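/- **Theorem.** The problem $\mathrm{SHAP}(\mathrm{WA},\mathrm{MARKOV})$ is solvable in polynomial time. *Objects.* Let $\Sigma$ be a finite alphabet. A weighted automaton $A$ with $\mathrm{size}(A)=s>0$ states consists of vectors $\alpha,\beta\in\mathbb R^s$ and matrices $A_\sigma\in\mathbb R^{s\times s}$ ($\sigma\in\Sigma$); it computes $f_A(w)=\alpha^{T}A_{w_1}\cdots A_{w_{|w|}}\beta$. A Markovian distribution $P$ with strictly positive parameters consists of a probability vector $P_{init}$ on $\Sigma$ and, for every $n>0$, a stochastic matrix $P_n$ indexed by $\Sigma\times\Sigma$, all entries being positive; for $w\in\Sigma^{\ell}$ put $P(w)=P_{init}(w_1)\prod_{j=1}^{\ell-1}P_j[w_j,w_{j+1}]$. It is polynomial-time computable if some machine outputs, on input $n>0$, the matrix $P_n$ in time at most $r(n+|\Sigma|)$, for a polynomial $r$. A pattern of length $\ell$ is a word $p$ of length $\ell$ over $\Sigma\cup\{\#\}$, $L_p$ is the set of words in $\Sigma^\ell$ that agree with $p$ wherever $p$ is not $\#$, and $\mathrm{swap}(p,i)$ is $p$ with its $i$-th element replaced by $\#$. For $w\in\Sigma^*$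 and $i\in\{1,\dots,|w|\}$ the SHAP score of $w_i$ is $$\mathrm{SHAP}(A,w,i,P)=\sum_{k=1}^{|w|-1}\frac{1}{|w|-k}\;\mathbb E_{p}\bigl[V(p)-V(\mathrm{swap}(p,i))\bigr],\qquad V(p)=\mathbb E_{w'\sim P}\bigl[f_A(w')\mid w'\in L_p\bigr],$$ where, in the $k$-th term, $p$ is uniformly distributed over the patterns of length $|w|$ with $w\in L_p$ and exactly $|w|-k$ occurrences of $\#$, and where $w'$ has length $|w|$. *Model.* Random access machines with registers and arrays of natural numbers and of field elements, the arithmetic operations of the field, and order tests. Operations on natural numbers are charged the binary length of the numbers involved. Exact operations on real numbers are charged one unit (a machine for $P_n$ may use finitely many built-in real constants); for rational inputs, all operations on rational numbers are charged the binary length of the numbers involved (fractions in lowest terms). *Claim.* There is one program, without built-in real constants, that takes as input $\Sigma$, $A$, $w$, $i$, $P_{init}$ and a machine for $n\mapsto P_n$, which it may run as a subroutine (the running time of which is counted), that always terminates with the exact value $\mathrm{SHAP}(A,w,i,P)$, and that runs in polynomial time in both of the following senses. For every polynomial $r$ there is a polynomial $q$ such that, whenever the machine for $P$ obeys the time bound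 $r(n+|\Sigma|)$: 1. on inputs over $\mathbb R$, with unit cost for real arithmetic, the time is at most $q(\mathrm{size}(A)+|\Sigma|+|w|)$; 2. on inputs over $\mathbb Q$, with bit cost throughout (also for the machine for $P$), the time is at most $q(\mathrm{size}(A)+|\Sigma|+|w|+B)$, where $B$ is the total binary length of the entries of $\alpha$, $\beta$, the $A_\sigma$ and $P_{init}$. Hence the problem is in FP. -/

import Mathlib

namespace ShapMarkov

noncomputable section

/-! ### Weighted automata, Markovian distributions and the SHAP score

The alphabet is `Fin m`.  The definitions make sense over any ordered field; they are used over
`ℝ`, and over `ℚ` for inputs that can be written down as bit strings. -/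

/-- Words of length `ℓ` over an alphabet with `m` symbols. -/
abbrev Word (m ℓ : ℕ) : Type := Fin ℓ → Fin m

/-- A weighted automaton with `size > 0` states, in its linear representation. -/
structure WA (K : Type) (m : ℕ) where
  size : ℕ
  size_pos : 0 < size
  init : Fin size → K
  trans : Fin m → Matrix (Fin size) (Fin size) K
  final : Fin size → K

/-- The language computed by a weighted automaton: `αᵀ · A_{w₁} ⋯ A_{w_ℓ} · β`. -/
def WA.eval {K : Type} [Field K] {m ℓ : ℕ} (A : WA K m) (w : Word m ℓ) : K :=
  A.init ⬝ᵥ ((List.ofFn fun j => A.trans (w j)).prod.mulVec A.final)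

/-- A Markovian distribution with strictly positive parameters: an initial distribution and, for
every position `n > 0`, a stochastic matrix `trans n` (the entry `trans 0` is never used). -/
structure Markov (K : Type) [Field K] [LinearOrder K] (m : ℕ) where
  init : Fin m → K
  trans : ℕ → Matrix (Fin m) (Fin m) K
  init_pos : ∀ a, 0 < init a
  init_sum : ∑ a, init a = 1
  trans_pos : ∀ n, 0 < n → ∀ a b, 0 < trans n a b
  trans_sum : ∀ n, 0 < n → ∀ a, ∑ b, trans n a b = 1

/-- The probability of a word: `P_init(w₁) ∏_{1 ≤ i < ℓ} P_i[w_i, w_{i+1}]` (positions of `w` are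
counted from `0` here). -/
def Markov.prob {K : Type} [Field K] [LinearOrder K] {m : ℕ} (P : Markov K m) :
    {ℓ : ℕ} → Word m ℓ → K
  | 0, _ => 1
  | ℓ + 1, w => P.init (w 0) * ∏ j : Fin ℓ, P.trans (j + 1) (w j.castSucc) (w j.succ)

/-- Patterns of length `ℓ`: words over the alphabet extended by the joker `#`, which is `none`. -/
abbrev Pattern (m ℓ : ℕ) : Type := Fin ℓ → Option (Fin m)

/-- The set `L_p` of words that match a pattern. -/
def Pattern.lang {m ℓ : ℕ} (p : Pattern m ℓ) : Finset (Word m ℓ) :=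
  Finset.univ.filter fun w => ∀ j, p j = none ∨ p j = some (w j)

/-- The number of occurrences of `#` in a pattern. -/
def Pattern.hashes {m ℓ : ℕ} (p : Pattern m ℓ) : ℕ :=
  (Finset.univ.filter fun j => p j = none).card

/-- Replace the `i`-th element of a pattern by `#`. -/
def Pattern.swap {m ℓ : ℕ} (p : Pattern m ℓ) (i : Fin ℓ) : Pattern m ℓ :=
  Function.update p i none

/-- The patterns that `w` matches and that have exactly `k` occurrences of `#`. -/
def patterns {m ℓ : ℕ} (w : Word m ℓ) (k : ℕ) : Finset (Pattern m ℓ) :=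
  Finset.univ.filter fun p => w ∈ p.lang ∧ p.hashes = k

section Score

variable {K : Type} [Field K] [LinearOrder K] {m ℓ : ℕ}

/-- The conditional expectation `E_{w' ∼ P} [f_A(w') | w' ∈ L_p]`, where `w'` has the length
of `p`. -/
def value (A : WA K m) (P : Markov K m) (p : Pattern m ℓ) : K :=
  (∑ w' ∈ p.lang, P.prob w' * A.eval w') / ∑ w' ∈ p.lang, P.prob w'

/-- The SHAP score of the `i`-th symbol of `w`. -/
def shap (A : WA K m) (w : Word m ℓ) (i : Fin ℓ) (P : Markov K m) : K :=
  ∑ k ∈ Finset.Icc 1 (ℓ - 1), 1 / ((ℓ - k : ℕ) : K) *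
    ((∑ p ∈ patterns w (ℓ - k), (value A P p - value A P (p.swap i))) /
      ((patterns w (ℓ - k)).card : K))

end Score

/-! ### The machine model

A random access machine with registers and arrays that hold natural numbers, and registers and
arrays that hold elements of an ordered field `K`.  Programs are `while`-programs.  There are no
operations that turn a field element into a natural number, other than branching on an order
test. -/

inductive NatOp
  | add | sub | mul

def NatOp.eval : NatOp → ℕ → ℕ → ℕ
  | .add, x, y => x + y
  | .sub, x, y => x - y
  | .mul, x, y => x * y

inductive FieldOp
  | add | sub | mul | div

def FieldOp.eval {K : Type} [Field K] : FieldOp → K → K → K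
  | .add, x, y => x + y
  | .sub, x, y => x - y
  | .mul, x, y => x * y
  | .div, x, y => x / y

/-- Programs.  Registers and arrays are named by numbers that are fixed in the program text.  The
letters `d` and `a`, `b`, `c` stand for registers and `T` for an array.  A program contains no
element of `K`. -/
inductive Com
  /-- do nothing -/
  | skip
  /-- `d := v`, for a numeral `v` -/
  | natConst (d v : ℕ)
  /-- `d := a op b`, on natural numbers -/
  | natOp (op : NatOp) (d a b : ℕ)
  /-- `d := T[a]`, natural numbers -/
  | natLoad (d T a : ℕ)
  /-- `T[a] := b`, natural numbers -/
  | natStore (T a b : ℕ)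
  /-- `d := a`, from a natural number to a field element -/
  | cast (d a : ℕ)
  /-- `d := a op b`, on field elements -/
  | fieldOp (op : FieldOp) (d a b : ℕ)
  /-- `d := T[a]`, field elements indexed by natural numbers -/
  | fieldLoad (d T a : ℕ)
  /-- `T[a] := b`, field elements indexed by natural numbers -/
  | fieldStore (T a b : ℕ)
  /-- call the external procedure with arguments `a`, `b` and copy the first `c` cells of its
  output to the array `T` of field elements -/
  | call (T a b c : ℕ)
  | seq (p q : Com)
  /-- `if a < b then p else q`, comparing natural numbers -/
  | ifNat (a b : ℕ) (p q : Com)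
  /-- `if a < b then p else q`, comparing field elements -/
  | ifField (a b : ℕ) (p q : Com)
  /-- `while a < b do p`, comparing natural numbers -/
  | whileNat (a b : ℕ) (p : Com)

/-- The memory of a machine. -/
structure State (K : Type) where
  nreg : ℕ → ℕ
  freg : ℕ → K
  narr : ℕ → ℕ → ℕ
  farr : ℕ → ℕ → K

section Machine

variable {K : Type} [Field K] [LinearOrder K]

def State.setN (s : State K) (d v : ℕ) : State K :=
  { s with nreg := Function.update s.nreg d v }

def State.setF (s : State K) (d : ℕ) (v : K) : State K :=
  { s with freg := Function.update s.freg d v }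

def State.storeN (s : State K) (T j v : ℕ) : State K :=
  { s with narr := Function.update s.narr T (Function.update (s.narr T) j v) }

def State.storeF (s : State K) (T j : ℕ) (v : K) : State K :=
  { s with farr := Function.update s.farr T (Function.update (s.farr T) j v) }

/-- Overwrite the first `len` cells of the array `T` by those of `out`. -/
def State.copyF (s : State K) (T len : ℕ) (out : ℕ → K) : State K :=
  { s with farr := Function.update s.farr T fun j => if j < len then out j else s.farr T j }

/-- An external procedure: `proc x y out t` says that on the arguments `x`, `y` it stops with the
output `out` after time `t`. -/
abbrev Proc (K : Type) : Type := ℕ → ℕ → (ℕ → K) → ℕ → Prop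

/-- `Exec sz proc p s s' t`: the program `p`, started in the state `s`, with calls answered by
`proc`, terminates in the state `s'` after time `t`.  An instruction costs one unit plus the sizes
of all numbers it handles: the binary length for natural numbers (addresses included) and `sz` for
field elements.  A call costs in addition the running time of the procedure. -/
inductive Exec (sz : K → ℕ) (proc : Proc K) : Com → State K → State K → ℕ → Prop
  | skip (s) : Exec sz proc .skip s s 1
  | natConst (s) (d v : ℕ) : Exec sz proc (.natConst d v) s (s.setN d v) (1 + v.size)
  | natOp (s) (op : NatOp) (d a b : ℕ) :
      Exec sz proc (.natOp op d a b) s (s.setN d (op.eval (s.nreg a) (s.nreg b)))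
        (1 + (s.nreg a).size + (s.nreg b).size + (op.eval (s.nreg a) (s.nreg b)).size)
  | natLoad (s) (d T a : ℕ) :
      Exec sz proc (.natLoad d T a) s (s.setN d (s.narr T (s.nreg a)))
        (1 + (s.nreg a).size + (s.narr T (s.nreg a)).size)
  | natStore (s) (T a b : ℕ) :
      Exec sz proc (.natStore T a b) s (s.storeN T (s.nreg a) (s.nreg b))
        (1 + (s.nreg a).size + (s.nreg b).size)
  | cast (s) (d a : ℕ) :
      Exec sz proc (.cast d a) s (s.setF d (s.nreg a : K))
        (1 + (s.nreg a).size + sz (s.nreg a : K))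
  | fieldOp (s) (op : FieldOp) (d a b : ℕ) :
      Exec sz proc (.fieldOp op d a b) s (s.setF d (op.eval (s.freg a) (s.freg b)))
        (1 + sz (s.freg a) + sz (s.freg b) + sz (op.eval (s.freg a) (s.freg b)))
  | fieldLoad (s) (d T a : ℕ) :
      Exec sz proc (.fieldLoad d T a) s (s.setF d (s.farr T (s.nreg a)))
        (1 + (s.nreg a).size + sz (s.farr T (s.nreg a)))
  | fieldStore (s) (T a b : ℕ) :
      Exec sz proc (.fieldStore T a b) s (s.storeF T (s.nreg a) (s.freg b))
        (1 + (s.nreg a).size + sz (s.freg b))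
  | call (s) (T a b c : ℕ) (out : ℕ → K) (t : ℕ) (h : proc (s.nreg a) (s.nreg b) out t) :
      Exec sz proc (.call T a b c) s (s.copyF T (s.nreg c) out)
        (1 + (s.nreg a).size + (s.nreg b).size + (s.nreg c).size + t +
          ∑ j ∈ Finset.range (s.nreg c), (1 + j.size + sz (out j)))
  | seq {p q : Com} {s₁ s₂ s₃ : State K} {t₁ t₂ : ℕ}
      (h₁ : Exec sz proc p s₁ s₂ t₁) (h₂ : Exec sz proc q s₂ s₃ t₂) :
      Exec sz proc (.seq p q) s₁ s₃ (t₁ + t₂)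
  | ifNat_true {a b : ℕ} {p q : Com} {s s' : State K} {t : ℕ}
      (hc : s.nreg a < s.nreg b) (h : Exec sz proc p s s' t) :
      Exec sz proc (.ifNat a b p q) s s' (1 + (s.nreg a).size + (s.nreg b).size + t)
  | ifNat_false {a b : ℕ} {p q : Com} {s s' : State K} {t : ℕ}
      (hc : ¬ s.nreg a < s.nreg b) (h : Exec sz proc q s s' t) :
      Exec sz proc (.ifNat a b p q) s s' (1 + (s.nreg a).size + (s.nreg b).size + t)
  | ifField_true {a b : ℕ} {p q : Com} {s s' : State K} {t : ℕ}
      (hc : s.freg a < s.freg b) (h : Exec sz proc p s s' t) :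
      Exec sz proc (.ifField a b p q) s s' (1 + sz (s.freg a) + sz (s.freg b) + t)
  | ifField_false {a b : ℕ} {p q : Com} {s s' : State K} {t : ℕ}
      (hc : ¬ s.freg a < s.freg b) (h : Exec sz proc q s s' t) :
      Exec sz proc (.ifField a b p q) s s' (1 + sz (s.freg a) + sz (s.freg b) + t)
  | while_false {a b : ℕ} {p : Com} {s : State K} (hc : ¬ s.nreg a < s.nreg b) :
      Exec sz proc (.whileNat a b p) s s (1 + (s.nreg a).size + (s.nreg b).size)
  | while_true {a b : ℕ} {p : Com} {s₁ s₂ s₃ : State K} {t₁ t₂ : ℕ}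
      (hc : s₁.nreg a < s₁.nreg b) (h₁ : Exec sz proc p s₁ s₂ t₁)
      (h₂ : Exec sz proc (.whileNat a b p) s₂ s₃ t₂) :
      Exec sz proc (.whileNat a b p) s₁ s₃
        (1 + (s₁.nreg a).size + (s₁.nreg b).size + t₁ + t₂)

/-! ### Machines that implement a Markovian distribution -/

/-- A machine: a program together with finitely many built-in constants from `K`. -/
structure Machine (K : Type) where
  code : Com
  consts : List K

/-- The start state: the arguments `x`, `y` are in the registers `0`, `1` for natural numbers, the
constants are in the registers for field elements, and everything else is `0`. -/
def Machine.start (Q : Machine K) (x y : ℕ) : State K where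
  nreg r := if r = 0 then x else if r = 1 then y else 0
  freg r := Q.consts.getD r 0
  narr _ _ := 0
  farr _ _ := 0

/-- The machine as a procedure, itself without access to an external procedure.  Its output is the
array `0` of field elements. -/
def Machine.run (sz : K → ℕ) (Q : Machine K) : Proc K := fun x y out t =>
  ∃ s' : State K, Exec sz (fun _ _ _ _ => False) Q.code (Q.start x y) s' t ∧ out = s'.farr 0

/-- On input `n > 0` (and the number `m` of symbols), the machine `Q` outputs the matrix `P_n`,
row by row, in time at most `r(n + m)`. -/
def Machine.Implements (sz : K → ℕ) (Q : Machine K) {m : ℕ} (P : Markov K m)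
    (r : Polynomial ℕ) : Prop :=
  ∀ n, 0 < n → ∃ out t, Q.run sz n m out t ∧ t ≤ r.eval (n + m) ∧
    ∀ a b : Fin m, out (a * m + b) = P.trans n a b

/-! ### The computational problem -/

/-- An instance of the problem: an alphabet with `m` symbols, a weighted automaton, a word, a
position in the word (counted from `0`), and a Markovian distribution together with a machine
for it. -/
structure Instance (K : Type) [Field K] [LinearOrder K] where
  m : ℕ
  A : WA K m
  len : ℕ
  w : Word m len
  i : Fin len
  P : Markov K m
  Q : Machine K

/-- The array with the given finitely many entries, followed by zeros. -/
def arrayOf {α : Type} [Zero α] {k : ℕ} (f : Fin k → α) : ℕ → α := fun j =>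
  if h : j < k then f ⟨j, h⟩ else 0

/-- The transition matrices of an automaton as one array; the entry `A_σ[x, y]` is at the index
`(σ * size + x) * size + y`. -/
def WA.transArray {m : ℕ} (A : WA K m) : ℕ → K :=
  arrayOf fun j : Fin ((m * A.size) * A.size) =>
    let u := finProdFinEquiv.symm j
    let v := finProdFinEquiv.symm u.1
    A.trans v.1 v.2 u.2

/-- The memory that holds an instance.  Registers: `size(A)`, `|Σ|`, `|w|` and the position.
Arrays: the word, and the initial vector, the final vector, the transition matrices of the
automaton and the initial distribution.  The machine for the transition matrices of the
distribution is present as the external procedure. -/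
def Instance.input (I : Instance K) : State K where
  nreg r := if r = 0 then I.A.size else if r = 1 then I.m else if r = 2 then I.len
    else if r = 3 then (I.i : ℕ) else 0
  freg _ := 0
  narr T := if T = 0 then arrayOf fun j => (I.w j : ℕ) else fun _ => 0
  farr T := if T = 0 then arrayOf I.A.init else if T = 1 then arrayOf I.A.final
    else if T = 2 then I.A.transArray else if T = 3 then arrayOf I.P.init else fun _ => 0

/-- The program `M`, on the instance `I`, terminates within time `t` with the SHAP score in the
register `0` for field elements. -/
def Solves (sz : K → ℕ) (M : Com) (I : Instance K) (t : ℕ) : Prop :=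
  ∃ s' t', Exec sz (I.Q.run sz) M I.input s' t' ∧ t' ≤ t ∧
    s'.freg 0 = shap I.A I.w I.i I.P

end Machine

/-- Sizes for the unit-cost measure on real numbers. -/
def unitSize : ℝ → ℕ := fun _ => 0

/-- The binary length of a rational number, written as a fraction in lowest terms. -/
def bitSize (q : ℚ) : ℕ := q.num.natAbs.size + q.den.size

/-- The total binary length of the numbers listed in an instance. -/
def Instance.bits (I : Instance ℚ) : ℕ :=
  ∑ x, bitSize (I.A.init x) + ∑ x, bitSize (I.A.final x) +
    ∑ a, ∑ x, ∑ y, bitSize (I.A.trans a x y) + ∑ a, bitSize (I.P.init a)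

end

end ShapMarkov

open ShapMarkov

/-! A pattern matched by `w` is determined by the set `S` of its fixed positions, so the score is a
weighted sum over exponentially many `S`. The obstacle is that each conditional expectation carries
its own denominator, the probability of `L_p`. By the Markov property this probability is a product
over `j ∈ S` of the probability of `w_j` given the last fixed symbol before `j`, and each factor
depends on `S` only through `j` and the position of that last fixed symbol (`Chain.fwd_trivial`,
`Stochastic.norm_eq`). A left-to-right dynamic programme can therefore divide by the factor at the
moment a position is fixed, and still add up all `S` that share the last fixed position, the number
of jokers, the current symbol and the automaton state.

Both kinds of step, joker and fixed symbol, are linear in the table. Hence the table is the sum over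
all `S` of the tables for a single `S` (`Chain.eTab_eq_sum`), and each of these is concentrated on
one pair of last position and joker count (`Chain.single_eq`). A joker at the distinguished position
is not counted and reverses the sign, so that the table directly yields the sum of the differences
`V(p) - V(swap(p,i))` (`Chain.result_eq_sum_sub`). Together with the bijection between patterns and
sets this gives `shap_eq`, where the number of patterns with `h` jokers is a binomial coefficient.

The programme is written in a small language of expressions whose compiled code is proved correct
with a time bound once and for all (`NExpr.runs`, `FExpr.runs`, `runs_fill`). Natural numbers stay
polynomially bounded in value. The sizes of field elements are controlled by an abstract `Grading`,
which is trivial for unit cost, so that one proof (`Prog.runs_main`) serves both cost measures.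

For bit cost the danger is that lengths double in every round. This does not happen: the divisors
are only the quadratically many probabilities `next` and the numbers `h * ℓ.choose h`, all of
moderate size. Multiplying a common denominator of the input by the numerators of the nonzero
divisors gives a number `D'` of polynomial length (`exists_denominator_inv`). The inverses of the
divisors, and then all values that occur, are integers over powers of `D'`, with exponents that grow
by a fixed amount per round. The number `D'` appears only in the analysis and is never computed. The
entries of the matrices `P_n` are not listed in the input; their lengths are bounded by the time in
which the machine writes them (`Exec.size_farr_le`). -/

namespace ShapMarkov

section

variable {K : Type} [Field K] [LinearOrder K]

/-! ### Total correctness with a time bound -/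

/-- Started in `s`, the program terminates within time `T` in a state that satisfies `Post`. -/
def Runs (sz : K → ℕ) (proc : Proc K) (p : Com) (s : State K) (T : ℕ) (Post : State K → Prop) :
    Prop :=
  ∃ s' t, Exec sz proc p s s' t ∧ t ≤ T ∧ Post s'

section Runs

variable {sz : K → ℕ} {proc : Proc K}

theorem Runs.mono {p : Com} {s : State K} {T T' : ℕ} {Q Q' : State K → Prop}
    (h : Runs sz proc p s T Q) (hT : T ≤ T') (hQ : ∀ s', Q s' → Q' s') :
    Runs sz proc p s T' Q' := by
  obtain ⟨s', t, he, ht, hq⟩ := h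
  exact ⟨s', t, he, ht.trans hT, hQ _ hq⟩

theorem Runs.seq {p q : Com} {s : State K} {T₁ T₂ : ℕ} {Q R : State K → Prop}
    (h₁ : Runs sz proc p s T₁ Q) (h₂ : ∀ s', Q s' → Runs sz proc q s' T₂ R) :
    Runs sz proc (.seq p q) s (T₁ + T₂) R := by
  obtain ⟨s', t, he, ht, hq⟩ := h₁
  obtain ⟨s'', t', he', ht', hr⟩ := h₂ s' hq
  exact ⟨s'', t + t', .seq he he', by omega, hr⟩

/-- A crude estimate is enough for the costs of natural numbers: all of them are indices and
counters of polynomial value, so the value itself may serve as a bound for the binary length. -/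
theorem size_le_self (n : ℕ) : n.size ≤ n := Nat.size_le.2 Nat.lt_two_pow_self

theorem size_le_of_le {n M : ℕ} (h : n ≤ M) : n.size ≤ M := (size_le_self n).trans h

theorem runs_natConst {s : State K} {d v U : ℕ} {Q : State K → Prop} (hU : 1 + v ≤ U)
    (h : Q (s.setN d v)) : Runs sz proc (.natConst d v) s U Q :=
  ⟨_, _, .natConst s d v, by have := size_le_self v; omega, h⟩

theorem runs_natOp {s : State K} {op : NatOp} {d a b U M : ℕ} {Q : State K → Prop}
    (ha : s.nreg a ≤ M) (hb : s.nreg b ≤ M) (hr : op.eval (s.nreg a) (s.nreg b) ≤ M)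
    (hU : 1 + 3 * M ≤ U) (h : Q (s.setN d (op.eval (s.nreg a) (s.nreg b)))) :
    Runs sz proc (.natOp op d a b) s U Q :=
  ⟨_, _, .natOp s op d a b, by
    have := size_le_of_le ha; have := size_le_of_le hb; have := size_le_of_le hr; omega, h⟩

/-- A loop that counts the register `v` up to the register `r`. -/
theorem runs_count {s : State K} {v r : ℕ} {body : Com} {n M U c : ℕ}
    (Inv : ℕ → State K → Prop) (hn : n ≤ M) (hU : 1 + 3 * M ≤ U)
    (hreg : ∀ t s, Inv t s → s.nreg v = t ∧ s.nreg r = n)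
    (hbody : ∀ t s, t < n → Inv t s → Runs sz proc body s (c * U) (Inv (t + 1)))
    (h0 : Inv 0 s) :
    Runs sz proc (.whileNat v r body) s ((M * (c + 1) + 1) * U) (Inv n) := by
  suffices H : ∀ k t s, t + k = n → Inv t s →
      Runs sz proc (.whileNat v r body) s ((k * (c + 1) + 1) * U) (Inv n) from
    (H n 0 s (by omega) h0).mono
      (Nat.mul_le_mul_right _ (Nat.add_le_add_right (Nat.mul_le_mul_right _ hn) _)) fun _ h => h
  intro k
  induction k with
  | zero =>
    intro t s ht hi
    obtain ⟨h1, h2⟩ := hreg t s hi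
    refine ⟨s, _, .while_false (by omega), ?_, by simpa [← ht] using hi⟩
    have := size_le_of_le (n := s.nreg v) (M := M) (by omega)
    have := size_le_of_le (n := s.nreg r) (M := M) (by omega)
    simp only [zero_mul, zero_add, one_mul]
    omega
  | succ k ih =>
    intro t s ht hi
    obtain ⟨h1, h2⟩ := hreg t s hi
    obtain ⟨s', τ, he, hτ, hi'⟩ := hbody t s (by omega) hi
    obtain ⟨s'', τ', he', hτ', hi''⟩ := ih (t + 1) s' (by omega) hi'
    refine ⟨s'', _, .while_true (by omega) he he', ?_, hi''⟩
    have := size_le_of_le (n := s.nreg v) (M := M) (by omega)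
    have := size_le_of_le (n := s.nreg r) (M := M) (by omega)
    -- Each round costs `c * U` for the body and `U` for the test; the last summand `U` pays for the
    -- test that fails.
    have e : ((k + 1) * (c + 1) + 1) * U = (k * (c + 1) + 1) * U + c * U + U := by ring
    omega

end Runs

/-! ### Expressions and their compilation -/

/-- The two states agree on the registers for natural numbers below `d` and on all arrays. -/
structure Agree (d : ℕ) (s s' : State K) : Prop where
  nreg : ∀ r < d, s'.nreg r = s.nreg r
  narr : s'.narr = s.narr
  farr : s'.farr = s.farr

theorem Agree.refl (d : ℕ) (s : State K) : Agree d s s := ⟨fun _ _ => rfl, rfl, rfl⟩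

theorem Agree.trans {d : ℕ} {s s' s'' : State K} (h : Agree d s s') (h' : Agree d s' s'') :
    Agree d s s'' :=
  ⟨fun r hr => (h'.nreg r hr).trans (h.nreg r hr), h'.narr.trans h.narr, h'.farr.trans h.farr⟩

theorem Agree.mono {d e : ℕ} {s s' : State K} (h : Agree e s s') (hd : d ≤ e) : Agree d s s' :=
  ⟨fun r hr => h.nreg r (hr.trans_le hd), h.narr, h.farr⟩

theorem Agree.setN {d r v : ℕ} {s s' : State K} (h : Agree d s s') (hr : d ≤ r) :
    Agree d s (s'.setN r v) :=
  ⟨fun x hx => by simp [State.setN, Function.update, h.nreg x hx, show x ≠ r by omega],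
    h.narr, h.farr⟩

theorem Agree.setF {d r : ℕ} {v : K} {s s' : State K} (h : Agree d s s') :
    Agree d s (s'.setF r v) := ⟨h.nreg, h.narr, h.farr⟩

@[simp] theorem State.setN_nreg (s : State K) (d v r : ℕ) :
    (s.setN d v).nreg r = if r = d then v else s.nreg r := by
  simp [State.setN, Function.update]

@[simp] theorem State.setN_freg (s : State K) (d v : ℕ) : (s.setN d v).freg = s.freg := rfl
@[simp] theorem State.setN_narr (s : State K) (d v : ℕ) : (s.setN d v).narr = s.narr := rfl
@[simp] theorem State.setN_farr (s : State K) (d v : ℕ) : (s.setN d v).farr = s.farr := rfl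

@[simp] theorem State.setF_freg (s : State K) (d : ℕ) (v : K) (r : ℕ) :
    (s.setF d v).freg r = if r = d then v else s.freg r := by
  simp [State.setF, Function.update]

@[simp] theorem State.setF_nreg (s : State K) (d : ℕ) (v : K) : (s.setF d v).nreg = s.nreg := rfl
@[simp] theorem State.setF_narr (s : State K) (d : ℕ) (v : K) : (s.setF d v).narr = s.narr := rfl
@[simp] theorem State.setF_farr (s : State K) (d : ℕ) (v : K) : (s.setF d v).farr = s.farr := rfl

/-- Expressions for natural numbers; variables are registers. -/
inductive NExpr
  | const (c : ℕ)
  | var (r : ℕ)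
  | op (o : NatOp) (a b : NExpr)
  | load (T : ℕ) (a : NExpr)
  | div (a b : NExpr)

namespace NExpr

def Scoped (d : ℕ) : NExpr → Prop
  | const _ => True
  | var r => r < d
  | op _ a b => a.Scoped d ∧ b.Scoped d
  | load _ a => a.Scoped d
  | div a b => a.Scoped d ∧ b.Scoped d

/-- The number of `q < a` with `(q + 1) * b ≤ a`; this is `a / b` when `b > 0`. -/
def quot (a b : ℕ) : ℕ := ∑ q ∈ Finset.range a, if (q + 1) * b < a + 1 then 1 else 0

theorem quot_le (a b n : ℕ) :
    ∑ q ∈ Finset.range n, (if (q + 1) * b < a + 1 then 1 else 0) ≤ n := by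
  calc _ ≤ ∑ q ∈ Finset.range n, 1 := Finset.sum_le_sum fun q _ => by split_ifs <;> omega
    _ = n := by simp

theorem quot_eq {a b : ℕ} (hb : 0 < b) : quot a b = a / b := by
  have h : ∀ q, (q + 1) * b < a + 1 ↔ q < a / b := fun q => by
    rw [Nat.lt_succ_iff, ← Nat.le_div_iff_mul_le hb, Nat.succ_le_iff]
  unfold quot
  simp only [h]
  rw [← Finset.sum_filter, Finset.sum_const, smul_eq_mul, mul_one]
  have : (Finset.range a).filter (fun q => q < a / b) = Finset.range (a / b) := by
    ext q
    simp only [Finset.mem_filter, Finset.mem_range, and_iff_right_iff_imp]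
    exact fun hq => hq.trans_le (Nat.div_le_self a b)
  rw [this, Finset.card_range]

def eval (s : State K) : NExpr → ℕ
  | const c => c
  | var r => s.nreg r
  | op o a b => o.eval (a.eval s) (b.eval s)
  | load T a => s.narr T (a.eval s)
  | div a b => quot (a.eval s) (b.eval s)

/-- A bound for all values that occur in the evaluation, if variables and arrays are bounded
by `V`. -/
def bnd (V : ℕ) : NExpr → ℕ
  | const c => c
  | var _ => V
  | op _ a b => a.bnd V + b.bnd V + a.bnd V * b.bnd V
  | load _ a => a.bnd V + V
  | div a b => a.bnd V + b.bnd V + a.bnd V * b.bnd V + 1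

/-- The unit is a budget `U` that covers any single instruction, and `M` bounds the number of rounds
of a loop. In the case of division, `6` counts the instructions of the loop body. -/
def steps (M : ℕ) : NExpr → ℕ
  | const _ => 1
  | var _ => 2
  | op _ a b => a.steps M + b.steps M + 1
  | load _ a => a.steps M + 1
  | div a b => a.steps M + b.steps M + (3 + (M * (6 + 1) + 1) + 1)

/-- Code that computes the value in the register `d`, without using lower registers. -/
def compile (d : ℕ) : NExpr → Com
  | const c => .natConst d c
  | var r => .seq (.natConst d 0) (.natOp .add d r d)
  | op o a b => .seq (.seq (a.compile d) (b.compile (d + 1))) (.natOp o d d (d + 1))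
  | load T a => .seq (a.compile d) (.natLoad d T d)
  | div a b =>
    .seq (.seq (a.compile d) (b.compile (d + 1)))
      (.seq (.seq (.seq (.seq (.natConst (d + 2) 0) (.natConst (d + 3) 0)) (.natConst (d + 4) 1))
        (.whileNat (d + 2) d
          (.seq (.seq (.seq (.seq
            (.natOp .add (d + 5) (d + 2) (d + 4))
            (.natOp .mul (d + 5) (d + 5) (d + 1)))
            (.natOp .add (d + 6) d (d + 4)))
            (.ifNat (d + 5) (d + 6) (.natOp .add (d + 3) (d + 3) (d + 4)) .skip))
            (.natOp .add (d + 2) (d + 2) (d + 4)))))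
        (.natOp .mul d (d + 3) (d + 4)))

theorem eval_congr {d : ℕ} {s s' : State K} (hr : ∀ r < d, s'.nreg r = s.nreg r)
    (hn : s'.narr = s.narr) : ∀ {e : NExpr}, e.Scoped d → e.eval s' = e.eval s
  | const _, _ => rfl
  | var r, hs => hr r hs
  | op o a b, hs => by simp only [eval, eval_congr hr hn hs.1, eval_congr hr hn hs.2]
  | load T a, hs => by simp only [eval, eval_congr hr hn (e := a) hs, hn]
  | div a b, hs => by simp only [eval, eval_congr hr hn hs.1, eval_congr hr hn hs.2]

theorem eval_le {d V : ℕ} {s : State K} (hV : ∀ r < d, s.nreg r ≤ V)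
    (hA : ∀ T j, s.narr T j ≤ V) : ∀ {e : NExpr}, e.Scoped d → e.eval s ≤ e.bnd V
  | const _, _ => le_rfl
  | var r, hs => hV r hs
  | op o a b, hs => by
    have h1 := eval_le hV hA hs.1
    have h2 := eval_le hV hA hs.2
    have h3 := Nat.mul_le_mul h1 h2
    cases o <;> simp only [eval, bnd, NatOp.eval] <;> omega
  | load T a, hs => by
    have := hA T (a.eval s)
    simp only [eval, bnd]; omega
  | div a b, hs => by
    have h1 := eval_le hV hA hs.1
    have h2 := quot_le (a.eval s) (b.eval s) (a.eval s)
    simp only [eval, bnd, quot]; omega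

theorem Scoped.mono {d d' : ℕ} (h : d ≤ d') : ∀ {e : NExpr}, e.Scoped d → e.Scoped d'
  | const _, _ => trivial
  | var _, hs => lt_of_lt_of_le hs h
  | op _ _ _, hs => ⟨hs.1.mono h, hs.2.mono h⟩
  | load _ a, hs => Scoped.mono (e := a) h hs
  | div _ _, hs => ⟨hs.1.mono h, hs.2.mono h⟩

/-- What the code of an expression guarantees. -/
def Post (s : State K) (d : ℕ) (v : ℕ) (s' : State K) : Prop :=
  Agree d s s' ∧ s'.freg = s.freg ∧ s'.nreg d = v

variable {sz : K → ℕ} {proc : Proc K}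

/-- The second operand is computed from the register `d + 1` on, so it leaves the first result in
`d` intact; and it does not see that result, because its variables are below `d`. -/
theorem runs_pair {U : ℕ} {a b : NExpr} {d : ℕ} {s : State K} {Ta Tb : ℕ} (hb : b.Scoped d)
    (iha : Runs sz proc (a.compile d) s (Ta * U) (Post s d (a.eval s)))
    (ihb : ∀ s', Agree d s s' → Runs sz proc (b.compile (d + 1)) s' (Tb * U)
      (Post s' (d + 1) (b.eval s'))) :
    Runs sz proc (.seq (a.compile d) (b.compile (d + 1))) s ((Ta + Tb) * U)
      (fun s' => Agree d s s' ∧ s'.freg = s.freg ∧ s'.nreg d = a.eval s ∧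
        s'.nreg (d + 1) = b.eval s) := by
  rw [Nat.add_mul]
  refine iha.seq fun s₁ h₁ => (ihb s₁ h₁.1).mono le_rfl fun s₂ h₂ => ?_
  refine ⟨h₁.1.trans (h₂.1.mono (by omega)), h₂.2.1.trans h₁.2.1,
    (h₂.1.nreg d (by omega)).trans h₁.2.2, h₂.2.2.trans (eval_congr h₁.1.nreg h₁.1.narr hb)⟩

end NExpr

end

/-! ### Correctness and cost of compiled expressions for natural numbers -/

section

variable {K : Type} [Field K] [LinearOrder K]
namespace NExpr
variable {sz : K → ℕ} {proc : Proc K}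

/-- The machine has no division of natural numbers; the quotient is found by counting the `q` that
satisfy the inequality in `quot`. Register `d + 2` runs over `q`, `d + 3` holds the partial count
and `d + 4` the number one. The number of rounds is the dividend, which is affordable because
indices have polynomial value. -/
theorem runs_quot {M U d : ℕ} {s : State K} (hU : 1 + 3 * M ≤ U) (hM : 1 ≤ M)
    (ha : s.nreg d + 1 ≤ M) (hab : s.nreg d * s.nreg (d + 1) ≤ M) :
    Runs sz proc (.seq (.seq (.seq (.seq (.natConst (d + 2) 0) (.natConst (d + 3) 0))
      (.natConst (d + 4) 1))
        (.whileNat (d + 2) d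
          (.seq (.seq (.seq (.seq
            (.natOp .add (d + 5) (d + 2) (d + 4))
            (.natOp .mul (d + 5) (d + 5) (d + 1)))
            (.natOp .add (d + 6) d (d + 4)))
            (.ifNat (d + 5) (d + 6) (.natOp .add (d + 3) (d + 3) (d + 4)) .skip))
            (.natOp .add (d + 2) (d + 2) (d + 4)))))
        (.natOp .mul d (d + 3) (d + 4))) s ((3 + (M * (6 + 1) + 1) + 1) * U)
      (Post s d (quot (s.nreg d) (s.nreg (d + 1)))) := by
  let Inv : ℕ → State K → Prop := fun t s' =>
    Agree (d + 2) s s' ∧ s'.freg = s.freg ∧ s'.nreg (d + 2) = t ∧ s'.nreg (d + 4) = 1 ∧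
      s'.nreg (d + 3) = ∑ q ∈ Finset.range t,
        if (q + 1) * s.nreg (d + 1) < s.nreg d + 1 then 1 else 0
  have e : (3 + (M * (6 + 1) + 1) + 1) * U = U + U + U + (M * (6 + 1) + 1) * U + U := by ring
  rw [e]
  refine Runs.seq (Q := Inv (s.nreg d)) (Runs.seq (Q := Inv 0) ?_ ?_) ?_
  · refine Runs.seq (Q := fun s' => Agree (d + 2) s s' ∧ s'.freg = s.freg ∧ s'.nreg (d + 2) = 0 ∧
        s'.nreg (d + 3) = 0) (Runs.seq (Q := fun s' => Agree (d + 2) s s' ∧ s'.freg = s.freg ∧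
        s'.nreg (d + 2) = 0) ?_ ?_) ?_
    · exact runs_natConst (by omega) ⟨(Agree.refl _ _).setN (by omega), rfl, by simp⟩
    · rintro s' ⟨h1, h2, h3⟩
      exact runs_natConst (by omega) ⟨h1.setN (by omega), h2, by simp [h3], by simp⟩
    · rintro s' ⟨h1, h2, h3, h4⟩
      exact runs_natConst (by omega) ⟨h1.setN (by omega), h2, by simp [h3], by simp, by simp [h4]⟩
  · intro s' hs'
    refine runs_count Inv (by omega) hU (fun t s'' h => ⟨h.2.2.1, h.1.nreg d (by omega)⟩) ?_ hs'
    rintro t s₁ ht ⟨h1, h2, h3, h4, h5⟩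
    have hd := h1.nreg d (by omega)
    have hd1 := h1.nreg (d + 1) (by omega)
    -- As `t` is below the dividend, this product never exceeds dividend times divisor.
    have hb : (t + 1) * s.nreg (d + 1) ≤ M :=
      (Nat.mul_le_mul_right _ (by omega)).trans hab
    have hq := quot_le (s.nreg d) (s.nreg (d + 1)) t
    rw [show 6 * U = U + U + U + (U + U) + U by ring]
    refine Runs.seq (Q := fun s₂ => Agree (d + 2) s s₂ ∧ s₂.freg = s.freg ∧ s₂.nreg (d + 2) = t ∧
      s₂.nreg (d + 4) = 1 ∧ s₂.nreg (d + 3) = ∑ q ∈ Finset.range (t + 1),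
        if (q + 1) * s.nreg (d + 1) < s.nreg d + 1 then 1 else 0) ?_ ?_
    · refine Runs.seq (Q := fun s₂ => Inv t s₂ ∧ s₂.nreg (d + 5) = (t + 1) * s.nreg (d + 1) ∧
        s₂.nreg (d + 6) = s.nreg d + 1) ?_ ?_
      · refine Runs.seq (Q := fun s₂ => Inv t s₂ ∧ s₂.nreg (d + 5) = (t + 1) * s.nreg (d + 1))
          (Runs.seq (Q := fun s₂ => Inv t s₂ ∧ s₂.nreg (d + 5) = (t + 1)) ?_ ?_) ?_
        · refine runs_natOp (M := M) (by omega) (by omega) (by simp [NatOp.eval]; omega) hU ?_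
          refine ⟨⟨h1.setN (by omega), h2, ?_, ?_, ?_⟩, ?_⟩ <;> simp [*, NatOp.eval]
        · rintro s₂ ⟨⟨h1, h2, h3, h4, h5⟩, h6⟩
          have hd1 := h1.nreg (d + 1) (by omega)
          have : s₂.nreg (d + 1) ≤ M := by
            have : 1 * s.nreg (d + 1) ≤ (t + 1) * s.nreg (d + 1) :=
              Nat.mul_le_mul_right _ (by omega)
            omega
          refine runs_natOp (M := M) (by omega) this (by simpa [NatOp.eval, h6, hd1]) hU ?_
          refine ⟨⟨h1.setN (by omega), h2, ?_, ?_, ?_⟩, ?_⟩ <;> simp [*, NatOp.eval]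
        · rintro s₂ ⟨⟨h1, h2, h3, h4, h5⟩, h6⟩
          have hd := h1.nreg d (by omega)
          refine runs_natOp (M := M) (by omega) (by omega) (by simp [NatOp.eval]; omega) hU ?_
          refine ⟨⟨h1.setN (by omega), h2, ?_, ?_, ?_⟩, ?_, ?_⟩ <;> simp [*, NatOp.eval]
      · rintro s₂ ⟨⟨h1, h2, h3, h4, h5⟩, h6, h7⟩
        have e1 := size_le_of_le (n := s₂.nreg (d + 5)) (M := M) (by omega)
        have e2 := size_le_of_le (n := s₂.nreg (d + 6)) (M := M) (by omega)
        by_cases hc : s₂.nreg (d + 5) < s₂.nreg (d + 6)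
        · obtain ⟨s₃, τ, h, hτ, hq⟩ : Runs sz proc (.natOp .add (d + 3) (d + 3) (d + 4)) s₂ U
              (fun s₂ => Agree (d + 2) s s₂ ∧ s₂.freg = s.freg ∧ s₂.nreg (d + 2) = t ∧
                s₂.nreg (d + 4) = 1 ∧ s₂.nreg (d + 3) = ∑ q ∈ Finset.range (t + 1),
                  if (q + 1) * s.nreg (d + 1) < s.nreg d + 1 then 1 else 0) := by
            refine runs_natOp (M := M) (by omega) (by omega) (by simp [NatOp.eval]; omega) hU ?_
            refine ⟨h1.setN (by omega), h2, by simp [*], by simp [*], ?_⟩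
            rw [h6, h7] at hc
            rw [Finset.sum_range_succ, if_pos hc, ← h5]
            simp [h4, NatOp.eval]
          exact ⟨s₃, _, .ifNat_true hc h, by omega, hq⟩
        · refine ⟨s₂, _, .ifNat_false hc (.skip _), by omega, h1, h2, h3, h4, ?_⟩
          rw [h6, h7] at hc
          rw [Finset.sum_range_succ, if_neg hc, h5, add_zero]
    · rintro s₂ ⟨h1, h2, h3, h4, h5⟩
      refine runs_natOp (M := M) (by omega) (by omega) (by simp [NatOp.eval]; omega) hU ?_
      exact ⟨h1.setN (by omega), h2, by simp [*, NatOp.eval], by simp [*], by simp [*]⟩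
  · rintro s' ⟨h1, h2, h3, h4, h5⟩
    have hq := quot_le (s.nreg d) (s.nreg (d + 1)) (s.nreg d)
    refine runs_natOp (M := M) (by omega) (by omega) (by simp [NatOp.eval, h4]; omega) hU ?_
    exact ⟨(h1.mono (by omega)).setN le_rfl, h2, by simp [NatOp.eval, h4, h5, quot]⟩

/-- The scope `d₀` and the first free register `d` are separate parameters, because the second
operand of an operation is compiled with a larger `d` while its variables keep their scope. -/
theorem runs {V M U : ℕ} (hU : 1 + 3 * M ≤ U) (hM : 1 ≤ M) :
    ∀ (e : NExpr) {d₀ d : ℕ} {s : State K}, e.Scoped d₀ → d₀ ≤ d → (∀ r < d₀, s.nreg r ≤ V) →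
    (∀ T j, s.narr T j ≤ V) → e.bnd V + 1 ≤ M →
    Runs sz proc (e.compile d) s (e.steps M * U) (Post s d (e.eval s))
  | const c, d₀, d, s, _, _, _, _, hb => by
    simp only [bnd] at hb
    simp only [steps, one_mul, compile]
    exact runs_natConst (by omega) ⟨(Agree.refl _ _).setN le_rfl, rfl, by simp [eval]⟩
  | var r, d₀, d, s, hs, hd, hV, _, hb => by
    simp only [bnd] at hb
    simp only [steps, compile]
    have := hV r hs
    have hne : r ≠ d := Nat.ne_of_lt (lt_of_lt_of_le hs hd)
    rw [two_mul]
    refine (runs_natConst (Q := fun s' => s' = s.setN d 0) (by omega) rfl).seq ?_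
    rintro _ rfl
    refine runs_natOp (M := M) (by simp [hne]; omega) (by simp) (by simp [NatOp.eval, hne]; omega)
      hU ⟨((Agree.refl _ _).setN le_rfl).setN le_rfl, rfl, by simp [eval, NatOp.eval, hne]⟩
  | op o a b, d₀, d, s, hs, hd, hV, hA, hb => by
    have h1 := eval_le hV hA hs.1
    have h2 := eval_le hV hA hs.2
    have h3 := eval_le hV hA (e := op o a b) hs
    simp only [bnd, eval] at hb h3
    simp only [steps, compile]
    rw [Nat.add_mul, one_mul]
    refine (runs_pair (hs.2.mono hd) (runs hU hM a hs.1 hd hV hA (by omega)) fun s' h =>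
      runs (V := V) hU hM b hs.2 (by omega) (fun r hr => ?_) (fun T j => ?_) (by omega)).seq ?_
    · rw [h.nreg r (by omega)]; exact hV r hr
    · rw [h.narr]; exact hA T j
    · rintro s' ⟨h4, h5, h6, h7⟩
      refine runs_natOp (M := M) (by omega) (by omega) (by rw [h6, h7]; omega) hU
        ⟨h4.setN le_rfl, h5, by simp [eval, h6, h7]⟩
  | load T a, d₀, d, s, hs, hd, hV, hA, hb => by
    have h1 := eval_le hV hA (e := a) hs
    simp only [bnd] at hb
    simp only [steps, compile]
    rw [Nat.add_mul, one_mul]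
    refine (runs hU hM a hs hd hV hA (by omega)).seq ?_
    rintro s' ⟨h4, h5, h6⟩
    refine ⟨_, _, .natLoad s' d T d, ?_, h4.setN le_rfl, h5, by simp [eval, h6, h4.narr]⟩
    have h7 : s'.narr T (s'.nreg d) ≤ V := by rw [h4.narr]; exact hA _ _
    have := size_le_of_le (h7.trans (show V ≤ M by omega))
    have := size_le_of_le (n := s'.nreg d) (M := M) (by omega)
    omega
  | div a b, d₀, d, s, hs, hd, hV, hA, hb => by
    have h1 := eval_le hV hA hs.1
    have h2 := eval_le hV hA hs.2
    have h3 := Nat.mul_le_mul h1 h2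
    simp only [bnd] at hb
    simp only [steps, compile]
    rw [Nat.add_mul]
    refine (runs_pair (hs.2.mono hd) (runs hU hM a hs.1 hd hV hA (by omega)) fun s' h =>
      runs (V := V) hU hM b hs.2 (by omega) (fun r hr => ?_) (fun T j => ?_) (by omega)).seq ?_
    · rw [h.nreg r (by omega)]; exact hV r hr
    · rw [h.narr]; exact hA T j
    · rintro s' ⟨h4, h5, h6, h7⟩
      refine (runs_quot hU hM (by omega) (by rw [h6, h7]; omega)).mono le_rfl ?_
      rintro s'' ⟨h8, h9, h10⟩
      exact ⟨h4.trans h8, h9.trans h5, by rw [h10, h6, h7]; rfl⟩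

end NExpr

/-! ### Expressions for field elements, with control of the size of all values -/

/-- A filtration of a field that is compatible with the arithmetic operations and controls the
sizes of numbers. Sums of at most `M` terms raise the degree by one. -/
structure Grading (sz : K → ℕ) (M B : ℕ) where
  Good : ℕ → K → Prop
  mono : ∀ {d e x}, d ≤ e → Good d x → Good e x
  add : ∀ {d e x y}, Good d x → Good e y → Good (max d e + 1) (x + y)
  sub : ∀ {d e x y}, Good d x → Good e y → Good (max d e + 1) (x - y)
  mul : ∀ {d e x y}, Good d x → Good e y → Good (d + e) (x * y)
  sum : ∀ {n d} {f : ℕ → K}, n ≤ M → (∀ i < n, Good d (f i)) →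
    Good (d + 1) (∑ i ∈ Finset.range n, f i)
  cast : ∀ {n : ℕ}, n ≤ M → Good 1 (n : K)
  size_le : ∀ {d x}, Good d x → sz x ≤ (d + 1) * B

/-- Expressions for field elements. -/
inductive FExpr
  | cast (a : NExpr)
  | load (T : ℕ) (a : NExpr)
  | op (o : FieldOp) (a b : FExpr)
  /-- `∑ v < r, e`, for registers `v` and `r` -/
  | sum (v r : ℕ) (e : FExpr)
  /-- `if a < b then p else q` -/
  | ite (a b : NExpr) (p q : FExpr)

namespace FExpr

/-- Only registers below `d` occur, and the variables that are bound are numbered consecutively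
from `d`. -/
def Scoped (d : ℕ) : FExpr → Prop
  | cast a => a.Scoped d
  | load _ a => a.Scoped d
  | op _ a b => a.Scoped d ∧ b.Scoped d
  | sum v r e => v = d ∧ r < d ∧ e.Scoped (d + 1)
  | ite a b p q => a.Scoped d ∧ b.Scoped d ∧ p.Scoped d ∧ q.Scoped d

/-- The array `T` does not occur. -/
def Avoids (T : ℕ) : FExpr → Prop
  | cast _ => True
  | load T' _ => T' ≠ T
  | op _ a b => a.Avoids T ∧ b.Avoids T
  | sum _ _ e => e.Avoids T
  | ite _ _ p q => p.Avoids T ∧ q.Avoids T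

def eval : FExpr → State K → K
  | cast a, s => (a.eval s : K)
  | load T a, s => s.farr T (a.eval s)
  | op o a b, s => o.eval (a.eval s) (b.eval s)
  | sum v r e, s => ∑ t ∈ Finset.range (s.nreg r), e.eval (s.setN v t)
  | ite a b p q, s => if a.eval s < b.eval s then p.eval s else q.eval s

def bnd (V : ℕ) : FExpr → ℕ
  | cast a => a.bnd V
  | load _ a => a.bnd V
  | op _ a b => a.bnd V + b.bnd V
  | sum _ _ e => e.bnd V + V
  | ite a b p q => a.bnd V + b.bnd V + p.bnd V + q.bnd V

def steps (M : ℕ) : FExpr → ℕ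
  | cast a => a.steps M + 1
  | load _ a => a.steps M + 1
  | op _ a b => a.steps M + b.steps M + 1
  | sum _ _ e => 2 + (M * (e.steps M + 3 + 1) + 1)
  | ite a b p q => a.steps M + b.steps M + (1 + p.steps M + q.steps M)

/-- The degree of the value, if the entries of the array `T` have degree `δ T` and inverses of
divisors have degree `δi`. -/
def deg (δ : ℕ → ℕ) (δi : ℕ) : FExpr → ℕ
  | cast _ => 1
  | load T _ => δ T
  | op .add a b => max (a.deg δ δi) (b.deg δ δi) + 1
  | op .sub a b => max (a.deg δ δi) (b.deg δ δi) + 1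
  | op .mul a b => a.deg δ δi + b.deg δ δi
  | op .div a b => max (a.deg δ δi + δi) (b.deg δ δi)
  | sum _ _ e => e.deg δ δi + 1
  | ite _ _ p q => max (p.deg δ δi) (q.deg δ δi)

/-- All divisors that occur have inverses of degree `δi`. -/
def Invertible {sz : K → ℕ} {M B : ℕ} (G : Grading sz M B) (δi : ℕ) : FExpr → State K → Prop
  | cast _, _ => True
  | load _ _, _ => True
  | op .div a b, s => a.Invertible G δi s ∧ b.Invertible G δi s ∧ G.Good δi (b.eval s)⁻¹
  | op .add a b, s => a.Invertible G δi s ∧ b.Invertible G δi s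
  | op .sub a b, s => a.Invertible G δi s ∧ b.Invertible G δi s
  | op .mul a b, s => a.Invertible G δi s ∧ b.Invertible G δi s
  | sum v r e, s => ∀ t < s.nreg r, e.Invertible G δi (s.setN v t)
  | ite a b p q, s =>
    (a.eval s < b.eval s → p.Invertible G δi s) ∧ (¬ a.eval s < b.eval s → q.Invertible G δi s)

/-- Code that computes the value in the register `f` for field elements, without using lower
registers for field elements or registers for natural numbers below `d`. -/
def compile : FExpr → ℕ → ℕ → Com
  | cast a, d, f => .seq (a.compile d) (.cast f d)
  | load T a, d, f => .seq (a.compile d) (.fieldLoad f T d)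
  | op o a b, d, f => .seq (.seq (a.compile d f) (b.compile d (f + 1))) (.fieldOp o f f (f + 1))
  | sum v r e, _, f =>
    .seq (.seq (.natConst v 0) (.cast f v))
      (.whileNat v r (.seq (.seq (.seq (e.compile (v + 1) (f + 1)) (.fieldOp .add f f (f + 1)))
        (.natConst (v + 1) 1)) (.natOp .add v v (v + 1))))
  | ite a b p q, d, f =>
    .seq (.seq (a.compile d) (b.compile (d + 1)))
      (.ifNat d (d + 1) (p.compile d f) (q.compile d f))

/-- The two states agree on everything that the expression `e` depends on, when its variables
are below `d`. -/
structure Same (e : FExpr) (d : ℕ) (s s' : State K) : Prop where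
  nreg : ∀ r < d, s'.nreg r = s.nreg r
  narr : s'.narr = s.narr
  farr : ∀ T, ¬ e.Avoids T → s'.farr T = s.farr T

theorem _root_.ShapMarkov.Agree.same {e : FExpr} {d : ℕ} {s s' : State K} (h : Agree d s s') :
    Same e d s s' := ⟨h.nreg, h.narr, fun _ _ => by rw [h.farr]⟩

theorem Same.sum {v r d t : ℕ} {e : FExpr} {s s' : State K} (h : Same (sum v r e) d s s')
    (hv : v = d) : Same e (d + 1) (s.setN v t) (s'.setN v t) where
  nreg x hx := by
    by_cases hxv : x = v
    · simp [hxv]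
    · simp [hxv, h.nreg x (by omega)]
  narr := h.narr
  farr := h.farr

theorem Same.imp {d : ℕ} {e e' : FExpr} {s s' : State K} (h : Same e d s s')
    (hi : ∀ T, e.Avoids T → e'.Avoids T) : Same e' d s s' :=
  ⟨h.nreg, h.narr, fun T hT => h.farr T fun hc => hT (hi T hc)⟩

/-- Agreement is required in the form `Same` and not `Agree`: in a `fill` the expression is
evaluated while an array that it does not read is being overwritten. -/
theorem eval_congr {e : FExpr} {d : ℕ} {s s' : State K} (hs : e.Scoped d)
    (h : Same e d s s') : e.eval s' = e.eval s := by
  induction e generalizing d s s' with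
  | cast a => simp only [eval, NExpr.eval_congr h.nreg h.narr (e := a) hs]
  | load T a =>
    simp only [eval, NExpr.eval_congr h.nreg h.narr (e := a) hs, h.farr T fun hc => hc rfl]
  | op o a b iha ihb =>
    simp only [eval, iha hs.1 (h.imp fun _ ht => ht.1), ihb hs.2 (h.imp fun _ ht => ht.2)]
  | sum v r e ih =>
    simp only [eval, h.nreg r hs.2.1]
    exact Finset.sum_congr rfl fun t _ => ih hs.2.2 (h.sum hs.1)
  | ite a b p q ihp ihq =>
    simp only [eval, NExpr.eval_congr h.nreg h.narr hs.1, NExpr.eval_congr h.nreg h.narr hs.2.1,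
      ihp hs.2.2.1 (h.imp fun _ ht => ht.1), ihq hs.2.2.2 (h.imp fun _ ht => ht.2)]

variable {sz : K → ℕ} {proc : Proc K} {M B : ℕ} {G : Grading sz M B} {δ : ℕ → ℕ} {δi V : ℕ}

theorem Invertible.congr {d : ℕ} {s s' : State K} {e : FExpr} (hs : e.Scoped d)
    (h : Same e d s s') (hi : e.Invertible G δi s) : e.Invertible G δi s' := by
  induction e generalizing d s s' with
  | cast a => trivial
  | load T a => trivial
  | op o a b iha ihb =>
    have hl := h.imp (e' := a) fun _ ht => ht.1
    have hr := h.imp (e' := b) fun _ ht => ht.2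
    cases o with
    | div =>
      refine ⟨iha hs.1 hl hi.1, ihb hs.2 hr hi.2.1, ?_⟩
      rw [eval_congr hs.2 hr]; exact hi.2.2
    | _ => exact ⟨iha hs.1 hl hi.1, ihb hs.2 hr hi.2⟩
  | sum v r e ih =>
    intro t ht
    rw [h.nreg r hs.2.1] at ht
    exact ih hs.2.2 (h.sum hs.1) (hi t ht)
  | ite a b p q ihp ihq =>
    refine ⟨fun hc => ihp hs.2.2.1 (h.imp fun _ ht => ht.1) (hi.1 ?_),
      fun hc => ihq hs.2.2.2 (h.imp fun _ ht => ht.2) (hi.2 ?_)⟩ <;>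
      simpa only [NExpr.eval_congr h.nreg h.narr hs.1, NExpr.eval_congr h.nreg h.narr hs.2.1]
        using hc

/-- The contents of the memory are bounded. -/
structure Bounded (G : Grading sz M B) (δ : ℕ → ℕ) (V d : ℕ) (s : State K) : Prop where
  nreg : ∀ r < d, s.nreg r ≤ V
  narr : ∀ T j, s.narr T j ≤ V
  farr : ∀ T j, G.Good (δ T) (s.farr T j)

theorem Bounded.congr {d d' : ℕ} {s s' : State K} (hd : d ≤ d') (h : Agree d' s s')
    (hb : Bounded G δ V d s) : Bounded G δ V d s' where
  nreg r hr := by rw [h.nreg r (by omega)]; exact hb.nreg r hr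
  narr := by rw [h.narr]; exact hb.narr
  farr := by rw [h.farr]; exact hb.farr

theorem Bounded.setN {d t : ℕ} {s : State K} (hb : Bounded G δ V d s) (ht : t ≤ V) :
    Bounded G δ V (d + 1) (s.setN d t) where
  nreg r hr := by
    by_cases h : r = d
    · simp [h, ht]
    · simpa [h] using hb.nreg r (by omega)
  narr := hb.narr
  farr := hb.farr

/-- The syntactic degree is an upper bound by induction. A quotient is treated as a product with an
inverse whose degree `δi` is supplied from outside, since the grading has no rule for inverses. -/
theorem eval_good {e : FExpr} {d : ℕ} {s : State K} (hs : e.Scoped d)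
    (hb : Bounded G δ V d s) (hM : e.bnd V ≤ M) (hi : e.Invertible G δi s) :
    G.Good (e.deg δ δi) (e.eval s) := by
  induction e generalizing d s with
  | cast a => exact G.cast ((NExpr.eval_le hb.nreg hb.narr (e := a) hs).trans hM)
  | load T a => exact hb.farr _ _
  | op o a b iha ihb =>
    simp only [bnd] at hM
    cases o with
    | div =>
      simp only [eval, FieldOp.eval, deg, div_eq_mul_inv]
      exact G.mono (le_max_left _ _) (G.mul (iha hs.1 hb (by omega) hi.1) hi.2.2)
    | add => exact G.add (iha hs.1 hb (by omega) hi.1) (ihb hs.2 hb (by omega) hi.2)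
    | sub => exact G.sub (iha hs.1 hb (by omega) hi.1) (ihb hs.2 hb (by omega) hi.2)
    | mul => exact G.mul (iha hs.1 hb (by omega) hi.1) (ihb hs.2 hb (by omega) hi.2)
  | sum v r e ih =>
    simp only [bnd] at hM
    obtain ⟨rfl, hr, he⟩ := hs
    have := hb.nreg r hr
    exact G.sum (by omega) fun t ht => ih he (hb.setN (by omega)) (by omega) (hi t ht)
  | ite a b p q ihp ihq =>
    simp only [bnd] at hM
    simp only [eval, deg]
    split_ifs with hc
    · exact G.mono (le_max_left _ _) (ihp hs.2.2.1 hb (by omega) (hi.1 hc))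
    · exact G.mono (le_max_right _ _) (ihq hs.2.2.2 hb (by omega) (hi.2 hc))

/-- Degrees never decrease from an operand to the result, so a bound for the whole expression also
covers the intermediate values. This is the reason for the maximum in the degree of a quotient,
where the degree of the divisor would otherwise be lost. -/
theorem deg_le_op_left (o : FieldOp) (a b : FExpr) : a.deg δ δi ≤ (op o a b).deg δ δi := by
  cases o <;> simp only [deg] <;> omega

theorem deg_le_op_right (o : FieldOp) (a b : FExpr) : b.deg δ δi ≤ (op o a b).deg δ δi := by
  cases o <;> simp only [deg] <;> omega

theorem Invertible.left {o : FieldOp} {a b : FExpr} {s : State K}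
    (h : (op o a b).Invertible G δi s) : a.Invertible G δi s := by
  cases o <;> exact h.1

theorem Invertible.right {o : FieldOp} {a b : FExpr} {s : State K}
    (h : (op o a b).Invertible G δi s) : b.Invertible G δi s := by
  cases o <;> first | exact h.2.1 | exact h.2

/-- What the code of an expression guarantees. -/
def Post (s : State K) (d f : ℕ) (v : K) (s' : State K) : Prop :=
  Agree d s s' ∧ (∀ r < f, s'.freg r = s.freg r) ∧ s'.freg f = v

theorem _root_.ShapMarkov.Grading.size_le_of_le (G : Grading sz M B) {d D : ℕ} {x : K}
    (h : G.Good d x) (hd : d ≤ D) : sz x ≤ (D + 1) * B :=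
  G.size_le (G.mono hd h)

/-- An arithmetic instruction handles at most three numbers, natural or from the field, which
explains the coefficients `3` in the budget `U`. -/
theorem runs {U D : ℕ} (hU : 1 + 3 * M + 3 * ((D + 1) * B) ≤ U) (hM : 1 ≤ M) :
    ∀ (e : FExpr) {d f : ℕ} {s : State K}, e.Scoped d → Bounded G δ V d s → e.bnd V + 1 ≤ M →
    e.deg δ δi ≤ D → e.Invertible G δi s →
    Runs sz proc (e.compile d f) s (e.steps M * U) (Post s d f (e.eval s))
  | cast a, d, f, s, hs, hb, hV, hD, hi => by
    have h1 := NExpr.eval_le hb.nreg hb.narr (e := a) hs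
    simp only [bnd, deg] at hV hD
    simp only [steps, compile]
    rw [Nat.add_mul, one_mul]
    refine (NExpr.runs (by omega) hM a hs le_rfl hb.nreg hb.narr hV).seq ?_
    rintro s' ⟨h4, h5, h6⟩
    refine ⟨_, _, .cast s' f d, ?_, h4.setF, fun r hr => ?_, by simp [eval, h6]⟩
    · rw [h6]
      have := size_le_of_le (h1.trans (show _ ≤ M by omega))
      have := G.size_le_of_le (G.cast (h1.trans (show _ ≤ M by omega))) hD
      omega
    · simp [hr.ne, h5]
  | load T a, d, f, s, hs, hb, hV, hD, hi => by
    have h1 := NExpr.eval_le hb.nreg hb.narr (e := a) hs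
    simp only [bnd, deg] at hV hD
    simp only [steps, compile]
    rw [Nat.add_mul, one_mul]
    refine (NExpr.runs (by omega) hM a hs le_rfl hb.nreg hb.narr hV).seq ?_
    rintro s' ⟨h4, h5, h6⟩
    refine ⟨_, _, .fieldLoad s' f T d, ?_, h4.setF, fun r hr => ?_, by simp [eval, h6, h4.farr]⟩
    · rw [h6, h4.farr]
      have := size_le_of_le (h1.trans (show _ ≤ M by omega))
      have := G.size_le_of_le (hb.farr T (a.eval s)) hD
      omega
    · simp [hr.ne, h5]
  | op o a b, d, f, s, hs, hb, hV, hD, hi => by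
    have ha := (deg_le_op_left o a b).trans hD
    have hb' := (deg_le_op_right o a b).trans hD
    have ho := G.size_le_of_le (eval_good hs hb (by omega) hi) hD
    simp only [bnd] at hV
    have ga := G.size_le_of_le (eval_good hs.1 hb (by omega) hi.left) ha
    have gb := G.size_le_of_le (eval_good hs.2 hb (by omega) hi.right) hb'
    simp only [steps, compile]
    rw [Nat.add_mul, Nat.add_mul, one_mul]
    refine Runs.seq (Q := fun s' => Agree d s s' ∧ (∀ r < f, s'.freg r = s.freg r) ∧
      s'.freg f = a.eval s ∧ s'.freg (f + 1) = b.eval s)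
      ((runs hU hM a hs.1 hb (by omega) ha hi.left).seq fun s₁ h₁ =>
        (runs hU hM b hs.2 (hb.congr le_rfl h₁.1) (by omega) hb'
          (hi.right.congr hs.2 h₁.1.same)).mono le_rfl ?_) ?_
    · rintro s₂ ⟨h4, h5, h6⟩
      exact ⟨h₁.1.trans h4, fun r hr => (h5 r (by omega)).trans (h₁.2.1 r hr),
        (h5 f (by omega)).trans h₁.2.2, h6.trans (eval_congr hs.2 h₁.1.same)⟩
    · rintro s₂ ⟨h4, h5, h6, h7⟩
      refine ⟨_, _, .fieldOp s₂ o f f (f + 1), ?_, h4.setF, fun r hr => ?_,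
        by simp [eval, h6, h7]⟩
      · rw [h6, h7]
        simp only [eval] at ho
        omega
      · simp [hr.ne, h5 r hr]
  | sum v r e, d, f, s, hs, hb, hV, hD, hi => by
    obtain ⟨rfl, hr, he⟩ := hs
    simp only [bnd] at hV
    simp only [deg] at hD
    have hn := hb.nreg r hr
    have hgood : ∀ t < s.nreg r, G.Good (e.deg δ δi) (e.eval (s.setN v t)) := fun t ht =>
      eval_good he (hb.setN (by omega)) (by omega) (hi t ht)
    -- The accumulator is estimated as one sum of `t` terms, which raises the degree by one only.
    -- Using the rule for a single addition `t` times would raise it by `t`.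
    have hpart : ∀ t ≤ s.nreg r, sz (∑ t ∈ Finset.range t, e.eval (s.setN v t)) ≤ (D + 1) * B :=
      fun t ht => G.size_le_of_le
        (G.sum (show t ≤ M by omega) fun i hi => hgood i (by omega)) hD
    simp only [steps, compile]
    rw [Nat.add_mul, two_mul]
    let Inv : ℕ → State K → Prop := fun t s' => Agree v s s' ∧ (∀ x < f, s'.freg x = s.freg x) ∧
      s'.nreg v = t ∧ s'.freg f = ∑ t ∈ Finset.range t, e.eval (s.setN v t)
    refine Runs.seq (Q := Inv 0) ((runs_natConst (Q := fun s' => s' = s.setN v 0)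
      (by omega) rfl).seq ?_) ?_
    · rintro _ rfl
      refine ⟨_, _, .cast _ f v, ?_, ((Agree.refl _ _).setN le_rfl).setF, fun x hx => ?_,
        by simp, by simp⟩
      · have := hpart 0 (by omega)
        simp only [Finset.range_zero, Finset.sum_empty] at this
        simp
        omega
      · simp [hx.ne]
    · intro s₁ h₁
      refine (runs_count (M := M) (n := s.nreg r) Inv (by omega) (by omega)
        (fun t s' h => ⟨h.2.2.1, h.1.nreg r hr⟩) ?_ h₁).mono le_rfl
        fun s' h => ⟨h.1, h.2.1, h.2.2.2⟩
      rintro t s₂ ht ⟨h4, h5, h6, h7⟩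
      -- In the round `t` the memory looks to the summand like the original one with `v` set to `t`,
      -- which is how the semantics of the sum evaluates it.
      have hag : Agree (v + 1) (s.setN v t) s₂ := ⟨fun x hx => by
        by_cases hxv : x = v
        · simp [hxv, h6]
        · simp [hxv, h4.nreg x (by omega)], h4.narr, h4.farr⟩
      rw [show (steps M e + 3) * U = steps M e * U + U + U + U by ring]
      have hb' : Bounded G δ V (v + 1) (s.setN v t) := hb.setN (by omega)
      refine Runs.seq (Runs.seq (Q := fun s' => Agree v s s' ∧ (∀ x < f, s'.freg x = s.freg x) ∧
        s'.nreg v = t ∧ s'.freg f = ∑ t ∈ Finset.range (t + 1), e.eval (s.setN v t))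
        (Runs.seq (runs hU hM e (f := f + 1) he (hb'.congr le_rfl hag) (by omega) (by omega)
        ((hi t ht).congr he hag.same)) ?_) ?_) ?_ (Q := fun s' =>
        (Agree v s s' ∧ (∀ x < f, s'.freg x = s.freg x) ∧
        s'.nreg v = t ∧ s'.freg f = ∑ t ∈ Finset.range (t + 1), e.eval (s.setN v t)) ∧
        s'.nreg (v + 1) = 1)
      · rintro s₃ ⟨h8, h9, h10⟩
        rw [eval_congr he hag.same] at h10
        have hf : s₃.freg f = ∑ t ∈ Finset.range t, e.eval (s.setN v t) :=
          (h9 f (by omega)).trans h7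
        have hsum : s₃.freg f + s₃.freg (f + 1) =
            ∑ t ∈ Finset.range (t + 1), e.eval (s.setN v t) := by
          rw [Finset.sum_range_succ, hf, h10]
        refine ⟨_, _, .fieldOp s₃ .add f f (f + 1), ?_, (h4.trans (h8.mono (by omega))).setF,
          fun x hx => ?_, (h8.nreg v (by omega)).trans h6, ?_⟩
        · simp only [FieldOp.eval, hsum]
          have h11 := hpart t (by omega)
          have h12 := hpart (t + 1) (by omega)
          have h13 := G.size_le_of_le (hgood t ht) (show _ ≤ D by omega)
          rw [hf, h10]
          omega
        · simp [hx.ne, h9 x (by omega), h5 x hx]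
        · simp only [State.setF_freg, if_true, FieldOp.eval, hsum]
      · rintro s₃ ⟨h8, h9, h10, h11⟩
        exact runs_natConst (by omega) ⟨⟨h8.setN (by omega), h9, by simp [h10], h11⟩, by simp⟩
      · rintro s₃ ⟨⟨h8, h9, h10, h11⟩, h12⟩
        exact runs_natOp (M := M) (by omega) (by omega) (by simp [NatOp.eval]; omega) (by omega)
          ⟨h8.setN (by omega), h9, by simp [NatOp.eval, h10, h12], h11⟩
  | ite a b p q, d, f, s, hs, hb, hV, hD, hi => by
    obtain ⟨hsa, hsb, hsp, hsq⟩ := hs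
    have h1 := NExpr.eval_le hb.nreg hb.narr hsa
    have h2 := NExpr.eval_le hb.nreg hb.narr hsb
    simp only [bnd] at hV
    simp only [deg] at hD
    simp only [steps, compile]
    rw [Nat.add_mul]
    refine (NExpr.runs_pair hsb (NExpr.runs (by omega) hM a hsa le_rfl hb.nreg hb.narr (by omega))
      fun s' h => NExpr.runs (V := V) (by omega) hM b hsb (by omega) (hb.congr le_rfl h).nreg
        (hb.congr le_rfl h).narr (by omega)).seq ?_
    rintro s₁ ⟨h4, h5, h6, h7⟩
    rw [Nat.add_mul, Nat.add_mul, one_mul]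
    have e1 := size_le_of_le (n := s₁.nreg d) (M := M) (by omega)
    have e2 := size_le_of_le (n := s₁.nreg (d + 1)) (M := M) (by omega)
    by_cases hc : a.eval s < b.eval s
    · obtain ⟨s₂, t, he, ht, h8, h9, h10⟩ : Runs sz proc (p.compile d f) s₁ (p.steps M * U)
          (Post s₁ d f (p.eval s₁)) := runs hU hM p hsp
        (hb.congr le_rfl h4) (by omega) (by omega) ((hi.1 hc).congr hsp h4.same)
      refine ⟨s₂, _, .ifNat_true (by omega) he, by omega, h4.trans h8, fun r hr => ?_, ?_⟩
      · rw [h9 r hr, h5]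
      · rw [h10, eval_congr hsp h4.same, eval, if_pos hc]
    · obtain ⟨s₂, t, he, ht, h8, h9, h10⟩ : Runs sz proc (q.compile d f) s₁ (q.steps M * U)
          (Post s₁ d f (q.eval s₁)) := runs hU hM q hsq
        (hb.congr le_rfl h4) (by omega) (by omega) ((hi.2 hc).congr hsq h4.same)
      refine ⟨s₂, _, .ifNat_false (by omega) he, by omega, h4.trans h8, fun r hr => ?_, ?_⟩
      · rw [h9 r hr, h5]
      · rw [h10, eval_congr hsq h4.same, eval, if_neg hc]

end FExpr

end

/-! ### Filling an array with the values of an expression -/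

section

variable {K : Type} [Field K] [LinearOrder K]

@[simp] theorem State.storeF_nreg (s : State K) (T j : ℕ) (v : K) :
    (s.storeF T j v).nreg = s.nreg := rfl
@[simp] theorem State.storeF_narr (s : State K) (T j : ℕ) (v : K) :
    (s.storeF T j v).narr = s.narr := rfl

/-- `for v < r do T[v] := e` -/
def fill (v T r : ℕ) (e : FExpr) : Com :=
  .seq (.natConst v 0) (.whileNat v r (.seq (.seq (.seq (e.compile (v + 1) 0) (.fieldStore T v 0))
    (.natConst (v + 1) 1)) (.natOp .add v v (v + 1))))

def fillSteps (M : ℕ) (e : FExpr) : ℕ := 1 + (M * (e.steps M + 3 + 1) + 1)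

/-- The memory after `fill v T r e`. -/
structure Filled (v T r : ℕ) (e : FExpr) (s s' : State K) : Prop where
  nreg : ∀ x < v, s'.nreg x = s.nreg x
  narr : s'.narr = s.narr
  other : ∀ T' ≠ T, s'.farr T' = s.farr T'
  cell : ∀ j, s'.farr T j = if j < s.nreg r then e.eval (s.setN v j) else s.farr T j

-- Since `e` does not read the array `T`, the cells already written do not influence the later ones,
-- and each cell receives the value of `e` in the original memory. The hypothesis `hT` keeps the
-- degree bounds for the arrays valid after the overwriting.
open FExpr in
theorem runs_fill {sz : K → ℕ} (proc : Proc K) {M B : ℕ} {G : Grading sz M B} {δ : ℕ → ℕ}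
    {δi V U D : ℕ} (hU : 1 + 3 * M + 3 * ((D + 1) * B) ≤ U) (hM : V + 1 ≤ M) {v T r : ℕ}
    {e : FExpr} {s : State K} (hr : r < v) (hs : e.Scoped (v + 1)) (ha : e.Avoids T)
    (hb : Bounded G δ V v s) (hV : e.bnd V + 1 ≤ M) (hD : e.deg δ δi ≤ D)
    (hT : e.deg δ δi ≤ δ T) (hi : ∀ t < s.nreg r, e.Invertible G δi (s.setN v t)) :
    Runs sz proc (fill v T r e) s (fillSteps M e * U)
      fun s' => Filled v T r e s s' ∧ Bounded G δ V v s' := by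
  have hn := hb.nreg r hr
  let Inv : ℕ → State K → Prop := fun t s' =>
    ((∀ x < v, s'.nreg x = s.nreg x) ∧ s'.narr = s.narr ∧ (∀ T' ≠ T, s'.farr T' = s.farr T') ∧
      ∀ j, s'.farr T j = if j < t then e.eval (s.setN v j) else s.farr T j) ∧ s'.nreg v = t
  have hgood : ∀ t < s.nreg r, G.Good (e.deg δ δi) (e.eval (s.setN v t)) := fun t ht =>
    eval_good hs (hb.setN (by omega)) (by omega) (hi t ht)
  have hbd : ∀ t s', t ≤ s.nreg r → Inv t s' → Bounded G δ V v s' := by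
    rintro t s' ht ⟨⟨h1, h2, h3, h4⟩, -⟩
    refine ⟨fun x hx => by rw [h1 x hx]; exact hb.nreg x hx, by rw [h2]; exact hb.narr,
      fun T' j => ?_⟩
    by_cases hT' : T' = T
    · subst hT'
      rw [h4]
      split_ifs with hj
      · exact G.mono hT (hgood j (by omega))
      · exact hb.farr _ _
    · rw [h3 T' hT']; exact hb.farr _ _
  simp only [fillSteps]
  rw [Nat.add_mul, one_mul]
  refine Runs.seq (Q := Inv 0) (runs_natConst (by omega) ⟨⟨fun x hx => by simp [hx.ne], rfl,
    fun _ _ => rfl, fun j => by simp⟩, by simp⟩) ?_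
  · intro s₁ h₁
    refine (runs_count (M := M) (n := s.nreg r) Inv (by omega) (by omega)
      (fun t s' h => ⟨h.2, h.1.1 r hr⟩) ?_ h₁).mono le_rfl
      fun s' h => ⟨⟨h.1.1, h.1.2.1, h.1.2.2.1, h.1.2.2.2⟩, hbd _ s' le_rfl h⟩
    rintro t s₂ ht hinv
    have hb₂ := hbd t s₂ ht.le hinv
    obtain ⟨⟨h4, h5, h6, h7⟩, h8⟩ := hinv
    have hag : Same e (v + 1) (s.setN v t) s₂ := ⟨fun x hx => by
      by_cases hxv : x = v
      · simp [hxv, h8]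
      · simp [hxv, h4 x (by omega)], h5, fun T' hT' => h6 T' fun hc => hT' (hc ▸ ha)⟩
    have hb' : Bounded G δ V (v + 1) s₂ := ⟨fun x hx => by
      by_cases hxv : x = v
      · rw [hxv, h8]; omega
      · exact hb₂.nreg x (by omega), hb₂.narr, hb₂.farr⟩
    rw [show (steps M e + 3) * U = steps M e * U + U + U + U by ring]
    let Inv' : State K → Prop := fun s' =>
      ((∀ x < v, s'.nreg x = s.nreg x) ∧ s'.narr = s.narr ∧ (∀ T' ≠ T, s'.farr T' = s.farr T') ∧
        ∀ j, s'.farr T j = if j < t + 1 then e.eval (s.setN v j) else s.farr T j) ∧ s'.nreg v = t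
    refine Runs.seq (Runs.seq (Q := Inv') (Runs.seq
      (runs hU (by omega) e hs hb' hV hD ((hi t ht).congr hs hag)) ?_) ?_) ?_ (Q := fun s' =>
        Inv' s' ∧ s'.nreg (v + 1) = 1)
    · rintro s₃ ⟨h9, h10, h11⟩
      rw [eval_congr hs hag] at h11
      have hv : s₃.nreg v = t := (h9.nreg v (by omega)).trans h8
      refine ⟨_, _, .fieldStore s₃ T v 0, ?_, ⟨⟨fun x hx => ?_, h9.narr.trans h5, fun T' hT' => ?_,
        fun j => ?_⟩, hv⟩⟩
      · rw [hv, h11]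
        have := size_le_of_le (n := t) (M := M) (by omega)
        have := G.size_le_of_le (hgood t ht) hD
        omega
      · rw [State.storeF_nreg, h9.nreg x (by omega), h4 x hx]
      · simp only [State.storeF, Function.update, hT', h9.farr, h6 T' hT', eq_rec_constant,
          dite_eq_ite, if_false]
      · simp only [State.storeF, Function.update_self, hv, h11, h9.farr]
        by_cases hj : j = t
        · simp [hj]
        · simp only [Function.update, hj, h7, eq_rec_constant, dite_eq_ite, if_false]
          congr 1
          exact propext (by omega)
    · rintro s₃ ⟨⟨h9, h10, h11, h12⟩, h13⟩
      exact runs_natConst (by omega) ⟨⟨⟨fun x hx => by simp [show x ≠ v + 1 by omega, h9 x hx],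
        h10, h11, h12⟩, by simp [h13]⟩, by simp⟩
    · rintro s₃ ⟨⟨⟨h9, h10, h11, h12⟩, h13⟩, h14⟩
      exact runs_natOp (M := M) (by omega) (by omega) (by simp [NatOp.eval]; omega) (by omega)
        ⟨⟨fun x hx => by simp [hx.ne, h9 x hx], h10, h11, h12⟩, by simp [NatOp.eval, h13, h14]⟩

end

section

/-! ### The dynamic programme -/

/-- An inhomogeneous Markov chain with a linear automaton reading its symbols, a word `w` and a
position `i`; everything is indexed by natural numbers. The chain starts in the symbol `0`, before
the first symbol is emitted. -/
structure Chain (K : Type) where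
  m : ℕ
  s : ℕ
  i : ℕ
  w : ℕ → ℕ
  α : ℕ → K
  β : ℕ → K
  A : ℕ → ℕ → ℕ → K
  P : ℕ → ℕ → ℕ → K

namespace Chain

variable {K : Type} [Field K] (c : Chain K)

/-- The probability of the symbol `u` after `j` steps, given that the last fixed symbol is the one
emitted in step `a` (none for `a = 0`). -/
def nTab : ℕ → ℕ → ℕ → K
  | 0, a, u => if a = 0 ∧ u = 0 then 1 else 0
  | j + 1, a, u => if a = j + 1 then (if u = c.w j then 1 else 0)
      else ∑ v ∈ Finset.range c.m, nTab j a v * c.P j v u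

/-- The probability that the next symbol is `u`. -/
def next (j a u : ℕ) : K := ∑ v ∈ Finset.range c.m, c.nTab j a v * c.P j v u

/-- Tables of row vectors, indexed by the last fixed position, the number of jokers and the current
symbol. -/
abbrev Tab (K : Type) : Type := ℕ → ℕ → ℕ → ℕ → K

/-- The part shared by both kinds of step: the chain moves to `u` and the automaton reads `u`,
before the last fixed position and the number of jokers are updated. -/
def base (j : ℕ) (E : Tab K) : Tab K := fun a k u x' =>
  ∑ v ∈ Finset.range c.m, ∑ x ∈ Finset.range c.s, E a k v x * c.P j v u * c.A u x x'

/-- The symbol `j` is a joker. For the distinguished position, the sign changes and the joker is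
not counted. -/
def hashStep (j : ℕ) (E : Tab K) : Tab K := fun a k u x =>
  if a < j + 1 then
    (if j = c.i then -c.base j E a k u x else if k = 0 then 0 else c.base j E a (k - 1) u x)
  else 0

/-- The symbol `j` is fixed. -/
def fixStep (j : ℕ) (E : Tab K) : Tab K := fun a k u x =>
  if a = j + 1 ∧ u = c.w j then
    ∑ b ∈ Finset.range (j + 1), c.base j E b k (c.w j) x / c.next j b (c.w j) else 0

def start : Tab K := fun a k u x => if a = 0 ∧ k = 0 ∧ u = 0 then c.α x else 0

def eTab : ℕ → Tab K
  | 0 => c.start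
  | j + 1 => fun a k u x => c.hashStep j (eTab j) a k u x + c.fixStep j (eTab j) a k u x

/-- The contribution of one set of fixed positions to `eTab`. -/
def single (S : Finset ℕ) : ℕ → Tab K
  | 0 => c.start
  | j + 1 => if j ∈ S then c.fixStep j (single S j) else c.hashStep j (single S j)

/-- Only the part of `S` below `j` has been looked at after `j` steps. -/
theorem single_congr {S S' : Finset ℕ} {j : ℕ} (h : ∀ t < j, t ∈ S ↔ t ∈ S') :
    c.single S j = c.single S' j := by
  induction j with
  | zero => rfl
  | succ j ih => simp only [single, ih fun t ht => h t (by omega), h j (by omega)]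

/-- Linearity of the steps in the table is what allows one table to process all sets of fixed
positions at the same time. -/
theorem base_sum {ι : Type} (F : Finset ι) (j : ℕ) (E : ι → Tab K) :
    c.base j (fun a k u x => ∑ S ∈ F, E S a k u x) =
      fun a k u x => ∑ S ∈ F, c.base j (E S) a k u x := by
  funext a k u x'
  simp only [base, Finset.sum_mul]
  rw [Finset.sum_comm]
  conv_rhs => rw [Finset.sum_comm]; enter [2, v]; rw [Finset.sum_comm]
  rw [Finset.sum_comm]

theorem hashStep_sum {ι : Type} (F : Finset ι) (j : ℕ) (E : ι → Tab K) :
    c.hashStep j (fun a k u x => ∑ S ∈ F, E S a k u x) =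
      fun a k u x => ∑ S ∈ F, c.hashStep j (E S) a k u x := by
  funext a k u x
  simp only [hashStep, base_sum]
  split_ifs <;> simp

theorem fixStep_sum {ι : Type} (F : Finset ι) (j : ℕ) (E : ι → Tab K) :
    c.fixStep j (fun a k u x => ∑ S ∈ F, E S a k u x) =
      fun a k u x => ∑ S ∈ F, c.fixStep j (E S) a k u x := by
  funext a k u x
  simp only [fixStep, base_sum, Finset.sum_div]
  split_ifs
  · rw [Finset.sum_comm]
  · simp

/-- Expanding the sum of a joker step and a fixing step at every position, by linearity, produces
one term for each choice of the fixed positions. The subsets of `range (j + 1)` split according to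
whether they contain `j`. -/
theorem eTab_eq_sum (j : ℕ) :
    c.eTab j = fun a k u x => ∑ S ∈ (Finset.range j).powerset, c.single S j a k u x := by
  induction j with
  | zero => simp [eTab, single]
  | succ j ih =>
    funext a k u x
    rw [Finset.range_add_one, Finset.sum_powerset_insert (by simp)]
    simp only [eTab, ih, hashStep_sum, fixStep_sum]
    congr 1 <;> refine Finset.sum_congr rfl fun S hS => ?_
    · have : j ∉ S := fun h => by simpa using Finset.mem_powerset.1 hS h
      simp [single, this]
    · have : c.single (insert j S) j = c.single S j := c.single_congr fun t ht => by
        simp [ht.ne]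
      simp [single, this]

/-- The unnormalised row vectors for one set of fixed positions. -/
def fwd (S : Finset ℕ) : ℕ → ℕ → ℕ → K
  | 0, u, x => if u = 0 then c.α x else 0
  | j + 1, u, x' => if j ∈ S ∧ u ≠ c.w j then 0 else
      ∑ v ∈ Finset.range c.m, ∑ x ∈ Finset.range c.s, fwd S j v x * c.P j v u * c.A u x x'

/-- Positions are shifted by one here, so that `0` can stand for the absence of a fixed symbol. -/
def last (S : Finset ℕ) : ℕ → ℕ
  | 0 => 0
  | j + 1 => if j ∈ S then j + 1 else last S j

/-- The probability of the fixed symbols. -/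
def norm (S : Finset ℕ) : ℕ → K
  | 0 => 1
  | j + 1 => if j ∈ S then norm S j * c.next j (last S j) (c.w j) else norm S j

/-- The number of jokers at positions other than `i`. -/
def count (S : Finset ℕ) : ℕ → ℕ
  | 0 => 0
  | j + 1 => if j ∈ S ∨ j = c.i then count S j else count S j + 1

/-- The sign turns a sum over all `S` into a sum of differences, between `S` with `i` fixed and `S`
with `i` a joker. -/
def sign (S : Finset ℕ) : ℕ → K
  | 0 => 1
  | j + 1 => if j ∉ S ∧ j = c.i then -sign S j else sign S j

theorem last_le (S : Finset ℕ) (j : ℕ) : last S j ≤ j := by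
  induction j with
  | zero => rfl
  | succ j ih => simp only [last]; split_ifs <;> omega

theorem base_single (S : Finset ℕ) (j a k u x : ℕ)
    (h : c.single S j = fun a k u x => if a = last S j ∧ k = c.count S j then
      c.sign S j * c.fwd S j u x / c.norm S j else 0) :
    c.base j (c.single S j) a k u x = if a = last S j ∧ k = c.count S j then
      c.sign S j * (∑ v ∈ Finset.range c.m, ∑ y ∈ Finset.range c.s,
        c.fwd S j v y * c.P j v u * c.A u y x) / c.norm S j else 0 := by
  simp only [base, h]
  split_ifs
  · simp only [Finset.mul_sum, Finset.sum_div]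
    exact Finset.sum_congr rfl fun v _ => Finset.sum_congr rfl fun y _ => by ring
  · simp

/-- The fixing step sums over every possible previous position `b`, but for a single `S` only `b =
last S j` contributes. Its divisor is then exactly the new factor of `norm`. This is where it
matters that the factor depends on `S` only through the last fixed position. -/
theorem single_eq (S : Finset ℕ) (j : ℕ) :
    c.single S j = fun a k u x => if a = last S j ∧ k = c.count S j then
      c.sign S j * c.fwd S j u x / c.norm S j else 0 := by
  induction j with
  | zero =>
    funext a k u x
    simp only [single, start, last, count, sign, fwd, norm, div_one, one_mul]
    split_ifs <;> tauto
  | succ j ih =>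
    funext a k u x
    have hl := last_le S j
    by_cases hj : j ∈ S
    · simp only [single, hj, if_true, fixStep, base_single c S j _ _ _ _ ih, last, count, sign,
        fwd, norm, true_or, not_true, false_and, if_false, true_and]
      by_cases ha : a = j + 1
      · by_cases hu : u = c.w j
        · by_cases hk : k = c.count S j
          · subst hu
            simp only [ha, hk, and_true, if_true, ne_eq, not_true, if_false, ite_div,
              zero_div, Finset.sum_ite_eq', Finset.mem_range, show last S j < j + 1 by omega]
            rw [div_div]
          · simp [hk]
        · simp [hu]
      · simp [ha]
    · simp only [single, hj, if_false, hashStep, base_single c S j _ _ _ _ ih, last, count, sign,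
        fwd, norm, false_or, false_and, not_false_eq_true, true_and]
      by_cases hi : j = c.i
      · have hl := last_le S c.i
        simp only [hi, if_true]
        by_cases ha : a = last S c.i ∧ k = c.count S c.i
        · rw [if_pos ha, if_pos (by omega), if_pos ha]; ring
        · simp [ha]
      · simp only [hi, if_false]
        by_cases ha : a = last S j ∧ k = c.count S j + 1
        · rw [if_pos (by omega), if_neg (by omega), if_pos (by omega), if_pos ha]
        · rw [if_neg ha]
          split_ifs <;> first | rfl | omega

end Chain

end

/-! ### From the last table to differences of conditional expectations -/

section

namespace Chain
variable {K : Type} [Field K] (c : Chain K)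

/-- The row vectors of the last step, evaluated at the final vector. -/
def result (ℓ k : ℕ) : K := ∑ a ∈ Finset.range (ℓ + 1), ∑ u ∈ Finset.range c.m,
  ∑ x ∈ Finset.range c.s, c.eTab ℓ a k u x * c.β x

/-- The conditional expectation, given that the symbols in `S` are those of `w`. -/
def val (ℓ : ℕ) (S : Finset ℕ) : K :=
  (∑ u ∈ Finset.range c.m, ∑ x ∈ Finset.range c.s, c.fwd S ℓ u x * c.β x) / c.norm S ℓ

/-- For each `S` the sum over `a` has at most one nonzero term, at `last S ℓ`, which lies in the
range because it is at most `ℓ`. -/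
theorem result_eq (ℓ k : ℕ) : c.result ℓ k = ∑ S ∈ (Finset.range ℓ).powerset,
    if k = c.count S ℓ then c.sign S ℓ * c.val ℓ S else 0 := by
  have h : ∀ S, ∑ a ∈ Finset.range (ℓ + 1), ∑ u ∈ Finset.range c.m, ∑ x ∈ Finset.range c.s,
      c.single S ℓ a k u x * c.β x =
      if k = c.count S ℓ then c.sign S ℓ * c.val ℓ S else 0 := fun S => by
    rw [Finset.sum_eq_single (last S ℓ)]
    · simp only [single_eq, true_and]
      split_ifs
      · rw [val, ← mul_div_assoc, Finset.mul_sum, Finset.sum_div]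
        refine Finset.sum_congr rfl fun u _ => ?_
        rw [Finset.mul_sum, Finset.sum_div]
        exact Finset.sum_congr rfl fun x _ => by ring
      · simp
    · intro a _ ha
      simp [single_eq, ha]
    · intro ha
      exact absurd (Finset.mem_range.2 (Nat.lt_succ_of_le (last_le S ℓ))) ha
  simp only [← h, result, eTab_eq_sum, Finset.sum_mul]
  conv_rhs => rw [Finset.sum_comm]; enter [2, a]; rw [Finset.sum_comm]; enter [2, u]; rw [Finset.sum_comm]

theorem count_eq (S : Finset ℕ) (ℓ : ℕ) :
    c.count S ℓ = ((Finset.range ℓ).filter fun t => t ∉ S ∧ t ≠ c.i).card := by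
  induction ℓ with
  | zero => rfl
  | succ ℓ ih =>
    rw [Finset.range_add_one, Finset.filter_insert, count, ih]
    by_cases h : ℓ ∈ S ∨ ℓ = c.i
    · rw [if_pos h, if_neg (by tauto)]
    · rw [if_neg h, if_pos (by tauto), Finset.card_insert_of_notMem (by simp)]

theorem sign_eq (S : Finset ℕ) (ℓ : ℕ) :
    c.sign S ℓ = if c.i < ℓ ∧ c.i ∉ S then -1 else 1 := by
  induction ℓ with
  | zero => simp [sign]
  | succ ℓ ih =>
    rw [sign, ih]
    by_cases h : ℓ = c.i
    · subst h
      by_cases hS : c.i ∈ S <;> simp [hS]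
    · rw [if_neg (by tauto)]
      congr 1
      exact propext ⟨fun ⟨h1, h2⟩ => ⟨by omega, h2⟩, fun ⟨h1, h2⟩ => ⟨by omega, h2⟩⟩

/-- The sum, over the patterns in which the symbol `i` is fixed and with `k` jokers, of the change
of the conditional expectation when the symbol `i` is replaced by a joker. -/
theorem result_eq_sum_sub {ℓ : ℕ} (hi : c.i < ℓ) (k : ℕ) :
    c.result ℓ k = ∑ S ∈ ((Finset.range ℓ).erase c.i).powerset,
      if k = ℓ - 1 - S.card then c.val ℓ (insert c.i S) - c.val ℓ S else 0 := by
  have hr : Finset.range ℓ = insert c.i ((Finset.range ℓ).erase c.i) := by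
    rw [Finset.insert_erase (Finset.mem_range.2 hi)]
  rw [result_eq]
  conv_lhs => rw [hr]
  -- Each `S` without `i` is paired with `insert i S`. Both have the same count, because a joker at
  -- `i` is not counted, and their signs are opposite.
  rw [Finset.sum_powerset_insert (by simp), ← Finset.sum_add_distrib]
  refine Finset.sum_congr rfl fun S hS => ?_
  have hS' := Finset.mem_powerset.1 hS
  have hiS : c.i ∉ S := fun h => by simpa using hS' h
  have hcard : ((Finset.range ℓ).erase c.i \ S).card = ℓ - 1 - S.card := by
    rw [Finset.card_sdiff_of_subset hS', Finset.card_erase_of_mem (Finset.mem_range.2 hi),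
      Finset.card_range]
  have h1 : c.count S ℓ = ℓ - 1 - S.card := by
    rw [count_eq, ← hcard]
    congr 1
    ext t
    simp only [Finset.mem_filter, Finset.mem_sdiff, Finset.mem_erase]
    tauto
  have h2 : c.count (insert c.i S) ℓ = ℓ - 1 - S.card := by
    rw [count_eq, ← hcard]
    congr 1
    ext t
    simp only [Finset.mem_filter, Finset.mem_sdiff, Finset.mem_erase, Finset.mem_insert]
    tauto
  rw [h1, h2, sign_eq, sign_eq]
  simp only [hi, hiS, not_false_eq_true, and_self, if_true, Finset.mem_insert, true_or, not_true,
    and_false, if_false]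
  split_ifs <;> ring

/-! ### Normalisation -/

/-- The chain without the automaton. -/
def trivial : Chain K := { c with s := 1, α := fun _ => 1, β := fun _ => 1, A := fun _ _ _ => 1 }

/-- The Markov property: the mass of the words that fit `S` and end in `u` is the probability of the
fixed symbols times the conditional probability of `u` given the last of them. At a fixed position
the conditional law collapses to a point mass, and the factor `next` passes into `norm`. The trivial
automaton has the single state `0`. -/
theorem fwd_trivial (S : Finset ℕ) (j u : ℕ) :
    c.trivial.fwd S j u 0 = c.norm S j * c.nTab j (last S j) u := by
  induction j generalizing u with
  | zero => simp [fwd, norm, last, nTab, trivial]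
  | succ j ih =>
    have hl := last_le S j
    have h : ∑ v ∈ Finset.range c.trivial.m, ∑ x ∈ Finset.range c.trivial.s,
        c.trivial.fwd S j v x * c.trivial.P j v u * c.trivial.A u x 0 =
        c.norm S j * c.next j (last S j) u := by
      rw [next, Finset.mul_sum]
      refine Finset.sum_congr rfl fun v _ => ?_
      simp only [show c.trivial.s = 1 from rfl, Finset.sum_range_one, ih]
      simp [trivial, mul_assoc]
    rw [fwd, h]
    by_cases hj : j ∈ S
    · by_cases hu : u = c.w j
      · subst hu
        simp [hj, norm, last, nTab, trivial]
      · simp [hj, hu, norm, last, nTab, trivial]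
    · have : last S j ≠ j + 1 := by omega
      simp [hj, norm, last, nTab, this, next]

/-- The transition probabilities sum up to `1` up to step `ℓ`, and `w` is a word. -/
structure Stochastic (ℓ : ℕ) : Prop where
  w_lt : ∀ j < ℓ, c.w j < c.m
  m_pos : 0 < c.m
  init : ∑ u ∈ Finset.range c.m, c.P 0 0 u = 1
  step : ∀ j < ℓ, 0 < j → ∀ v < c.m, ∑ u ∈ Finset.range c.m, c.P j v u = 1

variable {c} {ℓ : ℕ}

/-- The restriction `a ≤ j` is needed: no symbol beyond step `j` can have been fixed yet, and there
`nTab` vanishes. -/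
theorem Stochastic.sum_nTab (h : c.Stochastic ℓ) {j a : ℕ} (hj : j ≤ ℓ) (ha : a ≤ j) :
    ∑ u ∈ Finset.range c.m, c.nTab j a u = 1 := by
  induction j with
  | zero =>
    obtain rfl : a = 0 := by omega
    simp [nTab, h.m_pos.ne']
  | succ j ih =>
    simp only [nTab]
    by_cases haj : a = j + 1
    · simp [haj, h.w_lt j (by omega)]
    · simp only [haj, if_false]
      -- The step `0` is treated separately, since only the row of the starting symbol `0` is
      -- assumed to sum to one.
      rcases Nat.eq_zero_or_pos j with rfl | hj0
      · obtain rfl : a = 0 := by omega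
        rw [← h.init]
        exact Finset.sum_congr rfl fun u _ => by simp [nTab, h.m_pos]
      · rw [Finset.sum_comm, ← ih (by omega) (by omega)]
        refine Finset.sum_congr rfl fun v hv => ?_
        rw [← Finset.mul_sum, h.step j (by omega) hj0 v (Finset.mem_range.1 hv), mul_one]

/-- Summing `fwd_trivial` over the last symbol removes the conditional law. Thus the product of
conditional probabilities by which the programme divides is the total mass of the words that fit
`S`. -/
theorem Stochastic.norm_eq (h : c.Stochastic ℓ) (S : Finset ℕ) :
    c.norm S ℓ = ∑ u ∈ Finset.range c.m, c.trivial.fwd S ℓ u 0 := by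
  simp only [fwd_trivial, ← Finset.mul_sum, h.sum_nTab le_rfl (last_le S ℓ), mul_one]

end Chain

end

section

/-! ### Sums over words -/

/-- The last symbol of a word, and `0` for the empty word. -/
def lastSym {m : ℕ} : {j : ℕ} → Word m j → ℕ
  | 0, _ => 0
  | j + 1, v => v (Fin.last j)

theorem lastSym_lt {m j : ℕ} (hm : 0 < m) (v : Word m j) : lastSym v < m := by
  cases j
  · exact hm
  · exact (v _).2

namespace Chain
variable {K : Type} [Field K] (c : Chain K) {m : ℕ}

def wordProb : {j : ℕ} → Word m j → K
  | 0, _ => 1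
  | j + 1, v => wordProb (fun t => v t.castSucc) *
      c.P j (lastSym fun t => v t.castSucc) (v (Fin.last j))

def wordRow : {j : ℕ} → Word m j → ℕ → K
  | 0, _ => c.α
  | j + 1, v => fun x' => ∑ x ∈ Finset.range c.s,
      wordRow (fun t => v t.castSucc) x * c.A (v (Fin.last j)) x x'

/-- The word agrees with the symbols in `S`. -/
def Fits (S : Finset ℕ) {j : ℕ} (v : Word m j) : Prop := ∀ t : Fin j, (t : ℕ) ∈ S → (v t : ℕ) = c.w t

instance (S : Finset ℕ) {j : ℕ} (v : Word m j) : Decidable (c.Fits S v) := by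
  unfold Fits; infer_instance

theorem sum_word_succ {j : ℕ} (f : Word m (j + 1) → K) :
    ∑ v, f v = ∑ v : Word m j, ∑ b : Fin m, f (Fin.snoc (α := fun _ => Fin m) v b) := by
  rw [← (Fin.snocEquiv fun _ : Fin (j + 1) => Fin m).sum_comp, Fintype.sum_prod_type,
    Finset.sum_comm]
  rfl

theorem fits_snoc (S : Finset ℕ) {j : ℕ} (v : Word m j) (b : Fin m) :
    c.Fits S (Fin.snoc (α := fun _ => Fin m) v b) ↔ c.Fits S v ∧ (j ∈ S → (b : ℕ) = c.w j) := by
  simp [Fits, Fin.forall_fin_succ']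

theorem wordProb_snoc {j : ℕ} (v : Word m j) (b : Fin m) :
    c.wordProb (Fin.snoc (α := fun _ => Fin m) v b) =
      c.wordProb v * c.P j (lastSym v) b := by
  simp [wordProb]

theorem wordRow_snoc {j : ℕ} (v : Word m j) (b : Fin m) (x' : ℕ) :
    c.wordRow (Fin.snoc (α := fun _ => Fin m) v b) x' =
      ∑ x ∈ Finset.range c.s, c.wordRow v x * c.A b x x' := by
  simp [wordRow]

theorem lastSym_snoc {j : ℕ} (v : Word m j) (b : Fin m) :
    lastSym (Fin.snoc (α := fun _ => Fin m) v b : Word m (j + 1)) = b := by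
  simp [lastSym]

/-- The recursion for `fwd` appends one symbol. In the induction, words of length `j + 1` are split
into a prefix and a last symbol, and the prefixes are sorted by their own last symbol, the only
thing about them that the chain remembers. -/
theorem fwd_eq_sum (hc : c.m = m) (hm : 0 < m) (S : Finset ℕ) (j : ℕ) {u : ℕ} (hu : u < m) (x : ℕ) :
    c.fwd S j u x = ∑ v : Word m j,
      if c.Fits S v ∧ lastSym v = u then c.wordProb v * c.wordRow v x else 0 := by
  subst hc
  induction j generalizing u x with
  | zero =>
    simp [fwd, Fits, lastSym, wordProb, wordRow, eq_comm]
  | succ j ih =>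
    rw [sum_word_succ]
    have h1 : ∀ v : Word c.m j, ∑ b : Fin c.m, (if c.Fits S (Fin.snoc (α := fun _ => Fin c.m) v b) ∧
        lastSym (Fin.snoc (α := fun _ => Fin c.m) v b : Word c.m (j + 1)) = u then
        c.wordProb (Fin.snoc (α := fun _ => Fin c.m) v b) *
          c.wordRow (Fin.snoc (α := fun _ => Fin c.m) v b) x else 0) =
        if j ∈ S ∧ u ≠ c.w j then 0 else if c.Fits S v then c.wordProb v * c.P j (lastSym v) u *
          ∑ y ∈ Finset.range c.s, c.wordRow v y * c.A u y x else 0 := fun v => by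
      rw [Finset.sum_eq_single ⟨u, hu⟩]
      · simp only [fits_snoc, lastSym_snoc, wordProb_snoc, wordRow_snoc, and_true]
        by_cases h : j ∈ S ∧ u ≠ c.w j
        · rw [if_pos h, if_neg (by tauto)]
        · rw [if_neg h]
          congr 1
          exact propext ⟨fun h' => h'.1, fun h' => ⟨h', by tauto⟩⟩
      · intro b _ hb
        rw [if_neg]
        rintro ⟨-, h⟩
        rw [lastSym_snoc] at h
        exact hb (Fin.ext h)
      · simp
    simp only [h1, fwd]
    split_ifs with h
    · simp
    · have h2 : ∀ v' ∈ Finset.range c.m, ∑ y ∈ Finset.range c.s,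
          c.fwd S j v' y * c.P j v' u * c.A u y x = ∑ v : Word c.m j, if lastSym v = v' then
          (if c.Fits S v then c.wordProb v * c.P j (lastSym v) u *
            ∑ y ∈ Finset.range c.s, c.wordRow v y * c.A u y x else 0) else 0 := fun v' hv' => by
        simp only [ih _ (Finset.mem_range.1 hv'), Finset.sum_mul]
        rw [Finset.sum_comm]
        refine Finset.sum_congr rfl fun v _ => ?_
        by_cases h3 : lastSym v = v'
        · by_cases h4 : c.Fits S v
          · simp only [h3, h4, and_self, if_true, Finset.mul_sum]
            exact Finset.sum_congr rfl fun y _ => by ring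
          · simp [h4]
        · simp [h3]
      rw [Finset.sum_congr rfl h2, Finset.sum_comm]
      refine Finset.sum_congr rfl fun v _ => ?_
      rw [Finset.sum_ite_eq, if_pos (Finset.mem_range.2 (lastSym_lt hm v))]

theorem sum_fwd_eq (hc : c.m = m) (hm : 0 < m) (S : Finset ℕ) (ℓ : ℕ) :
    ∑ u ∈ Finset.range c.m, ∑ x ∈ Finset.range c.s, c.fwd S ℓ u x * c.β x =
      ∑ v : Word m ℓ, if c.Fits S v then
        c.wordProb v * ∑ x ∈ Finset.range c.s, c.wordRow v x * c.β x else 0 := by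
  subst hc
  have h : ∀ u ∈ Finset.range c.m, ∑ x ∈ Finset.range c.s, c.fwd S ℓ u x * c.β x =
      ∑ v : Word c.m ℓ, if lastSym v = u then (if c.Fits S v then
        c.wordProb v * ∑ x ∈ Finset.range c.s, c.wordRow v x * c.β x else 0) else 0 :=
      fun u hu => by
    simp only [fwd_eq_sum c rfl hm S ℓ (Finset.mem_range.1 hu), Finset.sum_mul]
    rw [Finset.sum_comm]
    refine Finset.sum_congr rfl fun v _ => ?_
    by_cases h3 : lastSym v = u
    · by_cases h4 : c.Fits S v
      · simp only [h3, h4, and_self, if_true, Finset.mul_sum]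
        exact Finset.sum_congr rfl fun y _ => by ring
      · simp [h4]
    · simp [h3]
  rw [Finset.sum_congr rfl h, Finset.sum_comm]
  refine Finset.sum_congr rfl fun v _ => ?_
  rw [Finset.sum_ite_eq, if_pos (Finset.mem_range.2 (lastSym_lt hm v))]

theorem wordProb_trivial {j : ℕ} (v : Word m j) : c.trivial.wordProb v = c.wordProb v := by
  induction j with
  | zero => rfl
  | succ j ih => simp only [wordProb, trivial]; congr 1; exact ih _

theorem wordRow_trivial {j : ℕ} (v : Word m j) : c.trivial.wordRow v 0 = 1 := by
  induction j with
  | zero => rfl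
  | succ j ih => simpa [wordRow, trivial] using ih _

theorem sum_fwd_trivial (hc : c.m = m) (hm : 0 < m) (S : Finset ℕ) (ℓ : ℕ) :
    ∑ u ∈ Finset.range c.m, c.trivial.fwd S ℓ u 0 =
      ∑ v : Word m ℓ, if c.Fits S v then c.wordProb v else 0 := by
  have h := c.trivial.sum_fwd_eq hc hm S ℓ
  simp only [show c.trivial.s = 1 from rfl, Finset.sum_range_one,
    show ∀ x, c.trivial.β x = 1 from fun _ => rfl, mul_one] at h
  refine h.trans (Finset.sum_congr rfl fun v _ => ?_)
  rw [wordProb_trivial, wordRow_trivial, mul_one]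
  rfl

end Chain

/-! ### The chain of an instance -/

section OfInstance
variable {K : Type} [Field K] [LinearOrder K] {m ℓ : ℕ}

theorem arrayOf_apply {α : Type} [Zero α] {k : ℕ} (f : Fin k → α) (j : Fin k) :
    arrayOf f j = f j := by simp [arrayOf]

/-- The chain that describes an instance of the problem. -/
def chainOf (A : WA K m) (w : Word m ℓ) (i : Fin ℓ) (P : Markov K m) : Chain K where
  m := m
  s := A.size
  i := i
  w := arrayOf fun j => (w j : ℕ)
  α := arrayOf A.init
  β := arrayOf A.final
  A u x x' := A.transArray ((u * A.size + x) * A.size + x')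
  -- Step `0` leads from the fictitious starting symbol `0` to the first symbol of the word, so its
  -- row `0` is the initial distribution and its other rows vanish.
  P j v u := if j = 0 then (if v = 0 then arrayOf P.init u else 0)
    else if h : v < m ∧ u < m then P.trans j ⟨v, h.1⟩ ⟨u, h.2⟩ else 0

variable (A : WA K m) (w : Word m ℓ) (i : Fin ℓ) (P : Markov K m)

@[simp] theorem chainOf_m : (chainOf A w i P).m = m := rfl
@[simp] theorem chainOf_s : (chainOf A w i P).s = A.size := rfl
@[simp] theorem chainOf_i : (chainOf A w i P).i = i := rfl

theorem chainOf_w (t : Fin ℓ) : (chainOf A w i P).w t = w t := by simp [chainOf, arrayOf]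
theorem chainOf_α (x : Fin A.size) : (chainOf A w i P).α x = A.init x := by
  simp [chainOf, arrayOf]
theorem chainOf_β (x : Fin A.size) : (chainOf A w i P).β x = A.final x := by
  simp [chainOf, arrayOf]
theorem chainOf_P_zero (u : Fin m) : (chainOf A w i P).P 0 0 u = P.init u := by
  simp [chainOf, arrayOf]
theorem chainOf_P {j : ℕ} (hj : 0 < j) (v u : Fin m) :
    (chainOf A w i P).P j v u = P.trans j v u := by
  simp [chainOf, hj.ne']

theorem transArray_apply (u : Fin m) (x y : Fin A.size) :
    A.transArray ((u * A.size + x) * A.size + y) = A.trans u x y := by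
  have h := arrayOf_apply (fun j : Fin ((m * A.size) * A.size) =>
    let u := finProdFinEquiv.symm j
    let v := finProdFinEquiv.symm u.1
    A.trans v.1 v.2 u.2) (finProdFinEquiv (finProdFinEquiv (u, x), y))
  simp only [Equiv.symm_apply_apply] at h
  rw [← h, WA.transArray]
  congr 1
  simp [finProdFinEquiv]
  ring

theorem transArray_eq (u : Fin m) (x y : Fin A.size) :
    (chainOf A w i P).A u x y = A.trans u x y := transArray_apply A u x y

theorem chainOf_wordProb {j : ℕ} (v : Word m j) : (chainOf A w i P).wordProb v = P.prob v := by
  induction j with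
  | zero => rfl
  | succ j ih =>
    rw [Chain.wordProb, ih]
    cases j with
    | zero => simpa [Markov.prob, lastSym] using chainOf_P_zero A w i P (v 0)
    | succ j =>
      simp only [Markov.prob, lastSym]
      rw [Fin.prod_univ_castSucc (n := j), mul_assoc, chainOf_P _ _ _ _ (Nat.succ_pos j)]
      simp

theorem chainOf_wordRow {j : ℕ} (v : Word m j) (x : Fin A.size) :
    (chainOf A w i P).wordRow v x =
      Matrix.vecMul A.init (List.ofFn fun t => A.trans (v t)).prod x := by
  induction j generalizing x with
  | zero => simp [Chain.wordRow, chainOf_α]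
  | succ j ih =>
    rw [List.ofFn_succ', List.concat_eq_append, List.prod_append, List.prod_singleton,
      ← Matrix.vecMul_vecMul, Chain.wordRow]
    beta_reduce
    rw [chainOf_s, Finset.sum_range, Matrix.vecMul, dotProduct]
    exact Finset.sum_congr rfl fun y _ => by rw [ih, transArray_eq]

theorem chainOf_eval {j : ℕ} (v : Word m j) :
    ∑ x ∈ Finset.range A.size, (chainOf A w i P).wordRow v x * (chainOf A w i P).β x = A.eval v := by
  rw [WA.eval, Matrix.dotProduct_mulVec, Finset.sum_range]
  exact Finset.sum_congr rfl fun x _ => by rw [chainOf_wordRow, chainOf_β]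

theorem chainOf_stochastic : (chainOf A w i P).Stochastic ℓ where
  w_lt j hj := by simp [chainOf, arrayOf, hj]
  m_pos := (w i).pos
  init := by
    rw [← P.init_sum, chainOf_m, Finset.sum_range]
    exact Finset.sum_congr rfl fun u _ => chainOf_P_zero A w i P u
  step j _ hj v hv := by
    rw [← P.trans_sum j hj ⟨v, hv⟩, chainOf_m, Finset.sum_range]
    exact Finset.sum_congr rfl fun u _ => chainOf_P A w i P hj ⟨v, hv⟩ u

/-- The pattern in which the positions in `S` are fixed to the symbols of `w`. -/
def patternOf (S : Finset ℕ) : Pattern m ℓ := fun t => if (t : ℕ) ∈ S then some (w t) else none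

theorem mem_lang_patternOf (S : Finset ℕ) (v : Word m ℓ) :
    v ∈ (patternOf w S).lang ↔ (chainOf A w i P).Fits S v := by
  rw [Pattern.lang, Finset.mem_filter, Chain.Fits]
  simp only [patternOf, Finset.mem_univ, true_and]
  refine forall_congr' fun t => ?_
  by_cases h : (t : ℕ) ∈ S
  · simp [h, chainOf_w, Fin.ext_iff, eq_comm]
  · simp [h]

/-- The numerator is the sum of forward vectors for the given automaton, and the denominator is the
same sum for the trivial automaton, which `norm_eq` identifies with `norm`. -/
theorem value_patternOf (S : Finset ℕ) :
    value A P (patternOf w S) = (chainOf A w i P).val ℓ S := by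
  have hm : 0 < m := (w i).pos
  have h : (patternOf w S).lang = Finset.univ.filter fun v => (chainOf A w i P).Fits S v := by
    ext v; rw [mem_lang_patternOf A w i P]; simp
  rw [value, Chain.val, (chainOf_stochastic A w i P).norm_eq, Chain.sum_fwd_trivial (m := m) _ rfl hm,
    Chain.sum_fwd_eq (m := m) _ rfl hm, h, Finset.sum_filter, Finset.sum_filter]
  simp only [chainOf_wordProb, chainOf_s, chainOf_eval]

theorem mem_lang_self (p : Pattern m ℓ) : w ∈ p.lang ↔ ∀ t, p t = none ∨ p t = some (w t) := by
  simp [Pattern.lang]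

theorem patternOf_hashes {S : Finset ℕ} (hS : S ⊆ Finset.range ℓ) :
    (patternOf w S).hashes = ℓ - S.card := by
  have h : (Finset.univ.filter fun t : Fin ℓ => patternOf w S t = none).map Fin.valEmbedding =
      Finset.range ℓ \ S := by
    ext t
    simp only [Finset.mem_map, Finset.mem_filter, Finset.mem_univ, true_and, Fin.valEmbedding_apply,
      Finset.mem_sdiff, Finset.mem_range, patternOf, ite_eq_right_iff, reduceCtorEq, imp_false]
    exact ⟨fun ⟨a, ha, hat⟩ => hat ▸ ⟨a.2, ha⟩, fun ⟨h1, h2⟩ => ⟨⟨t, h1⟩, h2, rfl⟩⟩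
  rw [Pattern.hashes, ← Finset.card_map Fin.valEmbedding, h, Finset.card_sdiff_of_subset hS,
    Finset.card_range]

theorem swap_patternOf (S : Finset ℕ) : (patternOf w S).swap i = patternOf w (S.erase i) := by
  funext t
  by_cases h : t = i
  · subst h; simp [Pattern.swap, patternOf]
  · simp [Pattern.swap, patternOf, h, Fin.val_eq_val]

/-- A pattern that `w` matches has the symbol of `w` wherever it has no joker, so it is determined
by its set of fixed positions. -/
theorem sum_patterns (k : ℕ) (g : Pattern m ℓ → K) :
    ∑ p ∈ patterns w k, g p = ∑ S ∈ (Finset.range ℓ).powerset,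
      if k = ℓ - S.card then g (patternOf w S) else 0 := by
  rw [← Finset.sum_filter]
  symm
  refine Finset.sum_bij (fun S _ => patternOf w S) (fun S hS => ?_) (fun S hS S' hS' h => ?_)
    (fun p hp => ?_) fun _ _ => rfl
  · obtain ⟨h1, h2⟩ := Finset.mem_filter.1 hS
    rw [patterns, Finset.mem_filter]
    refine ⟨Finset.mem_univ _, ?_, ?_⟩
    · rw [mem_lang_self]
      intro t
      by_cases ht : (t : ℕ) ∈ S <;> simp [patternOf, ht]
    · rw [patternOf_hashes w (Finset.mem_powerset.1 h1), h2]
  · have hS := Finset.mem_powerset.1 (Finset.mem_filter.1 hS).1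
    have hS' := Finset.mem_powerset.1 (Finset.mem_filter.1 hS').1
    have key : ∀ t : Fin ℓ, (t : ℕ) ∈ S ↔ (t : ℕ) ∈ S' := fun t => by
      have := congrFun h t
      by_cases h1 : (t : ℕ) ∈ S <;> by_cases h2 : (t : ℕ) ∈ S' <;> simp_all [patternOf]
    ext t
    exact ⟨fun ht => (key ⟨t, Finset.mem_range.1 (hS ht)⟩).1 ht,
      fun ht => (key ⟨t, Finset.mem_range.1 (hS' ht)⟩).2 ht⟩
  · rw [patterns, Finset.mem_filter, mem_lang_self] at hp
    obtain ⟨-, h1, h2⟩ := hp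
    let S := (Finset.univ.filter fun t : Fin ℓ => p t ≠ none).map Fin.valEmbedding
    have hmem : ∀ t : Fin ℓ, (t : ℕ) ∈ S ↔ p t ≠ none := fun t => by
      simp [S, Fin.val_inj]
    have hS : S ⊆ Finset.range ℓ := fun t ht => by
      obtain ⟨a, -, rfl⟩ := Finset.mem_map.1 ht
      exact Finset.mem_range.2 a.2
    have hp : patternOf w S = p := by
      funext t
      by_cases h : p t = none
      · simp [patternOf, hmem, h]
      · simp only [patternOf, hmem, ne_eq, h, not_false_eq_true, if_true]
        exact ((h1 t).resolve_left h).symm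
    refine ⟨S, Finset.mem_filter.2 ⟨Finset.mem_powerset.2 hS, ?_⟩, hp⟩
    rw [← patternOf_hashes w hS, hp, h2]

theorem card_patterns {k : ℕ} (hk : k ≤ ℓ) : (patterns w k).card = ℓ.choose k := by
  -- Counting is summation of the constant one; the rationals are chosen so that the resulting
  -- equality of casts can be pulled back to natural numbers.
  have h := sum_patterns (K := ℚ) w k fun _ => 1
  rw [← Finset.sum_filter, Finset.sum_const, Finset.sum_const, nsmul_one, nsmul_one] at h
  have h' := Nat.cast_injective h
  rw [h', ← Nat.choose_symm hk, ← Finset.card_range ℓ, ← Finset.card_powersetCard]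
  congr 1
  ext S
  rw [Finset.mem_filter, Finset.mem_powersetCard, Finset.mem_powerset, Finset.card_range]
  constructor
  · rintro ⟨h1, h2⟩
    have := Finset.card_le_card h1
    rw [Finset.card_range] at this
    exact ⟨h1, by omega⟩
  · rintro ⟨h1, h2⟩
    exact ⟨h1, by omega⟩

/-- Patterns with a joker at `i` are unchanged by the swap and contribute zero. In the others all
jokers are at positions different from `i`, so the number of jokers is the count used by the table.
-/
theorem sum_patterns_eq_result (k : ℕ) :
    ∑ p ∈ patterns w k, (value A P p - value A P (p.swap i)) = (chainOf A w i P).result ℓ k := by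
  have hi : (i : ℕ) < ℓ := i.2
  have hr : Finset.range ℓ = insert (i : ℕ) ((Finset.range ℓ).erase i) := by
    rw [Finset.insert_erase (Finset.mem_range.2 hi)]
  rw [sum_patterns, (chainOf A w i P).result_eq_sum_sub hi]
  conv_lhs => rw [hr]
  rw [Finset.sum_powerset_insert (by simp), ← Finset.sum_add_distrib]
  refine Finset.sum_congr rfl fun S hS => ?_
  have hS' := Finset.mem_powerset.1 hS
  have hiS : (i : ℕ) ∉ S := fun h => by simpa using hS' h
  simp only [swap_patternOf, value_patternOf A w i P, Finset.erase_eq_of_notMem hiS, sub_self,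
    ite_self, zero_add, Finset.erase_insert hiS, Finset.card_insert_of_notMem hiS]
  simp only [show (chainOf A w i P).i = i from rfl, Nat.sub_sub, Nat.add_comm]

/-- The summation index changes from `k` to the number of jokers `h = ℓ - k`; the expectation over
the uniform pattern contributes the factor `1 / ℓ.choose h`. -/
theorem shap_eq [CharZero K] : shap A w i P = ∑ h ∈ Finset.Icc 1 (ℓ - 1),
    (chainOf A w i P).result ℓ h / ((h : K) * (ℓ.choose h : K)) := by
  rw [shap]
  refine Finset.sum_bij' (fun k _ => ℓ - k) (fun k _ => ℓ - k) ?_ ?_ ?_ ?_ ?_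
  · intro k hk; rw [Finset.mem_Icc] at hk ⊢; omega
  · intro k hk; rw [Finset.mem_Icc] at hk ⊢; omega
  · intro k hk; rw [Finset.mem_Icc] at hk; omega
  · intro k hk; rw [Finset.mem_Icc] at hk; omega
  · intro k hk
    rw [sum_patterns_eq_result, card_patterns w (Nat.sub_le _ _), one_div_mul_eq_div, div_div,
      mul_comm]

end OfInstance

end

section

/-! ### The program

Registers: `0`–`3` hold the input, `4` the position `j`, `5` its successor, `6` the number
`|w| + 1`, `7`, `8`, `9` the sizes of tables and `10` the number `1`; `11` runs over the cells of a
table.  Arrays: `0` holds `eTab`, `1`, `2`, `3` the final vector, the automaton and the current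
transition matrix, `5` holds `nTab`, `6` `next`, `7` `base`, `8` binomial coefficients, which are
computed in `9`. -/

namespace NExpr

def add (a b : NExpr) : NExpr := .op .add a b
def mul (a b : NExpr) : NExpr := .op .mul a b
def pred (a : NExpr) : NExpr := .op .sub a (.const 1)
def mod (a b : NExpr) : NExpr := .op .sub a ((NExpr.div a b).mul b)

/-- The index `a * b + r`. -/
def flat (a b r : NExpr) : NExpr := (a.mul b).add r

end NExpr

namespace FExpr

def mul (a b : FExpr) : FExpr := .op .mul a b
def add (a b : FExpr) : FExpr := .op .add a b
def div (a b : FExpr) : FExpr := .op .div a b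
def zero : FExpr := .cast (.const 0)
def one : FExpr := .cast (.const 1)
def neg (a : FExpr) : FExpr := .op .sub zero a
-- The language only has the test `<`, so equality is tested by excluding both strict inequalities.
def iteEq (a b : NExpr) (p q : FExpr) : FExpr := .ite a b q (.ite b a q p)

end FExpr

namespace Prog
open NExpr FExpr

/-- The tables are stored linearly. With `R = |w| + 1`, `m` symbols and `z` states, the entry `(a,
k, u, x)` has the index `((a * R + k) * m + u) * z + x`, and an entry `(a, u)` has the index `a * m
+ u`. The expressions `eA`, `eK`, `eU`, `eX` and `nA`, `nU` recover the coordinates from the number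
of the cell. -/
def cell : NExpr := .var 11
def nA : NExpr := .div cell (.var 1)
def nU : NExpr := .mod cell (.var 1)
def eX : NExpr := .mod cell (.var 0)
def eU : NExpr := .mod (.div cell (.var 0)) (.var 1)
def eK : NExpr := .mod (.div (.div cell (.var 0)) (.var 1)) (.var 6)
def eA : NExpr := .div (.div (.div cell (.var 0)) (.var 1)) (.var 6)
def symb : NExpr := .load 0 (.var 4)
def eIdx (a k u x : NExpr) : NExpr := ((((a.flat (.var 6) k).flat (.var 1) u).flat (.var 0) x))

def nextE : FExpr :=
  .sum 12 1 (.mul (.load 5 (nA.flat (.var 1) (.var 12))) (.load 3 (.flat (.var 12) (.var 1) nU)))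

def nTabE : FExpr := .iteEq nA (.var 5) (.iteEq nU symb .one .zero) (.load 6 cell)

def baseE : FExpr :=
  .sum 12 1 (.sum 13 0 (.mul (.mul (.load 0 (eIdx eA eK (.var 12) (.var 13)))
    (.load 3 (.flat (.var 12) (.var 1) eU)))
    (.load 2 (.flat (.flat eU (.var 0) (.var 13)) (.var 0) eX))))

def hashE : FExpr :=
  .ite eA (.var 5) (.iteEq (.var 4) (.var 3) (.neg (.load 7 cell))
    (.iteEq eK (.const 0) .zero (.load 7 (eIdx eA eK.pred eU eX)))) .zero

def fixE : FExpr :=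
  .iteEq eA (.var 5) (.iteEq eU symb
    (.sum 12 5 (.div (.load 7 (eIdx (.var 12) eK symb eX))
      (.load 6 (.flat (.var 12) (.var 1) symb)))) .zero) .zero

def eTabE : FExpr := .add hashE fixE

def pascalE : FExpr := .add (.load 8 cell) (.iteEq cell (.const 0) .zero (.load 8 cell.pred))

def copyE : FExpr := .load 9 cell

def resultE : FExpr :=
  .sum 11 2 (.ite (.const 0) (.var 11)
    (.div (.sum 12 6 (.sum 13 1 (.sum 14 0
      (.mul (.load 0 (eIdx (.var 12) (.var 11) (.var 13) (.var 14))) (.load 1 (.var 14))))))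
      (.mul (.cast (.var 11)) (.load 8 (.var 11)))) .zero)

def registers : Com :=
  .seq (.seq (.seq (.seq (.seq (.seq (.natConst 10 1) (.natConst 4 0)) (.natOp .add 6 2 10))
    (.natOp .mul 7 6 1)) (.natOp .mul 8 6 7)) (.natOp .mul 8 8 0)) (.natOp .mul 9 1 1)

/-- Register `10` contains one, so both fillings write just the cell `0`: the start of `nTab` and
row zero of the Pascal triangle. The table `eTab` needs no initialisation, because the input array
`0` holds the initial vector followed by zeros, which is already the start table. -/
def setup : Com := .seq (.seq (.seq registers (.natConst 5 0)) (fill 11 5 10 .one)) (fill 11 8 10 .one)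

/-- `next` and `base` are computed from the old tables before these are replaced. The row of the
Pascal triangle takes a detour through the array `9`, since a filling must not read the array that
it writes. For `j = 0` no matrix is requested, as the initial distribution takes its place. -/
def body : Com :=
  .seq (.seq (.seq (.seq (.seq (.seq (.seq (.seq
    (.natOp .add 5 4 10)
    (.ifNat 4 10 .skip (.call 3 4 1 9)))
    (fill 11 6 7 nextE)) (fill 11 7 8 baseE)) (fill 11 9 6 pascalE))
    (fill 11 5 7 nTabE)) (fill 11 0 8 eTabE)) (fill 11 8 6 copyE))
    (.natOp .add 4 4 10)

/-- The program that computes the SHAP score. -/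
def main : Com := .seq (.seq setup (.whileNat 4 2 body)) (resultE.compile 11 0)

def bnd (V : ℕ) : ℕ :=
  V + FExpr.one.bnd V + nextE.bnd V + nTabE.bnd V + baseE.bnd V + eTabE.bnd V + pascalE.bnd V +
    copyE.bnd V + resultE.bnd V + 1

def setupSteps (M : ℕ) : ℕ := 7 + 1 + fillSteps M .one + fillSteps M .one

def bodySteps (M : ℕ) : ℕ :=
  1 + (M + 3) + fillSteps M nextE + fillSteps M baseE + fillSteps M pascalE + fillSteps M nTabE +
    fillSteps M eTabE + fillSteps M copyE + 1

def steps (M : ℕ) : ℕ := setupSteps M + (M * (bodySteps M + 1) + 1) + resultE.steps M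

/-- Degrees of array entries: `p` for the tables that are updated in every round, `q` for temporary
tables. -/
def degrees (p q : ℕ) : ℕ → ℕ := fun T =>
  if T = 1 ∨ T = 2 ∨ T = 3 then 1 else if T = 0 ∨ T = 5 ∨ T = 8 then p else q

/-! ### Scopes, arrays and degrees of the expressions in the programme -/

section Static

theorem scoped_all : nextE.Scoped 12 ∧ nTabE.Scoped 12 ∧ baseE.Scoped 12 ∧ eTabE.Scoped 12 ∧
    pascalE.Scoped 12 ∧ copyE.Scoped 12 ∧ FExpr.one.Scoped 12 ∧ resultE.Scoped 11 := by
  simp [nextE, nTabE, baseE, eTabE, hashE, fixE, pascalE, copyE, resultE, FExpr.Scoped,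
    NExpr.Scoped, FExpr.mul, FExpr.add, FExpr.div, FExpr.zero, FExpr.one, FExpr.neg, FExpr.iteEq,
    NExpr.add, NExpr.mul, NExpr.pred, NExpr.mod, NExpr.flat, cell, nA, nU, eX, eU, eK, eA, symb,
    eIdx]

theorem avoids_all : nextE.Avoids 6 ∧ nTabE.Avoids 5 ∧ baseE.Avoids 7 ∧ eTabE.Avoids 0 ∧
    pascalE.Avoids 9 ∧ copyE.Avoids 8 ∧ ∀ T, FExpr.one.Avoids T := by
  simp [nextE, nTabE, baseE, eTabE, hashE, fixE, pascalE, copyE, FExpr.Avoids,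
    FExpr.mul, FExpr.add, FExpr.div, FExpr.zero, FExpr.one, FExpr.neg, FExpr.iteEq]

/-- One round raises the degree `p` as follows. In `base` there are two factors of degree one and
two summations, which gives `p + 4`. The division adds `δi`, the sum over the previous fixed
position one, and the addition of the two kinds of step one more. The other expressions stay within
the same bounds. -/
theorem degree_le (p δi : ℕ) :
    nextE.deg (degrees p (p + 4)) δi ≤ p + 4 ∧ baseE.deg (degrees p (p + 4)) δi ≤ p + 4 ∧
    pascalE.deg (degrees p (p + 4)) δi ≤ p + 4 ∧
    nTabE.deg (degrees (p + (δi + 6)) (p + 4)) δi ≤ p + (δi + 6) ∧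
    eTabE.deg (degrees (p + (δi + 6)) (p + 4)) δi ≤ p + (δi + 6) ∧
    copyE.deg (degrees (p + (δi + 6)) (p + 4)) δi ≤ p + (δi + 6) ∧
    resultE.deg (degrees p p) δi ≤ p + (δi + 6) := by
  simp [nextE, nTabE, baseE, eTabE, hashE, fixE, pascalE, copyE, resultE, FExpr.deg,
    FExpr.mul, FExpr.add, FExpr.div, FExpr.zero, FExpr.one, FExpr.neg, FExpr.iteEq, degrees]
  omega

theorem div_flat {q b r : ℕ} (h : r < b) : (q * b + r) / b = q := by
  rw [Nat.add_comm, Nat.add_mul_div_right _ _ (by omega), Nat.div_eq_of_lt h, zero_add]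

end Static

/-! ### Values and divisors of the expressions in the programme -/

section Eval
variable {K : Type} [Field K] [LinearOrder K] {s : State K}

@[simp] theorem eval_mod (a b : NExpr) (hb : 0 < b.eval s) :
    (NExpr.mod a b).eval s = a.eval s % b.eval s := by
  simp only [NExpr.mod, NExpr.mul, NExpr.eval, NatOp.eval, quot_eq hb]
  have := Nat.div_add_mod' (a.eval s) (b.eval s)
  omega

@[simp] theorem eval_flat (a b r : NExpr) :
    (a.flat b r).eval s = a.eval s * b.eval s + r.eval s := rfl

@[simp] theorem eval_pred (a : NExpr) : a.pred.eval s = a.eval s - 1 := rfl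

@[simp] theorem eval_iteEq (a b : NExpr) (p q : FExpr) :
    (FExpr.iteEq a b p q).eval s = if a.eval s = b.eval s then p.eval s else q.eval s := by
  simp only [FExpr.iteEq, FExpr.eval]
  split_ifs <;> first | rfl | omega

@[simp] theorem eval_mul (a b : FExpr) : (FExpr.mul a b).eval s = a.eval s * b.eval s := rfl
@[simp] theorem eval_add (a b : FExpr) : (FExpr.add a b).eval s = a.eval s + b.eval s := rfl
@[simp] theorem eval_fdiv (a b : FExpr) : (FExpr.div a b).eval s = a.eval s / b.eval s := rfl
@[simp] theorem eval_neg (a : FExpr) : (FExpr.neg a).eval s = -a.eval s := by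
  simp [FExpr.neg, FExpr.eval, FieldOp.eval, FExpr.zero, NExpr.eval]
@[simp] theorem eval_zero : FExpr.zero.eval s = 0 := by simp [FExpr.eval, FExpr.zero, NExpr.eval]
@[simp] theorem eval_one : FExpr.one.eval s = 1 := by simp [FExpr.eval, FExpr.one, NExpr.eval]

variable {a k u x R m z j i : ℕ}

theorem eval_nextE (hm : s.nreg 1 = m) (hu : u < m) :
    nextE.eval (s.setN 11 (a * m + u)) =
      ∑ v ∈ Finset.range m, s.farr 5 (a * m + v) * s.farr 3 (v * m + u) := by
  have h0 : 0 < m := by omega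
  simp [nextE, nA, nU, cell, FExpr.eval, NExpr.eval, hm, h0, quot_eq h0, div_flat hu,
    Nat.mod_eq_of_lt hu]

theorem eval_nTabE (hm : s.nreg 1 = m) (hu : u < m) (hj : s.nreg 5 = j + 1) (hj' : s.nreg 4 = j) :
    nTabE.eval (s.setN 11 (a * m + u)) =
      if a = j + 1 then (if u = s.narr 0 j then 1 else 0) else s.farr 6 (a * m + u) := by
  have h0 : 0 < m := by omega
  simp [nTabE, nA, nU, cell, symb, FExpr.eval, NExpr.eval, hm, h0, quot_eq h0, div_flat hu,
    Nat.mod_eq_of_lt hu, hj, hj']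

theorem eval_baseE (hm : s.nreg 1 = m) (hz : s.nreg 0 = z) (hR : s.nreg 6 = R) (hu : u < m)
    (hx : x < z) (hk : k < R) :
    baseE.eval (s.setN 11 (((a * R + k) * m + u) * z + x)) =
      ∑ v ∈ Finset.range m, ∑ y ∈ Finset.range z, s.farr 0 (((a * R + k) * m + v) * z + y) *
        s.farr 3 (v * m + u) * s.farr 2 ((u * z + y) * z + x) := by
  have hm0 : 0 < m := by omega
  have hz0 : 0 < z := by omega
  have hR0 : 0 < R := by omega
  simp [baseE, eIdx, eX, eU, eK, eA, cell, FExpr.eval, NExpr.eval, hm, hz, hR, hm0, hz0, hR0,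
    quot_eq hm0, quot_eq hz0, quot_eq hR0, div_flat hu, div_flat hx, div_flat hk,
    Nat.mod_eq_of_lt hu, Nat.mod_eq_of_lt hx, Nat.mod_eq_of_lt hk]

theorem eval_eTabE (hm : s.nreg 1 = m) (hz : s.nreg 0 = z) (hR : s.nreg 6 = R) (hu : u < m)
    (hx : x < z) (hk : k < R) (hj : s.nreg 5 = j + 1) (hj' : s.nreg 4 = j) (hi : s.nreg 3 = i) :
    eTabE.eval (s.setN 11 (((a * R + k) * m + u) * z + x)) =
      (if a < j + 1 then (if j = i then -s.farr 7 (((a * R + k) * m + u) * z + x) else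
        if k = 0 then 0 else s.farr 7 (((a * R + (k - 1)) * m + u) * z + x)) else 0) +
      if a = j + 1 ∧ u = s.narr 0 j then ∑ b ∈ Finset.range (j + 1),
        s.farr 7 (((b * R + k) * m + s.narr 0 j) * z + x) / s.farr 6 (b * m + s.narr 0 j) else 0 := by
  have hm0 : 0 < m := by omega
  have hz0 : 0 < z := by omega
  have hR0 : 0 < R := by omega
  simp [eTabE, hashE, fixE, eIdx, eX, eU, eK, eA, symb, cell, FExpr.eval, NExpr.eval, hm, hz, hR,
    hm0, hz0, hR0, quot_eq hm0, quot_eq hz0, quot_eq hR0, div_flat hu, div_flat hx, div_flat hk,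
    Nat.mod_eq_of_lt hu, Nat.mod_eq_of_lt hx, Nat.mod_eq_of_lt hk, hj, hj', hi, ite_and]

theorem eval_pascalE (h : ℕ) :
    pascalE.eval (s.setN 11 h) = s.farr 8 h + if h = 0 then 0 else s.farr 8 (h - 1) := by
  simp [pascalE, cell, FExpr.eval, NExpr.eval]

theorem eval_copyE (h : ℕ) : copyE.eval (s.setN 11 h) = s.farr 9 h := by
  simp [copyE, cell, FExpr.eval, NExpr.eval]

theorem eval_resultE (hm : s.nreg 1 = m) (hz : s.nreg 0 = z) (hR : s.nreg 6 = R) :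
    resultE.eval s = ∑ h ∈ Finset.range (s.nreg 2), if 0 < h then
      (∑ a ∈ Finset.range R, ∑ u ∈ Finset.range m, ∑ x ∈ Finset.range z,
        s.farr 0 (((a * R + h) * m + u) * z + x) * s.farr 1 x) / ((h : K) * s.farr 8 h) else 0 := by
  simp [resultE, eIdx, FExpr.eval, NExpr.eval, hm, hz, hR]

variable {sz : K → ℕ} {M B δi : ℕ} {G : Grading sz M B}

/-- These expressions contain no division of field elements; divisions occur in them only in the
computation of indices. -/
theorem invertible_sumFree : nextE.Invertible G δi s ∧ baseE.Invertible G δi s ∧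
    pascalE.Invertible G δi s ∧ nTabE.Invertible G δi s ∧ copyE.Invertible G δi s ∧
    FExpr.one.Invertible G δi s := by
  simp [nextE, baseE, pascalE, nTabE, copyE, FExpr.Invertible, FExpr.mul, FExpr.add, FExpr.zero,
    FExpr.one, FExpr.iteEq]

theorem invertible_eTabE (h : ∀ b < s.nreg 5,
    G.Good δi (s.farr 6 (b * s.nreg 1 + s.narr 0 (s.nreg 4)))⁻¹) (c : ℕ) :
    eTabE.Invertible G δi (s.setN 11 c) := by
  simp [eTabE, hashE, fixE, FExpr.Invertible, FExpr.add, FExpr.zero, FExpr.div, FExpr.neg,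
    FExpr.iteEq, FExpr.eval, NExpr.eval, symb]
  intro _ _ _ _ b hb
  exact h b hb

theorem invertible_resultE (h : ∀ h < s.nreg 2, 0 < h → G.Good δi ((h : K) * s.farr 8 h)⁻¹) :
    resultE.Invertible G δi s := by
  simp [resultE, FExpr.Invertible, FExpr.div, FExpr.mul, FExpr.zero, FExpr.eval, NExpr.eval,
    FieldOp.eval, -mul_inv_rev]
  exact h

end Eval
end Prog

end

/-! ### The loop invariant and the correctness of the programme -/

section

variable {K : Type} [Field K] [LinearOrder K]

/-- Bounds for everything that the program meets on an instance: `V` for the numbers in registers,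
`M` for intermediate natural numbers, `δi` for the degrees of inverses, `D` for the degrees of field
elements, `Tc` for the time of a call and `U` for the cost of an instruction. -/
structure Resources {sz : K → ℕ} {M B : ℕ} (G : Grading sz M B) (I : Instance K)
    (V δi D Tc U : ℕ) : Prop where
  init : ∀ x, G.Good 1 (I.A.init x)
  final : ∀ x, G.Good 1 (I.A.final x)
  trans : ∀ u x y, G.Good 1 (I.A.trans u x y)
  chain_init : ∀ u, G.Good 1 (I.P.init u)
  chain_trans : ∀ n, 0 < n → n < I.len → ∀ a b, G.Good 1 (I.P.trans n a b)
  next_inv : ∀ j < I.len, ∀ b ≤ j, G.Good δi ((chainOf I.A I.w I.i I.P).next j b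
    ((chainOf I.A I.w I.i I.P).w j))⁻¹
  choose_inv : ∀ h < I.len, 0 < h → G.Good δi ((h : K) * (I.len.choose h : K))⁻¹
  proc : ∀ n, 0 < n → n < I.len → ∃ out t, I.Q.run sz n I.m out t ∧ t ≤ Tc ∧
    ∀ a b : Fin I.m, out (a * I.m + b) = I.P.trans n a b
  size_le : I.A.size ≤ V
  m_le : I.m ≤ V
  len_le : I.len + 1 ≤ V
  table_le : (I.len + 1) * I.m ≤ V
  matrix_le : I.m * I.m ≤ V
  tables_le : (I.len + 1) * ((I.len + 1) * I.m) * I.A.size ≤ V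
  bnd_le : Prog.bnd V ≤ M
  deg_le : 1 + I.len * (δi + 6) + (δi + 6) ≤ D
  cost_le : 1 + 3 * M + 3 * ((D + 1) * B) + Tc ≤ U

namespace Prog

/-- The part of the memory that does not change in the main loop, except for the position `j`. -/
structure Frame (I : Instance K) (j : ℕ) (s : State K) : Prop where
  r0 : s.nreg 0 = I.A.size
  r1 : s.nreg 1 = I.m
  r2 : s.nreg 2 = I.len
  r3 : s.nreg 3 = I.i
  r4 : s.nreg 4 = j
  r6 : s.nreg 6 = I.len + 1
  r7 : s.nreg 7 = (I.len + 1) * I.m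
  r8 : s.nreg 8 = (I.len + 1) * ((I.len + 1) * I.m) * I.A.size
  r9 : s.nreg 9 = I.m * I.m
  r10 : s.nreg 10 = 1
  narr : s.narr = I.input.narr
  final : s.farr 1 = I.input.farr 1
  trans : s.farr 2 = I.input.farr 2

theorem Frame.filled {I : Instance K} {j T r : ℕ} {e : FExpr} {s s' : State K}
    (h : Frame I j s) (hf : Filled 11 T r e s s') (h1 : T ≠ 1) (h2 : T ≠ 2) : Frame I j s' where
  r0 := (hf.nreg 0 (by omega)).trans h.r0
  r1 := (hf.nreg 1 (by omega)).trans h.r1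
  r2 := (hf.nreg 2 (by omega)).trans h.r2
  r3 := (hf.nreg 3 (by omega)).trans h.r3
  r4 := (hf.nreg 4 (by omega)).trans h.r4
  r6 := (hf.nreg 6 (by omega)).trans h.r6
  r7 := (hf.nreg 7 (by omega)).trans h.r7
  r8 := (hf.nreg 8 (by omega)).trans h.r8
  r9 := (hf.nreg 9 (by omega)).trans h.r9
  r10 := (hf.nreg 10 (by omega)).trans h.r10
  narr := hf.narr.trans h.narr
  final := (hf.other 1 h1.symm).trans h.final
  trans := (hf.other 2 h2.symm).trans h.trans

/-- The invariant of the main loop. -/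
structure Invariant {sz : K → ℕ} {M B : ℕ} (G : Grading sz M B) (I : Instance K)
    (V δi j : ℕ) (s : State K) : Prop where
  frame : Frame I j s
  first : j = 0 → s.farr 3 = I.input.farr 3
  eTab : ∀ a ≤ I.len, ∀ k ≤ I.len, ∀ u < I.m, ∀ x < I.A.size,
    s.farr 0 (((a * (I.len + 1) + k) * I.m + u) * I.A.size + x) =
      (chainOf I.A I.w I.i I.P).eTab j a k u x
  nTab : ∀ a ≤ I.len, ∀ u < I.m, s.farr 5 (a * I.m + u) = (chainOf I.A I.w I.i I.P).nTab j a u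
  choose : ∀ h ≤ I.len, s.farr 8 h = j.choose h
  bounded : FExpr.Bounded G (degrees (1 + j * (δi + 6)) (1 + j * (δi + 6))) V 11 s

theorem flat_lt {q n b r : ℕ} (hq : q < n) (hr : r < b) : q * b + r < n * b := by
  have : (q + 1) * b ≤ n * b := Nat.mul_le_mul_right _ hq
  rw [Nat.add_mul, one_mul] at this
  omega

theorem _root_.ShapMarkov.FExpr.Bounded.mono {sz : K → ℕ} {M B V d : ℕ} {G : Grading sz M B}
    {δ δ' : ℕ → ℕ} {s : State K} (h : FExpr.Bounded G δ V d s) (hδ : ∀ T, δ T ≤ δ' T) :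
    FExpr.Bounded G δ' V d s :=
  ⟨h.nreg, h.narr, fun T j => G.mono (hδ T) (h.farr T j)⟩

theorem degrees_mono {p p' q q' : ℕ} (hp : p ≤ p') (hq : q ≤ q') (T : ℕ) :
    degrees p q T ≤ degrees p' q' T := by
  simp only [degrees]; split_ifs <;> omega

/-- Read as a matrix, the input array `3` has the initial distribution as its row `0` and zeros
below. This is the transition matrix of step `0`, so the first round can use the array as it is. -/
theorem input_transitions (I : Instance K) (v u : ℕ) :
    I.input.farr 3 (v * I.m + u) = (chainOf I.A I.w I.i I.P).P 0 v u := by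
  have : I.input.farr 3 = arrayOf I.P.init := by simp [Instance.input]
  rw [this]
  by_cases hv : v = 0
  · simp [hv, chainOf]
  · have : ¬ v * I.m + u < I.m := by
      have := Nat.mul_le_mul_right I.m (Nat.pos_of_ne_zero hv)
      omega
    simp [chainOf, hv, arrayOf, this]

section Loop

variable {sz : K → ℕ} {M B : ℕ} {G : Grading sz M B} {I : Instance K} {V δi D Tc U : ℕ}

/-- The current transition matrix is loaded. -/
theorem runs_load (h : Resources G I V δi D Tc U) {j : ℕ} (hj : j < I.len) {δ : ℕ → ℕ}
    (hδ : δ 3 = 1) {s : State K} (hf : Frame I j s)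
    (h3 : j = 0 → s.farr 3 = I.input.farr 3) (hb : FExpr.Bounded G δ V 11 s) :
    Runs sz (I.Q.run sz) (.ifNat 4 10 .skip (.call 3 4 1 9)) s ((M + 3) * U) fun s' =>
      s'.nreg = s.nreg ∧ s'.narr = s.narr ∧ (∀ T ≠ 3, s'.farr T = s.farr T) ∧
      FExpr.Bounded G δ V 11 s' ∧ ∀ v < I.m, ∀ u < I.m,
        s'.farr 3 (v * I.m + u) = (chainOf I.A I.w I.i I.P).P j v u := by
  have hM := h.bnd_le
  have hU := h.cost_le
  have hl := h.len_le
  have hm := h.m_le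
  have hmm := h.matrix_le
  simp only [bnd] at hM
  have e4 := size_le_of_le (n := s.nreg 4) (M := M) (by rw [hf.r4]; omega)
  have e10 := size_le_of_le (n := s.nreg 10) (M := M) (by rw [hf.r10]; omega)
  have e1 := size_le_of_le (n := s.nreg 1) (M := M) (by rw [hf.r1]; omega)
  have e9 := size_le_of_le (n := s.nreg 9) (M := M) (by rw [hf.r9]; omega)
  have hMU : (M + 3) * U = M * U + U + U + U := by ring
  by_cases hj0 : j = 0
  · subst hj0
    refine ⟨s, _, .ifNat_true (by rw [hf.r4, hf.r10]; omega) (.skip s), ?_, rfl, rfl,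
      fun _ _ => rfl, hb, fun v _ u hu => ?_⟩
    · omega
    · rw [h3 rfl, input_transitions I v u]
  · obtain ⟨out, t, hrun, ht, hout⟩ := h.proc j (by omega) hj
    -- The output of the machine is specified only on its first `m * m` cells. Exactly these are
    -- copied, and each of them is an entry of the transition matrix and hence of degree one.
    have hidx : ∀ q < I.m * I.m, ∃ a b : Fin I.m, q = a * I.m + b := fun q hq =>
      ⟨⟨q / I.m, Nat.div_lt_of_lt_mul hq⟩, ⟨q % I.m, Nat.mod_lt _ (I.w I.i).pos⟩,
        (Nat.div_add_mod' q I.m).symm⟩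
    have hgood : ∀ q < I.m * I.m, G.Good 1 (out q) := fun q hq => by
      obtain ⟨a, b, rfl⟩ := hidx q hq
      rw [hout]
      exact h.chain_trans j (by omega) hj a b
    have hsum : ∑ q ∈ Finset.range (s.nreg 9), (1 + q.size + sz (out q)) ≤ M * U := by
      calc _ ≤ ∑ q ∈ Finset.range (s.nreg 9), U := Finset.sum_le_sum fun q hq => by
            rw [Finset.mem_range, hf.r9] at hq
            have := size_le_of_le (n := q) (M := M) (by omega)
            have := G.size_le_of_le (hgood q hq) (show 1 ≤ D by have := h.deg_le; omega)
            omega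
        _ ≤ M * U := by
          rw [Finset.sum_const, Finset.card_range, smul_eq_mul, hf.r9]
          exact Nat.mul_le_mul_right _ (by omega)
    refine ⟨_, _, .ifNat_false (by rw [hf.r4, hf.r10]; omega)
      (.call s 3 4 1 9 out t (by rw [hf.r4, hf.r1]; exact hrun)), ?_, rfl, rfl,
      fun T hT => by simp [State.copyF, Function.update, hT], ⟨hb.nreg, hb.narr, fun T q => ?_⟩,
      fun v hv u hu => ?_⟩
    · omega
    · by_cases hT : T = 3
      · subst hT
        simp only [State.copyF, Function.update_self, hf.r9]
        split_ifs with hq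
        · rw [hδ]; exact hgood q hq
        · exact hb.farr 3 q
      · simpa [State.copyF, Function.update, hT] using hb.farr T q
    · have := flat_lt hv hu
      simp only [State.copyF, Function.update_self, hf.r9, this, if_true]
      rw [hout ⟨v, hv⟩ ⟨u, hu⟩, ← chainOf_P I.A I.w I.i I.P (by omega)]

/-- Each filling evaluates one line of the recursion of `Chain`. Beyond the values, the point to
check is that the degrees grow by `δi + 6` and no more. -/
theorem runs_body (h : Resources G I V δi D Tc U) {j : ℕ} (hj : j < I.len) {s : State K}
    (hs : Invariant G I V δi j s) :
    Runs sz (I.Q.run sz) body s (bodySteps M * U) (Invariant G I V δi (j + 1)) := by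
  set c := chainOf I.A I.w I.i I.P with hc
  set p := 1 + j * (δi + 6) with hp
  have hM := h.bnd_le
  have hU := h.cost_le
  have hl := h.len_le
  have hm := h.m_le
  have hD : p + (δi + 6) ≤ D := by
    have := Nat.mul_le_mul_right (δi + 6) (show j + 1 ≤ I.len from hj)
    have := h.deg_le
    rw [Nat.add_mul] at *
    omega
  simp only [bnd] at hM
  have hU' : 1 + 3 * M + 3 * ((D + 1) * B) ≤ U := by omega
  have hVM : V + 1 ≤ M := by omega
  obtain ⟨sc1, sc2, sc3, sc4, sc5, sc6, -, -⟩ := scoped_all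
  obtain ⟨av1, av2, av3, av4, av5, av6, -⟩ := avoids_all
  obtain ⟨d1, d2, d3, d4, d5, d6, -⟩ := degree_le p δi
  have hf := hs.frame
  -- successor of the position
  obtain ⟨s₁, t₁, x₁, ht₁, rfl⟩ : Runs sz (I.Q.run sz) (.natOp .add 5 4 10) s U
      (fun s' => s' = s.setN 5 (j + 1)) := by
    refine runs_natOp (M := M) (by rw [hf.r4]; omega) (by rw [hf.r10]; omega)
      (by simp [NatOp.eval, hf.r4, hf.r10]; omega) (by omega) ?_
    simp [NatOp.eval, hf.r4, hf.r10]
  have f₁ : Frame I j (s.setN 5 (j + 1)) := by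
    constructor <;> simp [hf.r0, hf.r1, hf.r2, hf.r3, hf.r4, hf.r6, hf.r7, hf.r8, hf.r9, hf.r10,
      hf.narr, hf.final, hf.trans]
  have b₁ : FExpr.Bounded G (degrees p (p + 4)) V 11 (s.setN 5 (j + 1)) :=
    ⟨fun r hr => by
      simp only [State.setN_nreg]
      split_ifs
      · omega
      · exact hs.bounded.nreg r hr, hs.bounded.narr,
      (hs.bounded.mono (degrees_mono le_rfl (by omega))).farr⟩
  obtain ⟨s₂, t₂, x₂, ht₂, n₂, a₂, o₂, b₂, P₂⟩ := runs_load h hj (by simp [degrees]) f₁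
    (fun h0 => hs.first h0) b₁
  have f₂ : Frame I j s₂ := by
    constructor <;> simp [n₂, a₂, o₂, hf.r0, hf.r1, hf.r2, hf.r3, hf.r4, hf.r6, hf.r7, hf.r8,
      hf.r9, hf.r10, hf.narr, hf.final, hf.trans]
  have r5₂ : s₂.nreg 5 = j + 1 := by simp [n₂]
  have inv := fun s : State K => invertible_sumFree (G := G) (δi := δi) (s := s)
  obtain ⟨s₃, t₃, x₃, ht₃, F₃, b₃⟩ := runs_fill (I.Q.run sz) (r := 7) (T := 6) hU' hVM
    (by omega) sc1 av1 b₂ (by omega) (by omega) (by simpa [degrees] using d1)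
    fun t _ => (inv _).1
  have f₃ := f₂.filled F₃ (by omega) (by omega)
  obtain ⟨s₄, t₄, x₄, ht₄, F₄, b₄⟩ := runs_fill (I.Q.run sz) (r := 8) (T := 7) hU' hVM
    (by omega) sc3 av3 b₃ (by omega) (by omega) (by simpa [degrees] using d2)
    fun t _ => (inv _).2.1
  have f₄ := f₃.filled F₄ (by omega) (by omega)
  obtain ⟨s₅, t₅, x₅, ht₅, F₅, b₅⟩ := runs_fill (I.Q.run sz) (r := 6) (T := 9) hU' hVM
    (by omega) sc5 av5 b₄ (by omega) (by omega) (by simpa [degrees] using d3)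
    fun t _ => (inv _).2.2.1
  have f₅ := f₄.filled F₅ (by omega) (by omega)
  -- From here on the permanent tables are overwritten by values of the next degree `p + (δi + 6)`.
  -- Their bound is raised now, while that for the temporary tables, from which they are computed,
  -- stays at `p + 4`.
  have b₅' := b₅.mono (degrees_mono (p' := p + (δi + 6)) (by omega) le_rfl)
  obtain ⟨s₆, t₆, x₆, ht₆, F₆, b₆⟩ := runs_fill (I.Q.run sz) (r := 7) (T := 5) hU' hVM
    (by omega) sc2 av2 b₅' (by omega) (by omega) (by simpa [degrees] using d4)
    fun t _ => (inv _).2.2.2.1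
  have f₆ := f₅.filled F₆ (by omega) (by omega)
  have r5₆ : s₆.nreg 5 = j + 1 := by
    rw [F₆.nreg 5 (by omega), F₅.nreg 5 (by omega), F₄.nreg 5 (by omega), F₃.nreg 5 (by omega), r5₂]
  have r5₅ : s₅.nreg 5 = j + 1 := by
    rw [F₅.nreg 5 (by omega), F₄.nreg 5 (by omega), F₃.nreg 5 (by omega), r5₂]
  have hw : ∀ {s' : State K}, Frame I j s' → s'.narr 0 j = c.w j := fun hs' => by
    rw [hs'.narr]; rfl
  have hwm : c.w j < I.m := (chainOf_stochastic I.A I.w I.i I.P).w_lt j hj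
  -- the tables
  have T6 : ∀ a ≤ I.len, ∀ u < I.m, s₃.farr 6 (a * I.m + u) = c.next j a u := fun a ha u hu => by
    have hlt : a * I.m + u < (I.len + 1) * I.m := flat_lt (by omega) hu
    rw [F₃.cell, f₂.r7, if_pos hlt, eval_nextE f₂.r1 hu, Chain.next]
    refine Finset.sum_congr rfl fun v hv => ?_
    have hv := Finset.mem_range.1 hv
    rw [P₂ v hv u hu, o₂ 5 (by omega), State.setN_farr, hs.nTab a ha v hv]
  have T7 : ∀ a ≤ I.len, ∀ k ≤ I.len, ∀ u < I.m, ∀ x < I.A.size,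
      s₄.farr 7 (((a * (I.len + 1) + k) * I.m + u) * I.A.size + x) =
        c.base j (c.eTab j) a k u x := fun a ha k hk u hu x hx => by
    have hlt : ((a * (I.len + 1) + k) * I.m + u) * I.A.size + x <
        (I.len + 1) * ((I.len + 1) * I.m) * I.A.size := by
      rw [← mul_assoc (I.len + 1)]
      exact flat_lt (flat_lt (flat_lt (by omega) (by omega)) hu) hx
    rw [F₄.cell, f₃.r8, if_pos hlt, eval_baseE f₃.r1 f₃.r0 f₃.r6 hu hx (by omega), Chain.base]
    refine Finset.sum_congr rfl fun v hv => Finset.sum_congr rfl fun y hy => ?_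
    have hv := Finset.mem_range.1 hv
    have hy := Finset.mem_range.1 hy
    rw [F₃.other 0 (by omega), F₃.other 3 (by omega), P₂ v hv u hu, o₂ 0 (by omega),
      State.setN_farr, hs.eTab a ha k hk v hv y hy, f₃.trans]
    rfl
  have T9 : ∀ k ≤ I.len, s₅.farr 9 k = (j + 1).choose k := fun k hk => by
    rw [F₅.cell, f₄.r6, if_pos (by omega), eval_pascalE]
    have e8 : s₄.farr 8 = s.farr 8 := by
      rw [F₄.other 8 (by omega), F₃.other 8 (by omega), o₂ 8 (by omega), State.setN_farr]
    rw [e8]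
    cases k with
    | zero => simp [hs.choose]
    | succ k =>
      rw [hs.choose _ hk, if_neg (by omega), Nat.add_sub_cancel, hs.choose _ (by omega),
        Nat.choose_succ_succ]
      push_cast
      ring
  -- The only divisors in the round are the values of `next` at the symbol `w_j`, for last fixed
  -- positions `b ≤ j`.
  have hinv : ∀ b < s₆.nreg 5, G.Good δi
      (s₆.farr 6 (b * s₆.nreg 1 + s₆.narr 0 (s₆.nreg 4)))⁻¹ := fun b hb => by
    rw [r5₆] at hb
    rw [f₆.r1, f₆.r4, hw f₆, F₆.other 6 (by omega), F₅.other 6 (by omega), F₄.other 6 (by omega),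
      T6 b (by omega) _ hwm]
    exact h.next_inv j hj b (by omega)
  obtain ⟨s₇, t₇, x₇, ht₇, F₇, b₇⟩ := runs_fill (I.Q.run sz) (r := 8) (T := 0) hU' hVM
    (by omega) sc4 av4 b₆ (by omega) (by omega) (by simpa [degrees] using d5)
    fun t _ => invertible_eTabE hinv t
  have f₇ := f₆.filled F₇ (by omega) (by omega)
  obtain ⟨s₈, t₈, x₈, ht₈, F₈, b₈⟩ := runs_fill (I.Q.run sz) (r := 6) (T := 8) hU' hVM
    (by omega) sc6 av6 b₇ (by omega) (by omega) (by simpa [degrees] using d6)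
    fun t _ => (inv _).2.2.2.2.1
  have f₈ := f₇.filled F₈ (by omega) (by omega)
  obtain ⟨s₉, t₉, x₉, ht₉, rfl⟩ : Runs sz (I.Q.run sz) (.natOp .add 4 4 10) s₈ U
      (fun s' => s' = s₈.setN 4 (j + 1)) := by
    refine runs_natOp (M := M) (by rw [f₈.r4]; omega) (by rw [f₈.r10]; omega)
      (by simp [NatOp.eval, f₈.r4, f₈.r10]; omega) (by omega) ?_
    simp [NatOp.eval, f₈.r4, f₈.r10]
  refine ⟨_, _, .seq (.seq (.seq (.seq (.seq (.seq (.seq (.seq x₁ x₂) x₃) x₄) x₅) x₆) x₇) x₈) x₉,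
    ?_, ?_, fun h0 => absurd h0 (by omega), ?_, ?_, ?_, ?_⟩
  · simp only [bodySteps, Nat.add_mul, one_mul] at *
    omega
  · constructor <;> simp [f₈.r0, f₈.r1, f₈.r2, f₈.r3, f₈.r6, f₈.r7, f₈.r8, f₈.r9, f₈.r10,
      f₈.narr, f₈.final, f₈.trans]
  · intro a ha k hk u hu x hx
    have hlt : ((a * (I.len + 1) + k) * I.m + u) * I.A.size + x <
        (I.len + 1) * ((I.len + 1) * I.m) * I.A.size := by
      rw [← mul_assoc (I.len + 1)]
      exact flat_lt (flat_lt (flat_lt (by omega) (by omega)) hu) hx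
    have e7 : s₆.farr 7 = s₄.farr 7 := by rw [F₆.other 7 (by omega), F₅.other 7 (by omega)]
    have e6 : s₆.farr 6 = s₃.farr 6 := by
      rw [F₆.other 6 (by omega), F₅.other 6 (by omega), F₄.other 6 (by omega)]
    rw [State.setN_farr, F₈.other 0 (by omega), F₇.cell, f₆.r8, if_pos hlt,
      eval_eTabE f₆.r1 f₆.r0 f₆.r6 hu hx (by omega) r5₆ f₆.r4 f₆.r3, e6, e7, hw f₆, Chain.eTab]
    simp only [Chain.hashStep, Chain.fixStep]
    congr 1
    · rw [T7 a ha k hk u hu x hx, T7 a ha (k - 1) (by omega) u hu x hx]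
      rfl
    · refine if_congr Iff.rfl (Finset.sum_congr rfl fun b hb => ?_) rfl
      have hb := Finset.mem_range.1 hb
      rw [T7 b (by omega) k hk _ hwm x hx, T6 b (by omega) _ hwm]
  · intro a ha u hu
    have hlt : a * I.m + u < (I.len + 1) * I.m := flat_lt (by omega) hu
    rw [State.setN_farr, F₈.other 5 (by omega), F₇.other 5 (by omega), F₆.cell, f₅.r7, if_pos hlt,
      eval_nTabE f₅.r1 hu r5₅ f₅.r4, hw f₅, F₅.other 6 (by omega), F₄.other 6 (by omega),
      T6 a ha u hu]
    rfl
  · intro k hk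
    rw [State.setN_farr, F₈.cell, f₇.r6, if_pos (by omega), eval_copyE, F₇.other 9 (by omega),
      F₆.other 9 (by omega), T9 k hk]
  · have e : 1 + (j + 1) * (δi + 6) = p + (δi + 6) := by rw [hp]; ring
    rw [e]
    have b₈' := b₈.mono (degrees_mono (q' := p + (δi + 6)) le_rfl (by omega))
    exact ⟨fun r hr => by
      simp only [State.setN_nreg]
      split_ifs
      · omega
      · exact b₈'.nreg r hr, b₈'.narr, b₈'.farr⟩

theorem arrayOf_good {k d : ℕ} {f : Fin k → K} (h : ∀ j, G.Good d (f j)) (h0 : G.Good d 0)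
    (j : ℕ) : G.Good d (arrayOf f j) := by
  simp only [arrayOf]
  split_ifs
  · exact h _
  · exact h0

theorem input_good (h : Resources G I V δi D Tc U) (T j : ℕ) : G.Good 1 (I.input.farr T j) := by
  have h0 : G.Good 1 (0 : K) := by simpa using G.cast (Nat.zero_le M)
  simp only [Instance.input]
  split_ifs
  · exact arrayOf_good h.init h0 j
  · exact arrayOf_good h.final h0 j
  · exact arrayOf_good (fun _ => h.trans _ _ _) h0 j
  · exact arrayOf_good h.chain_init h0 j
  · exact h0

theorem input_narr_le (h : Resources G I V δi D Tc U) (T j : ℕ) : I.input.narr T j ≤ V := by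
  have hm := h.m_le
  simp only [Instance.input]
  split_ifs
  · simp only [arrayOf]
    split_ifs
    · exact (Fin.is_lt _).le.trans hm
    · exact Nat.zero_le _
  · exact Nat.zero_le _

theorem runs_registers (proc : Proc K) {s : State K} {z m ℓ : ℕ} (hU : 1 + 3 * M ≤ U) (hz0 : 0 < z)
    (h0 : s.nreg 0 = z) (h1 : s.nreg 1 = m) (h2 : s.nreg 2 = ℓ) (htab : (ℓ + 1) * m ≤ M)
    (hmat : m * m ≤ M) (htabs : (ℓ + 1) * ((ℓ + 1) * m) * z ≤ M) (hz : z ≤ M) (hm : m ≤ M)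
    (hl : ℓ + 1 ≤ M) :
    Runs sz proc registers s (7 * U) fun s' => Agree 4 s s' ∧ s'.nreg 4 = 0 ∧
      s'.nreg 6 = ℓ + 1 ∧ s'.nreg 7 = (ℓ + 1) * m ∧ s'.nreg 8 = (ℓ + 1) * ((ℓ + 1) * m) * z ∧
      s'.nreg 9 = m * m ∧ s'.nreg 10 = 1 := by
  -- Register `8` first receives the product without the factor `z`; as `z` is positive, the bound
  -- for the full product covers it.
  have hRm : (ℓ + 1) * ((ℓ + 1) * m) ≤ M := (Nat.le_mul_of_pos_right _ hz0).trans htabs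
  have e : 7 * U = U + U + U + U + U + U + U := by ring
  rw [e]
  refine Runs.seq (Runs.seq (Runs.seq (Runs.seq (Runs.seq (Runs.seq
    (runs_natConst (Q := fun s' => Agree 4 s s' ∧ s'.nreg 10 = 1) (by omega) ?_)
    fun s₁ h => runs_natConst (Q := fun s' => Agree 4 s s' ∧ s'.nreg 10 = 1 ∧ s'.nreg 4 = 0)
      (by omega) ?_)
    fun s₂ h => runs_natOp (Q := fun s' => Agree 4 s s' ∧ s'.nreg 10 = 1 ∧ s'.nreg 4 = 0 ∧
      s'.nreg 6 = ℓ + 1) (M := M) ?_ ?_ ?_ hU ?_)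
    fun s₃ h => runs_natOp (Q := fun s' => Agree 4 s s' ∧ s'.nreg 10 = 1 ∧ s'.nreg 4 = 0 ∧
      s'.nreg 6 = ℓ + 1 ∧ s'.nreg 7 = (ℓ + 1) * m) (M := M) ?_ ?_ ?_ hU ?_)
    fun s₄ h => runs_natOp (Q := fun s' => Agree 4 s s' ∧ s'.nreg 10 = 1 ∧ s'.nreg 4 = 0 ∧
      s'.nreg 6 = ℓ + 1 ∧ s'.nreg 7 = (ℓ + 1) * m ∧ s'.nreg 8 = (ℓ + 1) * ((ℓ + 1) * m)) (M := M)
      ?_ ?_ ?_ hU ?_)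
    fun s₅ h => runs_natOp (Q := fun s' => Agree 4 s s' ∧ s'.nreg 10 = 1 ∧ s'.nreg 4 = 0 ∧
      s'.nreg 6 = ℓ + 1 ∧ s'.nreg 7 = (ℓ + 1) * m ∧ s'.nreg 8 = (ℓ + 1) * ((ℓ + 1) * m) * z)
      (M := M) ?_ ?_ ?_ hU ?_)
    fun s₆ h => runs_natOp (M := M) ?_ ?_ ?_ hU ?_
  · exact ⟨(Agree.refl _ _).setN (by omega), by simp⟩
  · exact ⟨h.1.setN (by omega), by simp [h.2], by simp⟩
  · rw [h.1.nreg 2 (by omega)]; omega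
  · omega
  · simp [NatOp.eval, h.1.nreg 2 (by omega), h.2.1, h2, hl]
  · exact ⟨h.1.setN (by omega), by simp [h.2.1], by simp [h.2.2],
      by simp [NatOp.eval, h.1.nreg 2 (by omega), h.2.1, h2]⟩
  · omega
  · rw [h.1.nreg 1 (by omega)]; omega
  · simp [NatOp.eval, h.1.nreg 1 (by omega), h.2.2.2, h1, htab]
  · exact ⟨h.1.setN (by omega), by simp [h.2.1], by simp [h.2.2.1], by simp [h.2.2.2],
      by simp [NatOp.eval, h.1.nreg 1 (by omega), h.2.2.2, h1]⟩
  · omega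
  · omega
  · simp [NatOp.eval, h.2.2.2.1, h.2.2.2.2, hRm]
  · exact ⟨h.1.setN (by omega), by simp [h.2.1], by simp [h.2.2.1], by simp [h.2.2.2.1],
      by simp [h.2.2.2.2], by simp [NatOp.eval, h.2.2.2.1, h.2.2.2.2]⟩
  · omega
  · rw [h.1.nreg 0 (by omega)]; omega
  · simp [NatOp.eval, h.1.nreg 0 (by omega), h.2.2.2.2.2, h0, htabs]
  · exact ⟨h.1.setN (by omega), by simp [h.2.1], by simp [h.2.2.1], by simp [h.2.2.2.1],
      by simp [h.2.2.2.2.1], by simp [NatOp.eval, h.1.nreg 0 (by omega), h.2.2.2.2.2, h0]⟩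
  · rw [h.1.nreg 1 (by omega)]; omega
  · rw [h.1.nreg 1 (by omega)]; omega
  · simp [NatOp.eval, h.1.nreg 1 (by omega), h1, hmat]
  · exact ⟨h.1.setN (by omega), by simp [h.2.2.1], by simp [h.2.2.2.1], by simp [h.2.2.2.2.1],
      by simp [h.2.2.2.2.2], by simp [NatOp.eval, h.1.nreg 1 (by omega), h1], by simp [h.2.1]⟩

theorem runs_setup (h : Resources G I V δi D Tc U) :
    Runs sz (I.Q.run sz) setup I.input (setupSteps M * U) (Invariant G I V δi 0) := by
  have hM := h.bnd_le
  have hU := h.cost_le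
  have hl := h.len_le
  have hz := h.size_le
  have hm := h.m_le
  have htab := h.table_le
  have htabs := h.tables_le
  have hmat := h.matrix_le
  have hD := h.deg_le
  have hm0 : 0 < I.m := (I.w I.i).pos
  have hz0 : 0 < I.A.size := I.A.size_pos
  have hi := I.i.2
  simp only [bnd] at hM
  obtain ⟨s₇, t₇, x₇, ht₇, k₇, r4, r6, r7, r8, r9, r10⟩ := runs_registers (sz := sz)
    (I.Q.run sz) (M := M) (U := U) (s := I.input) (z := I.A.size)
    (m := I.m) (ℓ := I.len) (by omega) I.A.size_pos rfl rfl rfl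
    (htab.trans (by omega)) (hmat.trans (by omega)) (htabs.trans (by omega)) (by omega) (by omega)
    (by omega)
  obtain ⟨s₆, t₆, x₆, ht₆, rfl⟩ : Runs sz (I.Q.run sz) (.natConst 5 0) s₇ U (· = s₇.setN 5 0) :=
    runs_natConst (by omega) rfl
  have f₇ : Frame I 0 (s₇.setN 5 0) := by
    constructor <;> simp [k₇.nreg, k₇.narr, k₇.farr, Instance.input, r4, r6, r7, r8, r9, r10]
  have farr₇ : (s₇.setN 5 0).farr = I.input.farr := k₇.farr
  have b₇ : FExpr.Bounded G (degrees 1 1) V 11 (s₇.setN 5 0) := by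
    refine ⟨fun r hr => ?_, fun T j => ?_, fun T j => ?_⟩
    · by_cases hr5 : r = 5
      · simp [hr5]
      · rcases (by omega : r = 0 ∨ r = 1 ∨ r = 2 ∨ r = 3 ∨ r = 4 ∨ r = 6 ∨ r = 7 ∨ r = 8 ∨ r = 9 ∨
          r = 10) with rfl | rfl | rfl | rfl | rfl | rfl | rfl | rfl | rfl | rfl
        · rw [f₇.r0]; exact hz
        · rw [f₇.r1]; exact hm
        · rw [f₇.r2]; omega
        · rw [f₇.r3]; omega
        · rw [f₇.r4]; omega
        · rw [f₇.r6]; omega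
        · rw [f₇.r7]; exact htab
        · rw [f₇.r8]; exact htabs
        · rw [f₇.r9]; exact hmat
        · rw [f₇.r10]; omega
    · rw [f₇.narr]; exact input_narr_le h T j
    · rw [farr₇]
      exact G.mono (by simp only [degrees]; split_ifs <;> omega) (input_good h T j)
  obtain ⟨-, -, -, -, -, -, sc, -⟩ := scoped_all
  obtain ⟨-, -, -, -, -, -, av⟩ := avoids_all
  have hd : FExpr.one.deg (degrees 1 1) δi = 1 := rfl
  obtain ⟨s₈, t₈, x₈, ht₈, F₈, b₈⟩ := runs_fill (I.Q.run sz) (r := 10) (T := 5) (D := D)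
    (δi := δi) (B := B) (U := U) (M := M) (by omega) (by omega)
    (by omega) sc (av 5) b₇ (by omega) (by omega) (by simp [degrees, hd])
    fun t _ => invertible_sumFree.2.2.2.2.2
  have f₈ := f₇.filled F₈ (by omega) (by omega)
  obtain ⟨s₉, t₉, x₉, ht₉, F₉, b₉⟩ := runs_fill (I.Q.run sz) (r := 10) (T := 8) (D := D)
    (δi := δi) (B := B) (U := U) (M := M) (by omega) (by omega)
    (by omega) sc (av 8) b₈ (by omega) (by omega) (by simp [degrees, hd])
    fun t _ => invertible_sumFree.2.2.2.2.2
  have f₉ := f₈.filled F₉ (by omega) (by omega)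
  refine ⟨_, _, .seq (.seq (.seq x₇ x₆) x₈) x₉, ?_, f₉, fun _ => ?_, ?_, ?_, ?_, by simpa using b₉⟩
  · simp only [setupSteps, Nat.add_mul] at *
    omega
  · rw [F₉.other 3 (by omega), F₈.other 3 (by omega), farr₇]
  · intro a ha k hk u hu x hx
    rw [F₉.other 0 (by omega), F₈.other 0 (by omega), farr₇]
    simp only [Chain.eTab, Chain.start]
    by_cases h0 : a = 0 ∧ k = 0 ∧ u = 0
    · obtain ⟨rfl, rfl, rfl⟩ := h0
      simp [Instance.input, chainOf]
    · rw [if_neg h0]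
      -- Apart from the block `(0, 0, 0)`, every cell has an index of at least the number of states,
      -- where the input array contains zeros.
      have hpos : 0 < (a * (I.len + 1) + k) * I.m + u := by
        rcases Nat.eq_zero_or_pos u with hu0 | hu0
        · rcases Nat.eq_zero_or_pos k with hk0 | hk0
          · have : 0 < a := by omega
            positivity
          · positivity
        · positivity
      have := Nat.mul_le_mul_right I.A.size (Nat.succ_le_of_lt hpos)
      have hge : ¬ ((a * (I.len + 1) + k) * I.m + u) * I.A.size + x < I.A.size := by omega
      simp [Instance.input, arrayOf, hge]
  · intro a ha u hu
    rw [F₉.other 5 (by omega), F₈.cell, f₇.r10, farr₇, eval_one]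
    simp only [Chain.nTab]
    by_cases h0 : a = 0 ∧ u = 0
    · simp [h0]
    · rw [if_neg h0, if_neg]
      · simp [Instance.input]
      · rcases Nat.eq_zero_or_pos a with ha0 | ha0
        · omega
        · have : 0 < a * I.m := by positivity
          omega
  · intro k hk
    rw [F₉.cell, f₈.r10, F₈.other 8 (by omega), farr₇, eval_one]
    cases k with
    | zero => simp
    | succ k => simp [Instance.input]

/-- After `|w|` rounds the invariant supplies the last table and the row `|w|` of the Pascal
triangle; the final expression is then the right-hand side of `shap_eq`, with the term for `h = 0`
suppressed by a test. -/
theorem runs_main (h : Resources G I V δi D Tc U) [CharZero K] :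
    Runs sz (I.Q.run sz) main I.input (steps M * U) fun s' =>
      s'.freg 0 = shap I.A I.w I.i I.P := by
  have hM := h.bnd_le
  have hU := h.cost_le
  have hl := h.len_le
  simp only [bnd] at hM
  simp only [steps, Nat.add_mul (setupSteps M + (M * (bodySteps M + 1) + 1)),
    Nat.add_mul (setupSteps M)]
  refine Runs.seq (Q := fun s => Invariant G I V δi I.len s) (Runs.seq (runs_setup h) ?_) ?_
  · intro s hs
    refine (runs_count (M := M) (n := I.len) (fun j s => j ≤ I.len ∧ Invariant G I V δi j s)
      (by omega) (by omega) (fun t s hs => ⟨hs.2.frame.r4, hs.2.frame.r2⟩) ?_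
      ⟨Nat.zero_le _, hs⟩).mono le_rfl fun s hs => hs.2
    intro t s ht hs
    exact (runs_body h ht hs.2).mono le_rfl fun s' hs' => ⟨ht, hs'⟩
  · intro s hs
    have hf := hs.frame
    obtain ⟨-, -, -, -, -, -, -, sc⟩ := scoped_all
    obtain ⟨-, -, -, -, -, -, d⟩ := degree_le (1 + I.len * (δi + 6)) δi
    have := h.deg_le
    refine (FExpr.runs (D := D) (δi := δi) (by omega) (by omega) resultE sc hs.bounded (by omega)
      (d.trans (by omega)) (invertible_resultE fun k hk hk0 => ?_)).mono le_rfl fun s' hs' => ?_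
    · rw [hf.r2] at hk
      rw [hs.choose k hk.le]
      exact h.choose_inv k hk hk0
    · rw [hs'.2.2, eval_resultE hf.r1 hf.r0 hf.r6, hf.r2, shap_eq, ← Finset.sum_filter]
      refine Finset.sum_congr ?_ fun k hk => ?_
      · ext k
        simp only [Finset.mem_filter, Finset.mem_range, Finset.mem_Icc]
        omega
      · rw [Finset.mem_Icc] at hk
        rw [hs.choose k (by omega), Chain.result]
        congr 1
        refine Finset.sum_congr rfl fun a ha => Finset.sum_congr rfl fun u hu =>
          Finset.sum_congr rfl fun x hx => ?_
        have ha := Finset.mem_range.1 ha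
        rw [hs.eTab a (by omega) k (by omega) u (Finset.mem_range.1 hu) x (Finset.mem_range.1 hx),
          hf.final]
        rfl

end Loop
end Prog

end

section

/-! ### Polynomial bounds -/

theorem eval_mono (p : Polynomial ℕ) {x y : ℕ} (h : x ≤ y) : p.eval x ≤ p.eval y := by
  rw [Polynomial.eval_eq_sum_range, Polynomial.eval_eq_sum_range]
  exact Finset.sum_le_sum fun i _ => Nat.mul_le_mul_left _ (Nat.pow_le_pow_left h i)

/-- The function is bounded by a polynomial. -/
def PolyBdd (f : ℕ → ℕ) : Prop := ∃ p : Polynomial ℕ, ∀ x, f x ≤ p.eval x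

namespace PolyBdd

theorem const (c : ℕ) : PolyBdd fun _ => c := ⟨.C c, fun x => by simp⟩

theorem id : PolyBdd fun x => x := ⟨.X, fun x => by simp⟩

theorem poly (p : Polynomial ℕ) : PolyBdd fun x => p.eval x := ⟨p, fun _ => le_rfl⟩

variable {f g : ℕ → ℕ}

theorem add (hf : PolyBdd f) (hg : PolyBdd g) : PolyBdd fun x => f x + g x := by
  obtain ⟨p, hp⟩ := hf
  obtain ⟨q, hq⟩ := hg
  exact ⟨p + q, fun x => by rw [Polynomial.eval_add]; exact Nat.add_le_add (hp x) (hq x)⟩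

theorem mul (hf : PolyBdd f) (hg : PolyBdd g) : PolyBdd fun x => f x * g x := by
  obtain ⟨p, hp⟩ := hf
  obtain ⟨q, hq⟩ := hg
  exact ⟨p * q, fun x => by rw [Polynomial.eval_mul]; exact Nat.mul_le_mul (hp x) (hq x)⟩

theorem comp (hf : PolyBdd f) (hg : PolyBdd g) : PolyBdd fun x => f (g x) := by
  obtain ⟨p, hp⟩ := hf
  obtain ⟨q, hq⟩ := hg
  exact ⟨p.comp q, fun x => by
    rw [Polynomial.eval_comp]; exact (hp _).trans (eval_mono p (hq x))⟩

theorem pow (hf : PolyBdd f) (n : ℕ) : PolyBdd fun x => f x ^ n := by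
  induction n with
  | zero => simpa using const 1
  | succ n ih => simpa only [pow_succ] using ih.mul hf

end PolyBdd

theorem NExpr.polyBdd_bnd (e : NExpr) : PolyBdd fun V => e.bnd V := by
  induction e with
  | const c => exact .const c
  | var r => exact .id
  | op o a b iha ihb => exact (iha.add ihb).add (iha.mul ihb)
  | load T a ih => exact ih.add .id
  | div a b iha ihb => exact ((iha.add ihb).add (iha.mul ihb)).add (.const 1)

theorem NExpr.polyBdd_steps (e : NExpr) : PolyBdd fun M => e.steps M := by
  induction e with
  | const c => exact .const 1
  | var r => exact .const 2
  | op o a b iha ihb => exact (iha.add ihb).add (.const 1)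
  | load T a ih => exact ih.add (.const 1)
  | div a b iha ihb =>
    exact (iha.add ihb).add (((PolyBdd.const 3).add
      ((PolyBdd.id.mul (.const 7)).add (.const 1))).add (.const 1))

theorem FExpr.polyBdd_bnd (e : FExpr) : PolyBdd fun V => e.bnd V := by
  induction e with
  | cast a => exact a.polyBdd_bnd
  | load T a => exact a.polyBdd_bnd
  | op o a b iha ihb => exact iha.add ihb
  | sum v r e ih => exact ih.add .id
  | ite a b p q ihp ihq => exact ((a.polyBdd_bnd.add b.polyBdd_bnd).add ihp).add ihq

theorem FExpr.polyBdd_steps (e : FExpr) : PolyBdd fun M => e.steps M := by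
  induction e with
  | cast a => exact a.polyBdd_steps.add (.const 1)
  | load T a => exact a.polyBdd_steps.add (.const 1)
  | op o a b iha ihb => exact (iha.add ihb).add (.const 1)
  | sum v r e ih =>
    exact (PolyBdd.const 2).add ((PolyBdd.id.mul ((ih.add (.const 3)).add (.const 1))).add
      (.const 1))
  | ite a b p q ihp ihq =>
    exact (a.polyBdd_steps.add b.polyBdd_steps).add (((PolyBdd.const 1).add ihp).add ihq)

theorem polyBdd_fillSteps (e : FExpr) : PolyBdd fun M => fillSteps M e :=
  (PolyBdd.const 1).add ((PolyBdd.id.mul ((e.polyBdd_steps.add (.const 3)).add (.const 1))).add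
    (.const 1))

theorem Prog.polyBdd_bnd : PolyBdd Prog.bnd :=
  ((((((((PolyBdd.id.add (FExpr.polyBdd_bnd _)).add (FExpr.polyBdd_bnd _)).add
    (FExpr.polyBdd_bnd _)).add (FExpr.polyBdd_bnd _)).add (FExpr.polyBdd_bnd _)).add
    (FExpr.polyBdd_bnd _)).add (FExpr.polyBdd_bnd _)).add (FExpr.polyBdd_bnd _)).add (.const 1)

theorem Prog.polyBdd_bodySteps : PolyBdd Prog.bodySteps :=
  ((((((((PolyBdd.const 1).add (PolyBdd.id.add (.const 3))).add (polyBdd_fillSteps _)).add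
    (polyBdd_fillSteps _)).add (polyBdd_fillSteps _)).add (polyBdd_fillSteps _)).add
    (polyBdd_fillSteps _)).add (polyBdd_fillSteps _)).add (.const 1)

theorem Prog.polyBdd_steps : PolyBdd Prog.steps :=
  ((((PolyBdd.const (7 + 1)).add (polyBdd_fillSteps _)).add (polyBdd_fillSteps _)).add
    ((PolyBdd.id.mul (polyBdd_bodySteps.add (.const 1))).add (.const 1))).add
    (FExpr.polyBdd_steps _)

/-! ### Common resources -/

/-- A bound for the numbers in registers. -/
def regBound (x : ℕ) : ℕ := (x + 1) ^ 4

/-- A bound for the cost of an instruction. -/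
def unitCost (x δi B Tc : ℕ) : ℕ :=
  1 + 3 * Prog.bnd (regBound x) + 3 * ((1 + x * (δi + 6) + (δi + 6) + 1) * B) + Tc

theorem polyBdd_regBound : PolyBdd regBound := (PolyBdd.id.add (.const 1)).pow 4

/-- The largest number in a register is the number of cells of `eTab`, a product of four factors,
hence the exponent `4`. -/
theorem regBound_bounds {z m ℓ x : ℕ} (h : z + m + ℓ ≤ x) :
    z ≤ regBound x ∧ m ≤ regBound x ∧ ℓ + 1 ≤ regBound x ∧ (ℓ + 1) * m ≤ regBound x ∧
      m * m ≤ regBound x ∧ (ℓ + 1) * ((ℓ + 1) * m) * z ≤ regBound x := by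
  have hz : z ≤ x + 1 := by omega
  have hm : m ≤ x + 1 := by omega
  have hl : ℓ + 1 ≤ x + 1 := by omega
  have h1 : x + 1 ≤ (x + 1) ^ 4 := Nat.le_self_pow (by norm_num) _
  have h2 : (x + 1) * (x + 1) ≤ (x + 1) ^ 4 := by
    rw [← sq]; exact Nat.pow_le_pow_right (by omega) (by norm_num)
  refine ⟨hz.trans h1, hm.trans h1, hl.trans h1, (Nat.mul_le_mul hl hm).trans h2,
    (Nat.mul_le_mul hm hm).trans h2, ?_⟩
  calc _ ≤ (x + 1) * ((x + 1) * (x + 1)) * (x + 1) :=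
        Nat.mul_le_mul (Nat.mul_le_mul hl (Nat.mul_le_mul hl hm)) hz
    _ = regBound x := by simp only [regBound]; ring

section Resources
variable {K : Type} [Field K] [LinearOrder K] {sz : K → ℕ}

theorem resources_of {x B δi : ℕ} {G : Grading sz (Prog.bnd (regBound x)) B} {I : Instance K}
    {r : Polynomial ℕ} (hI : I.Q.Implements sz I.P r) (hx : I.A.size + I.m + I.len ≤ x)
    (init : ∀ x, G.Good 1 (I.A.init x)) (final : ∀ x, G.Good 1 (I.A.final x))
    (trans : ∀ u x y, G.Good 1 (I.A.trans u x y)) (chain_init : ∀ u, G.Good 1 (I.P.init u))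
    (chain_trans : ∀ n, 0 < n → n < I.len → ∀ a b, G.Good 1 (I.P.trans n a b))
    (next_inv : ∀ j < I.len, ∀ b ≤ j, G.Good δi ((chainOf I.A I.w I.i I.P).next j b
      ((chainOf I.A I.w I.i I.P).w j))⁻¹)
    (choose_inv : ∀ h < I.len, 0 < h → G.Good δi ((h : K) * (I.len.choose h : K))⁻¹) :
    Resources G I (regBound x) δi (1 + x * (δi + 6) + (δi + 6)) (r.eval x)
      (unitCost x δi B (r.eval x)) := by
  obtain ⟨h1, h2, h3, h4, h5, h6⟩ := regBound_bounds hx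
  refine ⟨init, final, trans, chain_init, chain_trans, next_inv, choose_inv, fun n hn hnl => ?_,
    h1, h2, h3, h4, h5, h6, le_rfl, ?_, le_rfl⟩
  · obtain ⟨out, t, hrun, ht, hout⟩ := hI n hn
    exact ⟨out, t, hrun, ht.trans (eval_mono r (by omega)), hout⟩
  · have := Nat.mul_le_mul_right (δi + 6) (show I.len ≤ x by omega)
    omega

end Resources

/-! ### Unit cost -/

/-- The trivial filtration of the real numbers. -/
def realGrading (M : ℕ) : Grading unitSize M 0 where
  Good _ _ := True
  mono _ _ := trivial
  add _ _ := trivial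
  sub _ _ := trivial
  mul _ _ := trivial
  sum _ _ := trivial
  cast _ := trivial
  size_le _ := le_rfl

/-- With the trivial grading all conditions on degrees are void and field elements cost nothing, so
only the count of instructions, the natural numbers and the calls remain. -/
theorem solves_real (r : Polynomial ℕ) : ∃ p : Polynomial ℕ, ∀ I : Instance ℝ,
    I.Q.Implements unitSize I.P r →
      Solves unitSize Prog.main I (p.eval (I.A.size + I.m + I.len)) := by
  obtain ⟨p, hp⟩ : PolyBdd fun x => Prog.steps (Prog.bnd (regBound x)) *
      unitCost x 0 0 (r.eval x) :=
    (Prog.polyBdd_steps.comp (Prog.polyBdd_bnd.comp polyBdd_regBound)).mul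
      ((((PolyBdd.const 1).add ((PolyBdd.const 3).mul (Prog.polyBdd_bnd.comp
        polyBdd_regBound))).add (.const _)).add (.poly r))
  refine ⟨p, fun I hI => ?_⟩
  have h := resources_of (G := realGrading _) (δi := 0) hI le_rfl (fun _ => trivial)
    (fun _ => trivial) (fun _ _ _ => trivial) (fun _ => trivial) (fun _ _ _ _ _ => trivial)
    (fun _ _ _ _ => trivial) fun _ _ _ => trivial
  obtain ⟨s', t, he, ht, hq⟩ := Prog.runs_main h
  exact ⟨s', t, he, ht.trans (hp _), hq⟩

end

section

/-! ### Bit cost -/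

theorem size_mul_le (a b : ℕ) : (a * b).size ≤ a.size + b.size := by
  rcases Nat.eq_zero_or_pos a with rfl | ha
  · simp
  rcases Nat.eq_zero_or_pos b with rfl | hb
  · simp
  rw [Nat.size_le, pow_add]
  exact Nat.mul_lt_mul'' (Nat.lt_size_self a) (Nat.lt_size_self b)

theorem size_succ_le (a : ℕ) : (a + 1).size ≤ a.size + 1 := by
  rw [Nat.size_le, pow_succ]
  have := Nat.lt_size_self a
  omega

theorem size_pow_le (a d : ℕ) : (a ^ d).size ≤ d * a.size + 1 := by
  induction d with
  | zero => simp
  | succ d ih =>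
    rw [pow_succ]
    have := size_mul_le (a ^ d) a
    rw [Nat.add_mul, one_mul]
    omega

theorem size_prod_le {ι : Type} (s : Finset ι) (f : ι → ℕ) :
    (∏ i ∈ s, f i).size ≤ 1 + ∑ i ∈ s, (f i).size := by
  classical
  induction s using Finset.induction_on with
  | empty => simp
  | insert a s ha ih =>
    rw [Finset.prod_insert ha, Finset.sum_insert ha]
    have := size_mul_le (f a) (∏ i ∈ s, f i)
    omega

/-- Rational numbers of the form `z / D ^ d` whose absolute value is at most `D ^ d`. -/
def IsGood (D d : ℕ) (q : ℚ) : Prop := (∃ z : ℤ, q * (D : ℚ) ^ d = z) ∧ |q| ≤ (D : ℚ) ^ d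

namespace IsGood

variable {D D' d e : ℕ} {x y : ℚ}

theorem mono (hD : 1 ≤ D) (h : d ≤ e) (hx : IsGood D d x) : IsGood D e x := by
  obtain ⟨⟨z, hz⟩, hb⟩ := hx
  have hD' : (1 : ℚ) ≤ D := by exact_mod_cast hD
  refine ⟨⟨z * (D : ℤ) ^ (e - d), ?_⟩, hb.trans (pow_le_pow_right₀ hD' h)⟩
  push_cast
  rw [← hz, mul_assoc, ← pow_add, Nat.add_sub_cancel' h]

/-- This permits the change to a larger common denominator without any change of degree. -/
theorem of_dvd (hD : 1 ≤ D') (h : D ∣ D') (hx : IsGood D d x) : IsGood D' d x := by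
  obtain ⟨⟨z, hz⟩, hb⟩ := hx
  have hle : D ≤ D' := Nat.le_of_dvd hD h
  obtain ⟨k, rfl⟩ := h
  refine ⟨⟨z * (k : ℤ) ^ d, ?_⟩, hb.trans (pow_le_pow_left₀ (by positivity)
    (by exact_mod_cast hle) d)⟩
  push_cast
  rw [← hz]; ring

theorem intCast {n : ℤ} (h : |(n : ℚ)| ≤ (D : ℚ) ^ d) : IsGood D d n :=
  ⟨⟨n * (D : ℤ) ^ d, by push_cast; ring⟩, h⟩

/-- The denominator does not change; the additional factor `D` is spent on the absolute value, which
at most doubles. -/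
theorem add (hD : 2 ≤ D) (hx : IsGood D d x) (hy : IsGood D e y) :
    IsGood D (max d e + 1) (x + y) := by
  obtain ⟨⟨z, hz⟩, hb⟩ := hx.mono (by omega) (le_max_left d e)
  obtain ⟨⟨z', hz'⟩, hb'⟩ := hy.mono (by omega) (le_max_right d e)
  have hD' : (2 : ℚ) ≤ D := by exact_mod_cast hD
  refine ⟨⟨(z + z') * D, ?_⟩, ?_⟩
  · push_cast
    rw [← hz, ← hz']; ring
  · refine (abs_add_le x y).trans ((add_le_add hb hb').trans ?_)
    rw [pow_succ, ← mul_two]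
    exact mul_le_mul_of_nonneg_left hD' (by positivity)

theorem neg (hx : IsGood D d x) : IsGood D d (-x) := by
  obtain ⟨⟨z, hz⟩, hb⟩ := hx
  exact ⟨⟨-z, by push_cast; rw [← hz]; ring⟩, by rwa [abs_neg]⟩

theorem mul (hx : IsGood D d x) (hy : IsGood D e y) : IsGood D (d + e) (x * y) := by
  obtain ⟨⟨z, hz⟩, hb⟩ := hx
  obtain ⟨⟨z', hz'⟩, hb'⟩ := hy
  refine ⟨⟨z * z', ?_⟩, ?_⟩
  · push_cast
    rw [← hz, ← hz', pow_add]; ring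
  · rw [abs_mul, pow_add]
    exact mul_le_mul hb hb' (abs_nonneg _) (by positivity)

/-- A single factor `D ≥ n` absorbs the growth of the absolute value for all `n` terms together. -/
theorem sum {n : ℕ} {f : ℕ → ℚ} (hn : n ≤ D) (h : ∀ i < n, IsGood D d (f i)) :
    IsGood D (d + 1) (∑ i ∈ Finset.range n, f i) := by
  constructor
  · choose z hz using fun i : Fin n => (h i i.2).1
    refine ⟨(∑ i, z i) * D, ?_⟩
    push_cast
    rw [Finset.sum_range, pow_succ, ← mul_assoc, Finset.sum_mul]
    congr 1
    exact Finset.sum_congr rfl fun i _ => hz i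
  · calc |∑ i ∈ Finset.range n, f i| ≤ ∑ i ∈ Finset.range n, |f i| := Finset.abs_sum_le_sum_abs _ _
      _ ≤ ∑ i ∈ Finset.range n, (D : ℚ) ^ d :=
        Finset.sum_le_sum fun i hi => (h i (Finset.mem_range.1 hi)).2
      _ = n * (D : ℚ) ^ d := by simp
      _ ≤ D * (D : ℚ) ^ d := by
        have : (n : ℚ) ≤ D := by exact_mod_cast hn
        exact mul_le_mul_of_nonneg_right this (by positivity)
      _ = (D : ℚ) ^ (d + 1) := by ring

theorem den_dvd (hx : IsGood D d x) : x.den ∣ D ^ d := by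
  obtain ⟨⟨z, hz⟩, -⟩ := hx
  have h : x.num * (D : ℤ) ^ d = z * x.den := by
    have h1 : (x.num : ℚ) = x * x.den := (Rat.mul_den_eq_num x).symm
    have h2 : ((x.num * (D : ℤ) ^ d : ℤ) : ℚ) = ((z * x.den : ℤ) : ℚ) := by
      push_cast
      rw [h1, ← hz]; ring
    exact_mod_cast h2
  have h3 : (x.den : ℤ) ∣ x.num * (D : ℤ) ^ d := ⟨z, by rw [h]; ring⟩
  have h4 : IsCoprime (x.den : ℤ) x.num := by
    rw [Int.isCoprime_iff_gcd_eq_one, Int.gcd_comm]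
    exact x.reduced
  exact_mod_cast h4.dvd_of_dvd_mul_left h3

theorem den_le (hD : 1 ≤ D) (hx : IsGood D d x) : x.den ≤ D ^ d :=
  Nat.le_of_dvd (Nat.pow_pos hD) hx.den_dvd

/-- The numerator is the value times its denominator, and both are at most `D ^ d` in absolute
value. -/
theorem num_le (hD : 1 ≤ D) (hx : IsGood D d x) : x.num.natAbs ≤ D ^ d * D ^ d := by
  have h1 : (x.num : ℚ) = x * x.den := (Rat.mul_den_eq_num x).symm
  have h2 : ((x.num.natAbs : ℕ) : ℚ) = |x| * x.den := by
    rw [Nat.cast_natAbs, Int.cast_abs, h1, abs_mul, Nat.abs_cast]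
  have h3 : (x.den : ℚ) ≤ (D : ℚ) ^ d := by exact_mod_cast hx.den_le hD
  have : ((x.num.natAbs : ℕ) : ℚ) ≤ (D : ℚ) ^ d * (D : ℚ) ^ d := by
    rw [h2]; exact mul_le_mul hx.2 h3 (by positivity) (by positivity)
  exact_mod_cast this

theorem bitSize_le (hD : 1 ≤ D) (hx : IsGood D d x) : bitSize x ≤ (d + 1) * (3 * D.size + 3) := by
  have h1 := Nat.size_le_size (hx.den_le hD)
  have h2 := Nat.size_le_size (hx.num_le hD)
  have h3 := size_mul_le (D ^ d) (D ^ d)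
  have h4 := size_pow_le D d
  have h5 : (d + 1) * (3 * D.size + 3) = 3 * (d * D.size) + 3 * D.size + 3 * d + 3 := by ring
  rw [bitSize]
  omega

/-- Inverses become good when the numerator divides the common denominator. -/
theorem inv (hD : 1 ≤ D) (hD' : 1 ≤ D') (h : D ∣ D') (hn : x ≠ 0 → x.num.natAbs ∣ D')
    (hx : IsGood D d x) : IsGood D' (d + 1) x⁻¹ := by
  by_cases h0 : x = 0
  · subst h0
    rw [inv_zero]
    exact ⟨⟨0, by simp⟩, by simp⟩
  have hnum : x.num ≠ 0 := Rat.num_ne_zero.2 h0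
  have hinv : x⁻¹ = x.den / x.num := by
    conv_lhs => rw [← Rat.num_div_den x]
    rw [inv_div]
  have hD1 : (1 : ℚ) ≤ D' := by exact_mod_cast hD'
  constructor
  · have hd : x.num ∣ (D' : ℤ) := Int.natAbs_dvd.1 (Int.natCast_dvd_natCast.2 (hn h0))
    obtain ⟨k, hk⟩ := hd
    refine ⟨x.den * k * (D' : ℤ) ^ d, ?_⟩
    have hk' : (D' : ℚ) = x.num * k := by exact_mod_cast hk
    have hnum' : (x.num : ℚ) ≠ 0 := by exact_mod_cast hnum
    push_cast
    rw [hinv, pow_succ]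
    nth_rewrite 2 [hk']
    field_simp
  -- The numerator of a nonzero rational number has absolute value at least one.
  · have h1 : |x⁻¹| ≤ x.den := by
      rw [hinv, abs_div, Nat.abs_cast]
      refine div_le_self (by positivity) ?_
      exact_mod_cast Int.one_le_abs hnum
    have h2 : (x.den : ℚ) ≤ (D : ℚ) ^ d := by exact_mod_cast hx.den_le hD
    have h3 : (D : ℚ) ^ d ≤ (D' : ℚ) ^ d :=
      pow_le_pow_left₀ (by positivity) (by exact_mod_cast Nat.le_of_dvd hD' h) d
    exact h1.trans (h2.trans (h3.trans (pow_le_pow_right₀ hD1 (by omega))))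

theorem of_num_den {n : ℕ} (hden : x.den ∣ n) (hle : x.num.natAbs ≤ n) : IsGood n 1 x := by
  obtain ⟨k, rfl⟩ := hden
  refine ⟨⟨x.num * k, ?_⟩, ?_⟩
  · push_cast
    rw [pow_one, ← mul_assoc, Rat.mul_den_eq_num]
  · rw [pow_one]
    have h2 : |x| * x.den = ((x.num.natAbs : ℕ) : ℚ) := by
      rw [Nat.cast_natAbs, Int.cast_abs, ← Rat.mul_den_eq_num x, abs_mul, Nat.abs_cast]
    have h3 : |x| ≤ |x| * x.den := by
      have : (1 : ℚ) ≤ x.den := by exact_mod_cast x.pos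
      exact le_mul_of_one_le_right (abs_nonneg _) this
    refine h3.trans (h2.le.trans ?_)
    exact_mod_cast hle

end IsGood

/-- The filtration of the rational numbers by powers of a common denominator. -/
def ratGrading {M D : ℕ} (hM : M ≤ D) (hD : 2 ≤ D) : Grading bitSize M (3 * D.size + 3) where
  Good := IsGood D
  mono h hx := hx.mono (by omega) h
  add hx hy := hx.add hD hy
  sub hx hy := by rw [sub_eq_add_neg]; exact hx.add hD hy.neg
  mul hx hy := hx.mul hy
  sum hn h := IsGood.sum (hn.trans hM) h
  cast {n} hn := by
    have := IsGood.intCast (D := D) (d := 1) (n := (n : ℤ)) (by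
      simpa using (Nat.cast_le (α := ℚ)).2 (hn.trans hM))
    simpa using this
  size_le hx := hx.bitSize_le (by omega)

/-- A common denominator for a finite family of rational numbers. -/
theorem exists_denominator {ι : Type} [Fintype ι] (M : ℕ) (f : ι → ℚ) :
    ∃ D, M ≤ D ∧ 2 ≤ D ∧ (∀ i, IsGood D 1 (f i)) ∧
      D.size ≤ M + 3 + ∑ i, (bitSize (f i) + 1) := by
  -- The factor `g i` is divisible by the denominator and exceeds the absolute value of the
  -- numerator, so the product serves both conditions of `IsGood`. The further factor `M + 2`
  -- ensures the lower bounds for `D`.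
  let g : ι → ℕ := fun i => (f i).den * ((f i).num.natAbs + 1)
  have hg : ∀ i, 0 < g i := fun i => Nat.mul_pos (f i).pos (by omega)
  have hprod : 0 < ∏ i, g i := Finset.prod_pos fun i _ => hg i
  have hdvd : ∀ i, g i ∣ (M + 2) * ∏ i, g i := fun i =>
    (Finset.dvd_prod_of_mem g (Finset.mem_univ i)).mul_left _
  have hle := Nat.le_mul_of_pos_right (M + 2) hprod
  refine ⟨(M + 2) * ∏ i, g i, by omega, by omega, fun i => ?_, ?_⟩
  · refine IsGood.of_num_den ((Dvd.intro _ rfl).trans (hdvd i)) ?_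
    have h1 := Nat.le_of_dvd (by positivity) (hdvd i)
    have h2 : (f i).num.natAbs + 1 ≤ g i := Nat.le_mul_of_pos_left _ (f i).pos
    omega
  · have h1 := size_mul_le (M + 2) (∏ i, g i)
    have h2 := size_le_self (M + 2)
    have h3 := size_prod_le Finset.univ g
    have h4 : ∑ i, (g i).size ≤ ∑ i, (bitSize (f i) + 1) := Finset.sum_le_sum fun i _ => by
      have h5 := size_mul_le (f i).den ((f i).num.natAbs + 1)
      have h6 := size_succ_le (f i).num.natAbs
      simp only [g, bitSize]
      omega
    omega

/-- A common denominator for a finite family and for inverses of good numbers. -/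
theorem exists_denominator_inv {ι : Type} [Fintype ι] {D d : ℕ} (hD : 2 ≤ D) (f : ι → ℚ)
    (hf : ∀ i, IsGood D d (f i)) :
    ∃ D', D ∣ D' ∧ 1 ≤ D' ∧ (∀ i, IsGood D' (d + 1) (f i)⁻¹) ∧
      D'.size ≤ D.size + 1 + Fintype.card ι * (2 * d * D.size + 3) := by
  -- The maximum with `1` keeps the product positive when some of the numbers are zero; their
  -- inverses are zero and require no divisibility.
  let g : ι → ℕ := fun i => max 1 (f i).num.natAbs
  have hprod : 0 < ∏ i, g i := Finset.prod_pos fun i _ => by simp [g]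
  have hpos : 1 ≤ D * ∏ i, g i := Nat.mul_pos (by omega) hprod
  refine ⟨D * ∏ i, g i, Dvd.intro _ rfl, hpos, fun i => ?_, ?_⟩
  · refine (hf i).inv (by omega) hpos (Dvd.intro _ rfl) fun h0 => ?_
    have h1 : (f i).num.natAbs = g i :=
      (max_eq_right (Int.natAbs_pos.2 (Rat.num_ne_zero.2 h0))).symm
    rw [h1]
    exact (Finset.dvd_prod_of_mem g (Finset.mem_univ i)).mul_left _
  · have h1 := size_mul_le D (∏ i, g i)
    have h3 := size_prod_le Finset.univ g
    have h4 : ∑ i, (g i).size ≤ ∑ i : ι, (2 * d * D.size + 3) := Finset.sum_le_sum fun i _ => by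
      have h5 : g i ≤ D ^ d * D ^ d :=
        max_le (Nat.mul_pos (Nat.pow_pos (by omega)) (Nat.pow_pos (by omega)))
          ((hf i).num_le (by omega))
      have h6 := Nat.size_le_size h5
      have h7 := size_mul_le (D ^ d) (D ^ d)
      have h8 := size_pow_le D d
      have h9 : 2 * d * D.size = 2 * (d * D.size) := by ring
      omega
    rw [Finset.sum_const, Finset.card_univ, smul_eq_mul] at h4
    omega

end

/-! ### Rational instances: lengths of the transition probabilities and a common denominator -/

section

/-- Without external calls, the size of an array entry is bounded by the time that was needed to
write it. -/
theorem Exec.size_farr_le {K : Type} [Field K] [LinearOrder K] {sz : K → ℕ} {p : Com}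
    {s s' : State K} {t : ℕ} (h : Exec sz (fun _ _ _ _ => False) p s s' t) (T j : ℕ) :
    sz (s'.farr T j) ≤ max (sz (s.farr T j)) t := by
  induction h with
  | fieldStore s T' a b =>
    by_cases h1 : T = T'
    · subst h1
      simp only [State.storeF, Function.update_self]
      by_cases h2 : j = s.nreg a
      · subst h2
        rw [Function.update_self]
        omega
      · rw [Function.update_of_ne h2]
        exact le_max_left _ _
    · simp only [State.storeF, Function.update_of_ne h1]
      exact le_max_left _ _
  | call s T a b c out t h => exact h.elim
  | seq _ _ ih₁ ih₂ => omega
  | ifNat_true _ _ ih => omega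
  | ifNat_false _ _ ih => omega
  | ifField_true _ _ ih => omega
  | ifField_false _ _ ih => omega
  | while_true _ _ _ ih₁ ih₂ => omega
  | _ => exact le_max_left _ _

theorem bitSize_zero : bitSize 0 = 1 := by
  simp [bitSize]

/-- The machine is charged the length of every number that it stores, so its running time bounds the
entries of its output. The summand `1` accounts for cells that were never written, since zero has
length one. -/
theorem bitSize_trans_le {I : Instance ℚ} {r : Polynomial ℕ}
    (hI : I.Q.Implements bitSize I.P r) {x n : ℕ} (hn : 0 < n) (hx : n + I.m ≤ x)
    (a b : Fin I.m) : bitSize (I.P.trans n a b) ≤ r.eval x + 1 := by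
  obtain ⟨out, t, ⟨s', he, rfl⟩, ht, hout⟩ := hI n hn
  rw [← hout]
  have h1 := he.size_farr_le 0 (a * I.m + b)
  have h2 : bitSize ((I.Q.start n I.m).farr 0 (a * I.m + b)) = 1 := bitSize_zero
  have h3 := eval_mono r hx
  omega

section Good
variable {K : Type} [Field K] [LinearOrder K] {sz : K → ℕ} {M B : ℕ} (G : Grading sz M B)

theorem Grading.zero : G.Good 1 0 := by simpa using G.cast (Nat.zero_le M)

/-- Each step of the recursion multiplies by one entry of degree one and forms one sum, which adds
two to the degree. No division is involved, so these bounds are available before inverses are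
considered. -/
theorem Grading.next (c : Chain K) {ℓ : ℕ} (hM : 1 ≤ M) (hm : c.m ≤ M)
    (hP : ∀ j < ℓ, ∀ v u, G.Good 1 (c.P j v u)) {j : ℕ} (hj : j < ℓ) (a u : ℕ) :
    G.Good (2 * j + 3) (c.next j a u) := by
  have h1 : G.Good 1 1 := by simpa using G.cast hM
  have key : ∀ j ≤ ℓ, ∀ a u, G.Good (2 * j + 1) (c.nTab j a u) := fun j => by
    induction j with
    | zero =>
      intro _ a u
      simp only [Chain.nTab]
      split_ifs
      · exact h1
      · exact G.zero
    | succ j ih =>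
      intro hj a u
      simp only [Chain.nTab]
      split_ifs
      · exact G.mono (by omega) h1
      · exact G.mono (by omega) G.zero
      · exact G.mono (by omega)
          (G.sum hm fun v _ => G.mul (ih (by omega) a v) (hP j hj v u))
  exact G.mono (by omega) (G.sum hm fun v _ => G.mul (key j hj.le a v) (hP j hj v u))

theorem chainOf_P_good {m ℓ : ℕ} {A : WA K m} {w : Word m ℓ} {i : Fin ℓ} {P : Markov K m}
    (hi : ∀ u, G.Good 1 (P.init u))
    (ht : ∀ n, 0 < n → n < ℓ → ∀ a b, G.Good 1 (P.trans n a b)) {j : ℕ} (hj : j < ℓ) (v u : ℕ) :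
    G.Good 1 ((chainOf A w i P).P j v u) := by
  simp only [chainOf]
  split_ifs with h1 h2 h2
  · exact Prog.arrayOf_good hi G.zero u
  · exact G.zero
  · exact ht j (by omega) hj _ _
  · exact G.zero

end Good

/-- A bound for the binary length of a common denominator of the input. -/
def inputLength (r : Polynomial ℕ) (x : ℕ) : ℕ :=
  Prog.bnd (regBound x) + 3 +
    (x + (x + (x + (x * (x * x) + x))) + x * (x * x) * (r.eval x + 2))

/-- A bound for the binary length of a common denominator of the input and the inverses. -/
def totalLength (r : Polynomial ℕ) (x : ℕ) : ℕ :=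
  inputLength r x + 1 + (x * x + x) * (2 * (2 * x + 3) * inputLength r x + 3)

theorem polyBdd_inputLength (r : Polynomial ℕ) : PolyBdd (inputLength r) :=
  have cube : PolyBdd fun x => x * (x * x) := PolyBdd.id.mul (PolyBdd.id.mul .id)
  ((Prog.polyBdd_bnd.comp polyBdd_regBound).add (.const 3)).add
    ((PolyBdd.id.add (PolyBdd.id.add (PolyBdd.id.add (cube.add .id)))).add
      (cube.mul ((PolyBdd.poly r).add (.const 2))))

theorem polyBdd_totalLength (r : Polynomial ℕ) : PolyBdd (totalLength r) :=
  ((polyBdd_inputLength r).add (.const 1)).add (((PolyBdd.id.mul .id).add .id).mul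
    ((((PolyBdd.const 2).mul (((PolyBdd.const 2).mul .id).add (.const 3))).mul
      (polyBdd_inputLength r)).add (.const 3)))

theorem polyBdd_unitCost {δ B T : ℕ → ℕ} (hδ : PolyBdd δ) (hB : PolyBdd B) (hT : PolyBdd T) :
    PolyBdd fun x => unitCost x (δ x) (B x) (T x) :=
  have h6 : PolyBdd fun x => δ x + 6 := hδ.add (.const 6)
  (((PolyBdd.const 1).add ((PolyBdd.const 3).mul (Prog.polyBdd_bnd.comp polyBdd_regBound))).add
    ((PolyBdd.const 3).mul (((((PolyBdd.const 1).add (PolyBdd.id.mul h6)).add h6).add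
      (.const 1)).mul hB))).add hT

/-- All numbers that occur on a rational instance have a common denominator of polynomial length. -/
theorem exists_rat_resources {I : Instance ℚ} {r : Polynomial ℕ}
    (hI : I.Q.Implements bitSize I.P r) {x : ℕ} (hx : I.A.size + I.m + I.len + I.bits = x) :
    ∃ (B : ℕ) (G : Grading bitSize (Prog.bnd (regBound x)) B), B ≤ 3 * totalLength r x + 3 ∧
      Resources G I (regBound x) (2 * x + 4)
        (1 + x * (2 * x + 4 + 6) + (2 * x + 4 + 6)) (r.eval x)
        (unitCost x (2 * x + 4) B (r.eval x)) := by
  have hle : I.A.size + I.m + I.len ≤ x := by omega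
  obtain ⟨-, hmV, -⟩ := regBound_bounds hle
  have hM1 : regBound x + 1 ≤ Prog.bnd (regBound x) := by
    simp only [Prog.bnd]; omega
  have hxV : x ≤ regBound x := by
    have : x + 1 ≤ (x + 1) ^ 4 := Nat.le_self_pow (by norm_num) _
    rw [regBound]; omega
  -- The matrix at index `0` is replaced by zeros: the machine guarantees nothing about it, so its
  -- entries have no length bound.
  let f : (Fin I.A.size ⊕ Fin I.A.size ⊕ (Fin I.m × Fin I.A.size × Fin I.A.size) ⊕ Fin I.m ⊕
      (Fin I.len × Fin I.m × Fin I.m)) → ℚ :=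
    Sum.elim I.A.init (Sum.elim I.A.final (Sum.elim (fun q => I.A.trans q.1 q.2.1 q.2.2)
      (Sum.elim I.P.init fun q => if (q.1 : ℕ) = 0 then 0 else I.P.trans q.1 q.2.1 q.2.2)))
  obtain ⟨D, hMD, hD2, hgood, hsize⟩ := exists_denominator (Prog.bnd (regBound x)) f
  have hDs : D.size ≤ inputLength r x := by
    refine hsize.trans (Nat.add_le_add_left ?_ _)
    have h5 : ∑ q : Fin I.len × Fin I.m × Fin I.m,
        (bitSize (if (q.1 : ℕ) = 0 then 0 else I.P.trans q.1 q.2.1 q.2.2) + 1) ≤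
          x * (x * x) * (r.eval x + 2) := by
      calc _ ≤ ∑ q : Fin I.len × Fin I.m × Fin I.m, (r.eval x + 2) :=
            Finset.sum_le_sum fun q _ => by
              split_ifs with h0
              · rw [bitSize_zero]; omega
              · have := bitSize_trans_le hI (x := x) (Nat.pos_of_ne_zero h0)
                  (by have := q.1.2; omega) q.2.1 q.2.2
                omega
        _ = I.len * (I.m * I.m) * (r.eval x + 2) := by simp
        _ ≤ _ := Nat.mul_le_mul_right _ (Nat.mul_le_mul (by omega)
            (Nat.mul_le_mul (by omega) (by omega)))
    have h3 : I.m * (I.A.size * I.A.size) ≤ x * (x * x) :=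
      Nat.mul_le_mul (by omega) (Nat.mul_le_mul (by omega) (by omega))
    have hbits : I.bits ≤ x := by omega
    simp only [Instance.bits] at hbits
    have e1 : ∑ y, (bitSize (I.A.init y) + 1) = ∑ y, bitSize (I.A.init y) + I.A.size := by
      simp [Finset.sum_add_distrib]
    have e2 : ∑ y, (bitSize (I.A.final y) + 1) = ∑ y, bitSize (I.A.final y) + I.A.size := by
      simp [Finset.sum_add_distrib]
    have e3 : ∑ q : Fin I.m × Fin I.A.size × Fin I.A.size,
        (bitSize (I.A.trans q.1 q.2.1 q.2.2) + 1) =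
        ∑ a, ∑ y, ∑ z, bitSize (I.A.trans a y z) + I.m * (I.A.size * I.A.size) := by
      rw [Finset.sum_add_distrib]
      congr 1
      · simp only [Fintype.sum_prod_type]
      · simp
    have e4 : ∑ u, (bitSize (I.P.init u) + 1) = ∑ u, bitSize (I.P.init u) + I.m := by
      simp [Finset.sum_add_distrib]
    simp only [f, Fintype.sum_sum_type, Sum.elim_inl, Sum.elim_inr]
    omega
  have hinit : ∀ y, IsGood D 1 (I.A.init y) := fun y => hgood (.inl y)
  have hfinal : ∀ y, IsGood D 1 (I.A.final y) := fun y => hgood (.inr (.inl y))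
  have htrans : ∀ u y z, IsGood D 1 (I.A.trans u y z) := fun u y z =>
    hgood (.inr (.inr (.inl (u, y, z))))
  have hPinit : ∀ u, IsGood D 1 (I.P.init u) := fun u => hgood (.inr (.inr (.inr (.inl u))))
  have hPtrans : ∀ n, 0 < n → n < I.len → ∀ a b, IsGood D 1 (I.P.trans n a b) :=
    fun n h0 hn a b => by
      have := hgood (.inr (.inr (.inr (.inr (⟨n, hn⟩, a, b)))))
      simpa [f, h0.ne'] using this
  -- All divisors that the programme meets: the values of `next` at the symbols of `w`, and the
  -- numbers in the final weights.
  let g : (Fin I.len × Fin I.len) ⊕ Fin I.len → ℚ :=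
    Sum.elim (fun q => (chainOf I.A I.w I.i I.P).next q.1 q.2 ((chainOf I.A I.w I.i I.P).w q.1))
      fun h => ((h : ℕ) : ℚ) * (I.len.choose h : ℚ)
  have hg : ∀ q, IsGood D (2 * x + 3) (g q) := by
    rintro (⟨j, b⟩ | h)
    · exact ((ratGrading hMD hD2).next _ (ℓ := I.len) (by omega) (by rw [chainOf_m]; omega)
        (fun j hj => chainOf_P_good _ hPinit hPtrans hj) j.2 b _).mono (by omega)
        (by have := j.2; omega)
    · have h1 : IsGood D 1 ((h : ℕ) : ℚ) := (ratGrading hMD hD2).cast (by have := h.2; omega)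
      -- A binomial coefficient is at most `2 ^ len`, hence at most `D ^ len`.
      have h2 : IsGood D I.len (I.len.choose h : ℚ) := by
        have h3 : I.len.choose h ≤ D ^ I.len :=
          (Nat.choose_le_two_pow _ _).trans (Nat.pow_le_pow_left hD2 _)
        have := IsGood.intCast (D := D) (d := I.len) (n := (I.len.choose h : ℤ)) (by
          simpa using (Nat.cast_le (α := ℚ)).2 h3)
        simpa using this
      exact (h1.mul h2).mono (by omega) (by omega)
  -- Inverting raises the degree `2 * x + 3` of the divisors by one, whence the value `2 * x + 4` of
  -- `δi`.
  obtain ⟨D', hdvd, hD', hinv, hsize'⟩ := exists_denominator_inv hD2 g hg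
  have hDD' := Nat.le_of_dvd hD' hdvd
  refine ⟨3 * D'.size + 3, ratGrading (hMD.trans hDD') (hD2.trans hDD'), ?_, ?_⟩
  · have hcard : Fintype.card ((Fin I.len × Fin I.len) ⊕ Fin I.len) ≤ x * x + x := by
      simp only [Fintype.card_sum, Fintype.card_prod, Fintype.card_fin]
      exact Nat.add_le_add (Nat.mul_le_mul (by omega) (by omega)) (by omega)
    have : D'.size ≤ totalLength r x := hsize'.trans (Nat.add_le_add (by omega)
      (Nat.mul_le_mul hcard (Nat.add_le_add_right (Nat.mul_le_mul_left _ hDs) _)))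
    omega
  · exact resources_of hI hle (fun y => (hinit y).of_dvd hD' hdvd)
      (fun y => (hfinal y).of_dvd hD' hdvd) (fun u y z => (htrans u y z).of_dvd hD' hdvd)
      (fun u => (hPinit u).of_dvd hD' hdvd)
      (fun n h0 hn a b => (hPtrans n h0 hn a b).of_dvd hD' hdvd)
      (fun j hj b hb => hinv (.inl (⟨j, hj⟩, ⟨b, by omega⟩)))
      fun h hh _ => hinv (.inr ⟨h, hh⟩)

theorem solves_rat (r : Polynomial ℕ) : ∃ p : Polynomial ℕ, ∀ I : Instance ℚ,
    I.Q.Implements bitSize I.P r →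
      Solves bitSize Prog.main I (p.eval (I.A.size + I.m + I.len + I.bits)) := by
  obtain ⟨p, hp⟩ : PolyBdd fun x => Prog.steps (Prog.bnd (regBound x)) *
      unitCost x (2 * x + 4) (3 * totalLength r x + 3) (r.eval x) := by
    exact (Prog.polyBdd_steps.comp (Prog.polyBdd_bnd.comp polyBdd_regBound)).mul
      (polyBdd_unitCost (((PolyBdd.const 2).mul .id).add (.const 4))
        (((PolyBdd.const 3).mul (polyBdd_totalLength r)).add (.const 3)) (.poly r))
  refine ⟨p, fun I hI => ?_⟩
  obtain ⟨B, G, hB, h⟩ := exists_rat_resources hI rfl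
  obtain ⟨s', t, he, ht, hq⟩ := Prog.runs_main h
  refine ⟨s', t, he, ht.trans ((Nat.mul_le_mul_left _ ?_).trans (hp _)), hq⟩
  simp only [unitCost]
  gcongr

end

end ShapMarkov

/-- One program solves the problem exactly.  On all instances over the real numbers, with unit cost
for exact arithmetic, its time is polynomial in the size of the automaton, the size of the alphabet
and the length of the word; on all instances over the rational numbers, with bit cost, its time is
polynomial in the length of the instance.  The polynomial depends only on the polynomial that bounds
the running time of the machine for the distribution. -/
theorem theorem1 :
    ∃ M : Com,
      (∀ r : Polynomial ℕ, ∃ p : Polynomial ℕ, ∀ I : Instance ℝ,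
        I.Q.Implements unitSize I.P r →
          Solves unitSize M I (p.eval (I.A.size + I.m + I.len))) ∧
      (∀ r : Polynomial ℕ, ∃ p : Polynomial ℕ, ∀ I : Instance ℚ,
        I.Q.Implements bitSize I.P r →
          Solves bitSize M I (p.eval (I.A.size + I.m + I.len + I.bits))) := by
  exact ⟨Prog.main, solves_real, solves_rat⟩
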